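/- **Setting.** Let $A\in\mathbb{R}^{n\times d}$ have rows $a_1^\top,\dots,a_n^\top$, let $\phi_1,\dots,\phi_n:\mathbb{R}\to\mathbb{R}$ be smooth, let $m_2>0$ and $$f(x)=\sum_{i=1}^n\phi_i(a_i^\top x)+\frac{m_2}{2}\|x\|_2^2,\qquad x\in\mathbb{R}^d .$$ Assume, for some $M,r>0$, that every $\phi_i'$ has Cauchy estimate $M$ with radius $r$, i.e. $|\phi_i^{(l+1)}(s)|\le M\,l!\,r^{-l}$ for all $s\in\mathbb{R}$ and all integers $l\ge 0$ (in particular this holds with $M=K$, $r=1/K$ if $|\phi_i^{(k)}|\le K^k$ for all $k\ge1$). Assume that $m_2 I\preceq\nabla^2 f(x)\preceq M_2 I$ for all $x$, where $m_2\le M_2$, and put $\kappa=M_2/m_2$ and $\tau=\|AA^\top\|_{\infty\to\infty}=\max_{x\neq0}\|AA^\top x\|_\infty/\|x\|_\infty$ (with $\tau=0$ if $n=0$). Let $0<\epsilon$, and write $\Lambda=\log\!\left(2+n+d+\kappa+\frac{\tau}{m_2}+\frac1\epsilon\right)$. **Algorithm.** Hamiltonian Monte Carlo (HMC) with step size $h$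 starts at $x^{(0)}$. In iteration $k=1,\dots,N$ it draws a fresh $v\sim\mathcal{N}(0,I_d)$ and replaces $x^{(k-1)}$ by an approximation $x^{(k)}$ of $x(h)$, where $x''=-\nabla f(x)$, $x'(0)=v$, $x(0)=x^{(k-1)}$. The approximation is computed by the collocation method with $D$ nodes and $J$ rounds: with the Chebyshev nodes $c_i=\frac12\left(1-\cos\frac{(2i+1)\pi}{2D}\right)$, $0\le i<D$, of $[0,1]$ and their Lagrange basis polynomials $\ell_j$, one starts from $p_i=x^{(k-1)}$, $w_i=v$, then $J$ times replaces, simultaneously for all $i$, $$p_i\leftarrow x^{(k-1)}+h\sum_j w_j\int_0^{c_i}\ell_j,\qquad w_i\leftarrow v-h\sum_j\nabla f(p_j)\int_0^{c_i}\ell_j ,$$ and finally sets $x^{(k)}=x^{(k-1)}+h\sum_j w_j\int_0^1\ell_j$. The method accesses $f$ only through an oracle for $\nabla f$; its time is the number of elementary real operations (arithmetic operations, moves of real numbers, and samples of a scalar Gaussian), and the evaluations of $\nabla f$ are counted separately. The coefficients $h\int_0^{c_i}\ell_j$, $h\int_0^1\ell_j$ are constants of the program. **Theorem.** There is an absolute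 constant $p\in\mathbb{N}$, and for all $M,r>0$ there is a constant $C>0$ depending only on $M$ and $r$, such that the following holds. For all $n,d,m_2,M_2,\tau,\epsilon$ there are a step size $0<h\le\frac{m_2^{1/4}}{2M_2^{3/4}}$ and $D,J,N\in\mathbb{N}$, depending only on these numbers and on $M,r$, such that for all $A,\phi_1,\dots,\phi_n$ as above, started at $x^{(0)}=0$ or at the minimizer $x^{(0)}$ of $f$, the output $X=x^{(N)}$ of HMC satisfies $$W_2(X,Y)\le\frac{\epsilon}{\sqrt{m_2}},\qquad Y\ \text{drawn from the density proportional to } e^{-f}.$$ The number of iterations is $$N\le C\left(\kappa^{1.5}+\frac{\tau}{m_2}\right)\Lambda^p=\widetilde O\!\left(\kappa^{1.5}+\frac{\tau}{m_2}\right),$$ and each iteration takes time at most $C\,d\,\Lambda^p=\widetilde O(d)$ and at most $C\,\Lambda^p=\widetilde O(1)$ evaluations of $\nabla f$. Here $W_2(\mu,\nu)=\left(\inf\mathbb{E}\|X-Y\|_2^2\right)^{1/2}$, the infimum being over all couplings $(X,Y)$ of $\mu$ and $\nu$. -/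

import Mathlib

open MeasureTheory ProbabilityTheory
open scoped Matrix ENNReal ContDiff

noncomputable section

namespace HMCSampling

/-- Cauchy estimate `M` with radius `r`: `|φ^(l)(x)| ≤ M · l! · r^(-l)` for all `x` and `l ≥ 0`. -/
def HasCauchyEstimate (φ : ℝ → ℝ) (M r : ℝ) : Prop :=
  ∀ (x : ℝ) (l : ℕ), |iteratedDeriv l φ x| ≤ M * (l.factorial : ℝ) * (r ^ l)⁻¹

/-- `f(x) = ∑ᵢ φᵢ(aᵢᵀ x) + (m₂ / 2) ‖x‖²`, where `aᵢ` is the `i`-th row of `A`. -/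
def potential {n d : ℕ} (A : Matrix (Fin n) (Fin d) ℝ) (φ : Fin n → ℝ → ℝ) (m₂ : ℝ)
    (x : EuclideanSpace ℝ (Fin d)) : ℝ :=
  ∑ i, φ i ((A *ᵥ x.ofLp) i) + m₂ / 2 * ‖x‖ ^ 2

/-- `m · I ⪯ ∇²f(x) ⪯ M · I` for all `x`, as quadratic forms. -/
def HessianBounds {d : ℕ} (f : EuclideanSpace ℝ (Fin d) → ℝ) (m M : ℝ) : Prop :=
  ∀ x w : EuclideanSpace ℝ (Fin d),
    m * ‖w‖ ^ 2 ≤ iteratedFDeriv ℝ 2 f x ![w, w] ∧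
      iteratedFDeriv ℝ 2 f x ![w, w] ≤ M * ‖w‖ ^ 2

/-- `‖B‖_{∞→∞}`: the operator norm of `B` on `ℝⁿ` with the sup norm. -/
def inftyOpNorm {n : ℕ} (B : Matrix (Fin n) (Fin n) ℝ) : ℝ :=
  ‖LinearMap.toContinuousLinearMap (Matrix.toLin' B)‖

/-- The probability measure with density proportional to `e^{-f}`. -/
def gibbs {d : ℕ} (f : EuclideanSpace ℝ (Fin d) → ℝ) : Measure (EuclideanSpace ℝ (Fin d)) :=
  (volume : Measure (EuclideanSpace ℝ (Fin d))).tilted (fun x => -f x)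

/-- The `k`-th Wasserstein distance: infimum over all couplings `γ` of `μ` and `ν`. -/
def wasserstein {E : Type*} [MeasurableSpace E] [PseudoEMetricSpace E] (k : ℕ)
    (μ ν : Measure E) : ℝ≥0∞ :=
  (⨅ (γ : Measure (E × E)) (_ : γ.map Prod.fst = μ ∧ γ.map Prod.snd = ν),
    ∫⁻ z, edist z.1 z.2 ^ k ∂γ) ^ (1 / (k : ℝ))

/-! ### Straight-line programs over vector registers, with an oracle for the gradient

Registers are numbered by `ℕ` and hold vectors of `ℝᵈ`. -/

/-- Instructions. `copy t s`: `Rₜ := Rₛ`. `addMul t s u c`: `Rₜ := Rₛ + c Rᵤ`.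
`grad t s`: `Rₜ := ∇f(Rₛ)`, one call of the gradient oracle. -/
inductive Instr : Type
  | copy (t s : ℕ)
  | addMul (t s u : ℕ) (c : ℝ)
  | grad (t s : ℕ)

/-- Execution of an instruction; `g` is the gradient oracle. -/
def Instr.exec {E : Type*} [AddCommGroup E] [Module ℝ E] (g : E → E) :
    Instr → (ℕ → E) → (ℕ → E)
  | .copy t s, R => Function.update R t (R s)
  | .addMul t s u c, R => Function.update R t (R s + c • R u)
  | .grad t s, R => Function.update R t (g (R s))

/-- Number of elementary operations on real numbers in dimension `d`: `d` moves for `copy`, `d`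
multiplications and `d` additions for `addMul`, and `2 d` moves for passing the argument to the
oracle and storing its answer. -/
def Instr.time (d : ℕ) : Instr → ℕ
  | .copy _ _ => d
  | .addMul _ _ _ _ => 2 * d
  | .grad _ _ => 2 * d

/-- Number of oracle calls. -/
def Instr.gradEvals : Instr → ℕ
  | .copy _ _ => 0
  | .addMul _ _ _ _ => 0
  | .grad _ _ => 1

/-- A program is a list of instructions, executed in order. -/
abbrev Program : Type := List Instr

def Program.exec {E : Type*} [AddCommGroup E] [Module ℝ E] (g : E → E) (P : Program)
    (R : ℕ → E) : ℕ → E :=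
  P.foldl (fun R i => i.exec g R) R

def Program.time (d : ℕ) (P : Program) : ℕ := (P.map (Instr.time d)).sum

def Program.gradEvals (P : Program) : ℕ := (P.map Instr.gradEvals).sum

/-! ### The collocation method for `x'' = -∇f(x)`, `x'(0) = v`, `x(0) = x₀` on `[0, h]`

The equation is solved as the first-order system `x' = w`, `w' = -∇f(x)`. The right-hand sides are
interpolated by polynomials of degree less than `D` at Chebyshev nodes and integrated exactly, and
the resulting fixed-point equation for the nodal values is iterated `J` times, starting from the
constant functions `x₀` and `v`. -/

/-- The `i`-th of the `D` Chebyshev nodes, transported to `[0, 1]`. -/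
def chebNode (D i : ℕ) : ℝ := (1 - Real.cos ((2 * i + 1) * Real.pi / (2 * D))) / 2

/-- The integral from `0` to `t` of the `j`-th Lagrange basis polynomial of these nodes. -/
def weight (D j : ℕ) (t : ℝ) : ℝ :=
  ∫ s in (0 : ℝ)..t, (Lagrange.basis (Finset.range D) (chebNode D) j).eval s

/-- Register of the position at the `i`-th node (registers `0` and `1` hold `x₀` and `v`). -/
def posReg (i : ℕ) : ℕ := 3 * i + 2

/-- Register of the velocity at the `i`-th node. -/
def velReg (i : ℕ) : ℕ := 3 * i + 3

/-- Register of the gradient at the `i`-th node. -/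
def gradReg (i : ℕ) : ℕ := 3 * i + 4

/-- All nodal positions are set to `x₀`, all nodal velocities to `v`. -/
def initProgram (D : ℕ) : Program :=
  (List.range D).flatMap fun i => [.copy (posReg i) 0, .copy (velReg i) 1]

/-- One fixed-point iteration, at the node times `h cᵢ`, with `Wᵢⱼ = ∫₀^{cᵢ} ℓⱼ`:
`pᵢ ← x₀ + h ∑ⱼ Wᵢⱼ wⱼ` and `wᵢ ← v - h ∑ⱼ Wᵢⱼ ∇f(pⱼ)`, simultaneously for all `i`. -/
def sweepProgram (D : ℕ) (h : ℝ) : Program :=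
  ((List.range D).map fun j => Instr.grad (gradReg j) (posReg j)) ++
  ((List.range D).flatMap fun i =>
    Instr.copy (posReg i) 0 :: (List.range D).map fun j =>
      Instr.addMul (posReg i) (posReg i) (velReg j) (h * weight D j (chebNode D i))) ++
  ((List.range D).flatMap fun i =>
    Instr.copy (velReg i) 1 :: (List.range D).map fun j =>
      Instr.addMul (velReg i) (velReg i) (gradReg j) (-(h * weight D j (chebNode D i))))

/-- The approximation `x₀ + h ∑ⱼ (∫₀¹ ℓⱼ) wⱼ` of `x(h)` is put into register `0`. -/
def outputProgram (D : ℕ) (h : ℝ) : Program :=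
  (List.range D).map fun j => Instr.addMul 0 0 (velReg j) (h * weight D j 1)

/-- The ODE solver, with `D` nodes and `J` fixed-point iterations. -/
def odeProgram (D J : ℕ) (h : ℝ) : Program :=
  initProgram D ++ (List.replicate J (sweepProgram D h)).flatten ++ outputProgram D h

/-- The output of the ODE solver: register `0`, when `x` and `v` are put into registers `0`
and `1` and the oracle is `∇f`. -/
def odeSolve {d : ℕ} (f : EuclideanSpace ℝ (Fin d) → ℝ) (D J : ℕ) (h : ℝ)
    (x v : EuclideanSpace ℝ (Fin d)) : EuclideanSpace ℝ (Fin d) :=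
  Program.exec (gradient f) (odeProgram D J h)
    (Function.update (Function.update (fun _ => 0) 0 x) 1 v) 0

/-! ### Hamiltonian Monte Carlo -/

/-- The law of the `N`-th iterate of HMC started at `x₀`: in each iteration a fresh `v ∼ N(0, I)`
is drawn and the current point `x` is replaced by the output of the ODE solver. -/
def hmcLaw {d : ℕ} (f : EuclideanSpace ℝ (Fin d) → ℝ) (D J : ℕ) (h : ℝ)
    (x₀ : EuclideanSpace ℝ (Fin d)) : ℕ → Measure (EuclideanSpace ℝ (Fin d))
  | 0 => Measure.dirac x₀
  | N + 1 => ((hmcLaw f D J h x₀ N).prod (stdGaussian (EuclideanSpace ℝ (Fin d)))).map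
      fun z => odeSolve f D J h z.1 z.2

/-- Time of one iteration: `d` samples of a scalar Gaussian, then the ODE solver. -/
def iterationTime (d D J : ℕ) (h : ℝ) : ℕ := d + (odeProgram D J h).time d

/-- Number of evaluations of `∇f` in one iteration. -/
def iterationGradEvals (D J : ℕ) (h : ℝ) : ℕ := (odeProgram D J h).gradEvals

/-- The logarithm whose powers are suppressed by `Õ`. -/
def logFactor (n d : ℕ) (κ ρ ε : ℝ) : ℝ := Real.log (2 + n + d + κ + ρ + 1 / ε)

end HMCSampling

end

/-! The chain of the algorithm is coupled with the chain of exact Hamiltonian flows started from the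
Gibbs measure, both driven by the same Gaussian velocities. The exact chain is stationary: the flow
conserves the energy and is a limit of volume-preserving symplectic Euler steps
(`measurePreserving_flow`). The expected squared distance of the two chains therefore bounds W₂
squared. Three ingredients control it.

Contraction. By cocoercivity of the gradient, two exact trajectories with the same initial velocity
approach each other by the factor 1 - m h²/8 as soon as h² K ≤ 1/4 (`IsTraj.sq_dist_le`,
`IsTraj.dist_le`). So about log / (m h²) steps suffice.

Accuracy. Call a position good if all |⟨aᵢ, x⟩| ≤ B and ‖x‖ ≤ R, and a velocity good if its
components along the aᵢ and along the coordinate axes are not large. From good data and for small h,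
the quantities ⟨aᵢ, ·⟩ vary by less than half the Cauchy radius r. The Picard iterates of the field
with Taylor polynomials in place of the profiles are then polynomial curves ∑ sᵏ cₖ with ∑ 2ᵏ ‖cₖ‖
bounded independently of the Taylor order. In the limit the force along the trajectory is within
about 2^(-D) of a polynomial of degree less than D (`IsRegularRidge.polyApprox_force`). The
Chebyshev weights are bounded by 2 (`abs_weight_le`), so a fixed-point sweep halves the error, and D
+ 1 nodes with D sweeps are accurate to 2^(-D) up to powers of D and the size of the data.

Staying good. Along aᵢ the force is m ⟨aᵢ, x⟩ plus a term of size at most τ M. The linear part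
damps, so good velocities keep good positions good (`damped_bound`, `IsRegularRidge.good_step`). Bad
velocities are handled in expectation: a quadratic Lyapunov function grows by at most exp(O(ℓ³))
over the whole run, whereas bad velocities contribute only about exp(-G²/2) with G = ℓ^10
(`lintegral_chainLaw_le`).

Here ℓ is a constant multiple of Λ, the step is c / (ℓ^12 b) in units of m₂^(-1/2), and b² = κ^(3/2)
+ ρ + 1 with ρ = τ / m₂. The term ρ is what analyticity along the aᵢ demands. Contraction and solver
need only κ ≤ b²; the power 3/2 serves the prescribed bound on the step size. -/

noncomputable section

namespace HMCSampling

open Set Filter Topology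
open scoped RealInnerProductSpace NNReal

/-! ### Strongly convex functions with Lipschitz gradient -/

/-- Two-sided quadratic bounds for `f`, with `g` in the role of the gradient. -/
structure QuadBounds {E : Type*} [NormedAddCommGroup E] [InnerProductSpace ℝ E]
    (f : E → ℝ) (g : E → E) (m K : ℝ) : Prop where
  lower : ∀ x y, f x + ⟪g x, y - x⟫ + m / 2 * ‖y - x‖ ^ 2 ≤ f y
  upper : ∀ x y, f y ≤ f x + ⟪g x, y - x⟫ + K / 2 * ‖y - x‖ ^ 2

namespace QuadBounds

variable {E : Type*} [NormedAddCommGroup E] [InnerProductSpace ℝ E]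
  {f : E → ℝ} {g : E → E} {m K : ℝ}

lemma strongMono (H : QuadBounds f g m K) (x y : E) :
    m * ‖x - y‖ ^ 2 ≤ ⟪g x - g y, x - y⟫ := by
  have h1 := H.lower x y
  have h2 := H.lower y x
  have h3 : ⟪g x, y - x⟫ = -⟪g x, x - y⟫ := by rw [← inner_neg_right, neg_sub]
  rw [inner_sub_left]
  rw [h3, norm_sub_rev y x] at h1
  linarith

/-- The point y - K⁻¹(g y - g x) is a gradient step for f minus its linearization at x. The upper
bound based at y and the lower bound based at x are compared there. -/
lemma gap (H : QuadBounds f g m K) (hm : 0 ≤ m) (hK : 0 < K) (x y : E) :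
    f x + ⟪g x, y - x⟫ + ‖g y - g x‖ ^ 2 / (2 * K) ≤ f y := by
  set G := g y - g x with hG
  have h1 := H.lower x (y - K⁻¹ • G)
  have h2 := H.upper y (y - K⁻¹ • G)
  have e1 : y - K⁻¹ • G - y = -(K⁻¹ • G) := by abel
  have e2 : y - K⁻¹ • G - x = (y - x) - K⁻¹ • G := by abel
  rw [e1, norm_neg, norm_smul, inner_neg_right, inner_smul_right] at h2
  rw [e2, inner_sub_right, inner_smul_right] at h1
  have h3 : ⟪g y, G⟫ - ⟪g x, G⟫ = ‖G‖ ^ 2 := by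
    rw [← inner_sub_left, ← hG, real_inner_self_eq_norm_sq]
  have h4 : 0 ≤ m / 2 * ‖y - x - K⁻¹ • G‖ ^ 2 := by positivity
  rw [Real.norm_of_nonneg (by positivity)] at h2
  have h5 : K / 2 * (K⁻¹ * ‖G‖) ^ 2 = ‖G‖ ^ 2 / (2 * K) := by field_simp
  have h6 : K⁻¹ * ⟪g y, G⟫ - K⁻¹ * ⟪g x, G⟫ = 2 * (‖G‖ ^ 2 / (2 * K)) := by
    rw [← mul_sub, h3]; field_simp
  linarith

/-- The sum of `gap` for (x, y) and for (y, x). In the contraction proof it pays for the quadratic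
error term with the gain itself, which is why no smallness beyond h² K ≤ 1/4 is needed. -/
lemma cocoercive (H : QuadBounds f g m K) (hm : 0 ≤ m) (hK : 0 < K) (x y : E) :
    ‖g x - g y‖ ^ 2 ≤ K * ⟪g x - g y, x - y⟫ := by
  have h1 := H.gap hm hK x y
  have h2 := H.gap hm hK y x
  have h3 : ⟪g x, y - x⟫ = -⟪g x, x - y⟫ := by rw [← inner_neg_right, neg_sub]
  rw [h3, norm_sub_rev (g y)] at h1
  rw [inner_sub_left]
  have : ‖g x - g y‖ ^ 2 = K * (2 * (‖g x - g y‖ ^ 2 / (2 * K))) := by field_simp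
  rw [this]
  gcongr
  linarith

lemma norm_sub_le (H : QuadBounds f g m K) (hm : 0 ≤ m) (hK : 0 < K) (x y : E) :
    ‖g x - g y‖ ≤ K * ‖x - y‖ := by
  have h1 := H.cocoercive hm hK x y
  have h2 := real_inner_le_norm (g x - g y) (x - y)
  rcases (norm_nonneg (g x - g y)).eq_or_lt with h | h
  · rw [← h]; positivity
  · have : ‖g x - g y‖ * ‖g x - g y‖ ≤ ‖g x - g y‖ * (K * ‖x - y‖) := by nlinarith
    exact le_of_mul_le_mul_left this h

lemma lipschitz (H : QuadBounds f g m K) (hm : 0 ≤ m) (hK : 0 < K) :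
    LipschitzWith ⟨K, hK.le⟩ g :=
  LipschitzWith.of_dist_le_mul fun x y => by
    rw [dist_eq_norm, dist_eq_norm]; exact H.norm_sub_le hm hK x y

end QuadBounds

/-- Applied to f and to -f along a segment, this yields both halves of `QuadBounds`. -/
lemma taylor_two_lower {u u₁ u₂ : ℝ → ℝ} {c : ℝ} (h1 : ∀ t, HasDerivAt u (u₁ t) t)
    (h2 : ∀ t, HasDerivAt u₁ (u₂ t) t) (hc : ∀ t, c ≤ u₂ t) : u 0 + u₁ 0 + c / 2 ≤ u 1 := by
  have A : ∀ t, 0 ≤ t → u₁ 0 + c * t ≤ u₁ t := by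
    have hd : ∀ t, HasDerivAt (fun t => u₁ t - c * t) (u₂ t - c) t := fun t => by
      exact ((h2 t).sub ((hasDerivAt_id t).const_mul c)).congr_deriv (by simp)
    have : Monotone (fun t => u₁ t - c * t) :=
      monotone_of_deriv_nonneg (fun t => (hd t).differentiableAt)
        (fun t => by rw [(hd t).deriv]; linarith [hc t])
    intro t ht
    have := this ht
    simp only [mul_zero, sub_zero] at this
    linarith
  have hd : ∀ t, HasDerivAt (fun t => u t - u₁ 0 * t - c / 2 * t ^ 2) (u₁ t - u₁ 0 - c * t) t :=
    fun t => by
      have := ((h1 t).sub ((hasDerivAt_id t).const_mul (u₁ 0))).sub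
        (((hasDerivAt_id t).pow 2).const_mul (c / 2))
      refine this.congr_deriv ?_
      simp; ring
  have : MonotoneOn (fun t => u t - u₁ 0 * t - c / 2 * t ^ 2) (Ici 0) := by
    refine monotoneOn_of_deriv_nonneg (convex_Ici 0)
      (fun t _ => (hd t).continuousAt.continuousWithinAt)
      (fun t _ => (hd t).differentiableAt.differentiableWithinAt) (fun t ht => ?_)
    rw [interior_Ici] at ht
    rw [(hd t).deriv]
    linarith [A t (le_of_lt ht)]
  have := this (by simp : (0 : ℝ) ∈ Ici 0) (by simp : (1 : ℝ) ∈ Ici 0) zero_le_one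
  simp at this
  linarith

lemma quadBounds_of_hessianBounds {d : ℕ} {f : EuclideanSpace ℝ (Fin d) → ℝ} {m K : ℝ}
    (hf : ContDiff ℝ 2 f) (H : HessianBounds f m K) : QuadBounds f (gradient f) m K := by
  have hd : Differentiable ℝ f := hf.differentiable (by norm_num)
  have hd2 : Differentiable ℝ (fderiv ℝ f) :=
    (hf.fderiv_right (m := 1) (by norm_num)).differentiable (by norm_num)
  have hline : ∀ x w : EuclideanSpace ℝ (Fin d), ∀ t : ℝ,
      HasDerivAt (fun t : ℝ => x + t • w) w t := fun x w t => by
    simpa using ((hasDerivAt_id t).smul_const w).const_add x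
  have D1 : ∀ x w : EuclideanSpace ℝ (Fin d), ∀ t : ℝ,
      HasDerivAt (fun t : ℝ => f (x + t • w)) (fderiv ℝ f (x + t • w) w) t := fun x w t =>
    (hd (x + t • w)).hasFDerivAt.comp_hasDerivAt t (hline x w t)
  have D2 : ∀ x w : EuclideanSpace ℝ (Fin d), ∀ t : ℝ,
      HasDerivAt (fun t : ℝ => fderiv ℝ f (x + t • w) w)
        (iteratedFDeriv ℝ 2 f (x + t • w) ![w, w]) t := fun x w t => by
    have h := (hd2 (x + t • w)).hasFDerivAt.comp_hasDerivAt t (hline x w t)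
    have h2 := h.clm_apply (hasDerivAt_const t w)
    rw [iteratedFDeriv_two_apply]
    simpa using h2
  have hg : ∀ x w, ⟪gradient f x, w⟫ = fderiv ℝ f x w := fun x w => by
    rw [gradient, InnerProductSpace.toDual_symm_apply]
  constructor
  · intro x y
    have := taylor_two_lower (D1 x (y - x)) (D2 x (y - x)) (fun t => (H _ (y - x)).1)
    simp only [zero_smul, add_zero, one_smul, add_sub_cancel] at this
    rw [hg]; linarith
  · intro x y
    have := taylor_two_lower (fun t => (D1 x (y - x) t).neg) (fun t => (D2 x (y - x) t).neg)
      (c := -(K * ‖y - x‖ ^ 2)) (fun t => neg_le_neg (H _ (y - x)).2)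
    simp only [Pi.neg_apply, zero_smul, add_zero, one_smul, add_sub_cancel] at this
    rw [hg]; linarith

/-! ### Ridge-separable gradients -/

/-- The vector field `x ↦ ∑ᵢ ψᵢ(⟨aᵢ, x⟩) aᵢ + m x`. -/
def ridgeField {ι E : Type*} [Fintype ι] [NormedAddCommGroup E] [InnerProductSpace ℝ E]
    (a : ι → E) (ψ : ι → ℝ → ℝ) (m : ℝ) (x : E) : E :=
  ∑ i, ψ i ⟪a i, x⟫ • a i + m • x

/-- The `i`-th row of a matrix, as a vector of the Euclidean space. -/
def row {n d : ℕ} (A : Matrix (Fin n) (Fin d) ℝ) (i : Fin n) : EuclideanSpace ℝ (Fin d) :=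
  WithLp.toLp 2 (A i)

section Potential

variable {n d : ℕ} (A : Matrix (Fin n) (Fin d) ℝ) (φ : Fin n → ℝ → ℝ) (m : ℝ)

lemma mulVec_eq_inner_row (x : EuclideanSpace ℝ (Fin d)) (i : Fin n) :
    (A *ᵥ x.ofLp) i = ⟪row A i, x⟫ := by
  simp [row, PiLp.inner_apply, Matrix.mulVec, dotProduct, mul_comm]

lemma potential_eq (x : EuclideanSpace ℝ (Fin d)) :
    potential A φ m x = ∑ i, φ i ⟪row A i, x⟫ + m / 2 * ‖x‖ ^ 2 := by
  simp [potential, mulVec_eq_inner_row]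

lemma contDiff_potential (hφ : ∀ i, ContDiff ℝ ∞ (φ i)) : ContDiff ℝ ∞ (potential A φ m) := by
  have : potential A φ m = fun x => ∑ i, φ i ⟪row A i, x⟫ + m / 2 * ‖x‖ ^ 2 :=
    funext (potential_eq A φ m)
  rw [this]
  refine (ContDiff.sum fun i _ => (hφ i).comp (contDiff_const.inner ℝ contDiff_id)).add ?_
  exact contDiff_const.mul (contDiff_norm_sq ℝ)

lemma gradient_potential (hφ : ∀ i, ContDiff ℝ ∞ (φ i)) :
    gradient (potential A φ m) = ridgeField (row A) (fun i => deriv (φ i)) m := by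
  funext x
  refine HasGradientAt.gradient ?_
  rw [hasGradientAt_iff_hasFDerivAt]
  have : potential A φ m = fun x => ∑ i, φ i ⟪row A i, x⟫ + m / 2 * ‖x‖ ^ 2 :=
    funext (potential_eq A φ m)
  rw [this]
  have h1 : ∀ i, HasFDerivAt (fun x => φ i ⟪row A i, x⟫)
      (deriv (φ i) ⟪row A i, x⟫ • (innerSL ℝ (row A i))) x := fun i => by
    have hd : HasDerivAt (φ i) (deriv (φ i) ⟪row A i, x⟫) ⟪row A i, x⟫ :=
      ((hφ i).differentiable (by simp) _).hasDerivAt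
    exact hd.comp_hasFDerivAt x (innerSL ℝ (row A i)).hasFDerivAt
  have h2 := (HasFDerivAt.fun_sum (u := Finset.univ) fun i _ => h1 i).add
    ((hasStrictFDerivAt_norm_sq x).hasFDerivAt.const_mul (m / 2))
  refine h2.congr_fderiv ?_
  ext w
  simp [ridgeField]
  ring

/-- The row sums of `|A Aᵀ|` are bounded by the norm of `A Aᵀ`. -/
lemma sum_abs_inner_row_le (i : Fin n) :
    ∑ j, |⟪row A i, row A j⟫| ≤ inftyOpNorm (A * Aᵀ) := by
  -- The operator norm is tested on the sign vector of row i, which turns the i-th entry of the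
  -- image into the sum of absolute values.
  have h := (LinearMap.toContinuousLinearMap (Matrix.toLin' (A * Aᵀ))).le_opNorm
    (fun j => (SignType.sign (⟪row A i, row A j⟫ : ℝ) : ℝ))
  have h1 : ‖(fun j => ((SignType.sign (⟪row A i, row A j⟫ : ℝ) : SignType) : ℝ))‖ ≤ 1 := by
    rw [pi_norm_le_iff_of_nonneg zero_le_one]
    intro j
    rcases h : SignType.sign (⟪row A i, row A j⟫ : ℝ) <;> simp
  have h2 := norm_le_pi_norm ((LinearMap.toContinuousLinearMap (Matrix.toLin' (A * Aᵀ)))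
    (fun j => ((SignType.sign (⟪row A i, row A j⟫ : ℝ) : SignType) : ℝ))) i
  have h3 : (LinearMap.toContinuousLinearMap (Matrix.toLin' (A * Aᵀ)))
    (fun j => ((SignType.sign (⟪row A i, row A j⟫ : ℝ) : SignType) : ℝ)) i
      = ∑ j, |⟪row A i, row A j⟫| := by
    simp only [LinearMap.coe_toContinuousLinearMap', Matrix.toLin'_apply, Matrix.mulVec,
      dotProduct]
    refine Finset.sum_congr rfl fun j _ => ?_
    have : (A * Aᵀ) i j = ⟪row A i, row A j⟫ := by
      simp [row, Matrix.mul_apply, PiLp.inner_apply, mul_comm]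
    rw [this, self_mul_sign]
  rw [h3] at h2
  refine (le_abs_self _).trans (h2.trans (h.trans ?_))
  exact mul_le_of_le_one_right (norm_nonneg _) h1

end Potential

/-! ### Hamiltonian trajectories -/

/-- `(X, W)` solves `X' = h W`, `W' = -h g(X)` on `[0, 1]`, with `X 0 = x` and `W 0 = v`. -/
structure IsTraj {E : Type*} [NormedAddCommGroup E] [NormedSpace ℝ E]
    (g : E → E) (h : ℝ) (x v : E) (X W : ℝ → E) : Prop where
  pos_zero : X 0 = x
  vel_zero : W 0 = v
  hasDerivAt_pos : ∀ s ∈ Icc (0 : ℝ) 1, HasDerivAt X (h • W s) s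
  hasDerivAt_vel : ∀ s ∈ Icc (0 : ℝ) 1, HasDerivAt W (-(h • g (X s))) s

/-- In the variables (X, 8 h W) the field is Lipschitz with constant 1/8, because 64 h² K ≤ 1.
Picard–Lindelöf then reaches the whole unit interval at once, without continuation. -/
lemma exists_isTraj {E : Type*} [NormedAddCommGroup E] [NormedSpace ℝ E] [CompleteSpace E]
    {g : E → E} {h K : ℝ} (hh : 0 < h)
    (hg : ∀ x y, ‖g x - g y‖ ≤ K * ‖x - y‖) (hhK : 64 * (h ^ 2 * K) ≤ 1) (x v : E) :
    ∃ X W, IsTraj g h x v X W := by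
  let G : E × E → E × E := fun z => ((1 / 8 : ℝ) • z.2, -((8 * h ^ 2) • g z.1))
  have hG : LipschitzWith (1 / 8) G := by
    refine LipschitzWith.of_dist_le_mul fun z z' => ?_
    rw [dist_eq_norm, dist_eq_norm, Prod.norm_def]
    refine max_le ?_ ?_
    · have : (G z - G z').1 = (1 / 8 : ℝ) • (z - z').2 := by simp [G, smul_sub]
      rw [this, norm_smul]
      have := norm_snd_le (z - z')
      simp only [NNReal.coe_div, NNReal.coe_one, NNReal.coe_ofNat]
      rw [Real.norm_of_nonneg (by norm_num)]
      gcongr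
    · have : (G z - G z').2 = -((8 * h ^ 2) • (g z.1 - g z'.1)) := by
        simp [G, smul_sub]; abel
      rw [this, norm_neg, norm_smul, Real.norm_of_nonneg (by positivity)]
      have h1 := hg z.1 z'.1
      have h2 := norm_fst_le (z - z')
      simp only [NNReal.coe_div, NNReal.coe_one, NNReal.coe_ofNat]
      calc 8 * h ^ 2 * ‖g z.1 - g z'.1‖ ≤ 8 * h ^ 2 * (K * ‖z.1 - z'.1‖) := by gcongr
        _ = (8 * (h ^ 2 * K)) * ‖(z - z').1‖ := by simp; ring
        _ ≤ 1 / 8 * ‖z - z'‖ := by gcongr; linarith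
  let z₀ : E × E := (x, (8 * h) • v)
  let B : NNReal := ‖G z₀‖₊
  -- On the ball of radius 4B the speed is at most B + 4B/8 ≤ 2B, so a path cannot leave it within
  -- time 2. The interval [-1, 2] has [0, 1] in its interior, which gives two-sided derivatives at 0
  -- and 1.
  have hPL : IsPicardLindelof (fun _ => G) (tmin := -1) (tmax := 2)
      ⟨0, by norm_num⟩ z₀ (4 * B) 0 (2 * B) (1 / 8) := by
    refine IsPicardLindelof.of_time_independent (fun z hz => ?_) (hG.lipschitzOnWith) ?_
    · have h1 := hG.dist_le_mul z z₀
      rw [Metric.mem_closedBall] at hz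
      rw [dist_eq_norm] at h1
      have h2 : ‖G z‖ ≤ ‖G z - G z₀‖ + ‖G z₀‖ := by simpa using norm_add_le (G z - G z₀) (G z₀)
      simp only [NNReal.coe_mul, NNReal.coe_ofNat, NNReal.coe_div, NNReal.coe_one, B,
        coe_nnnorm] at *
      linarith [norm_nonneg (G z₀)]
    · simp; linarith [B.2]
  obtain ⟨α, hα0, hα⟩ := hPL.exists_eq_forall_mem_Icc_hasDerivWithinAt₀
  have hα' : ∀ s ∈ Icc (0 : ℝ) 1, HasDerivAt α (G (α s)) s := fun s hs =>
    (hα s ⟨by linarith [hs.1], by linarith [hs.2]⟩).hasDerivAt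
      (Icc_mem_nhds (by linarith [hs.1]) (by linarith [hs.2]))
  refine ⟨fun s => (α s).1, fun s => (8 * h)⁻¹ • (α s).2, ?_, ?_, fun s hs => ?_, fun s hs => ?_⟩
  · have : α 0 = z₀ := hα0
    rw [this]
  · have : α 0 = z₀ := hα0
    rw [this]
    simp only [z₀]
    rw [smul_smul, inv_mul_cancel₀ (by positivity), one_smul]
  · refine ((ContinuousLinearMap.fst ℝ E E).hasFDerivAt.comp_hasDerivAt s (hα' s hs)).congr_deriv ?_
    simp only [G, ContinuousLinearMap.coe_fst']
    rw [smul_smul]; congr 1; field_simp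
  · refine (((ContinuousLinearMap.snd ℝ E E).hasFDerivAt.comp_hasDerivAt s
      (hα' s hs)).const_smul (8 * h)⁻¹).congr_deriv ?_
    simp only [G, ContinuousLinearMap.coe_snd']
    rw [smul_neg, smul_smul]; congr 2; field_simp

namespace IsTraj

variable {E : Type*} [NormedAddCommGroup E] [NormedSpace ℝ E]
  {g : E → E} {h : ℝ} {x v : E} {X W : ℝ → E}

lemma continuousOn_pos (H : IsTraj g h x v X W) : ContinuousOn X (Icc 0 1) :=
  fun s hs => (H.hasDerivAt_pos s hs).continuousAt.continuousWithinAt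

lemma continuousOn_vel (H : IsTraj g h x v X W) : ContinuousOn W (Icc 0 1) :=
  fun s hs => (H.hasDerivAt_vel s hs).continuousAt.continuousWithinAt

lemma continuousOn_field (H : IsTraj g h x v X W) (hg : Continuous g) :
    ContinuousOn (fun s => g (X s)) (Icc 0 1) :=
  hg.comp_continuousOn H.continuousOn_pos

lemma _root_.ContinuousOn.intervalIntegrable_unit {F : Type*} [NormedAddCommGroup F] {u : ℝ → F}
    (hu : ContinuousOn u (Icc 0 1)) {t : ℝ} (ht : t ∈ Icc (0 : ℝ) 1) :
    IntervalIntegrable u volume 0 t :=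
  (hu.mono (by rw [uIcc_of_le ht.1]; exact Icc_subset_Icc_right ht.2)).intervalIntegrable

variable [CompleteSpace E]

lemma pos_eq (H : IsTraj g h x v X W) (hg : Continuous g) {t : ℝ} (ht : t ∈ Icc (0 : ℝ) 1) :
    X t = x + t • h • v - ∫ s in (0 : ℝ)..t, (t - s) • h ^ 2 • g (X s) := by
  have hd : ∀ s ∈ uIcc 0 t, HasDerivAt (fun s => X s + (t - s) • h • W s)
      (-((t - s) • h ^ 2 • g (X s))) s := fun s hs => by
    rw [uIcc_of_le ht.1] at hs
    have hs' : s ∈ Icc (0 : ℝ) 1 := ⟨hs.1, hs.2.trans ht.2⟩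
    have h1 := (H.hasDerivAt_pos s hs').add ((((hasDerivAt_id s).const_sub t)).smul
      ((H.hasDerivAt_vel s hs').const_smul h))
    refine h1.congr_deriv ?_
    simp only [smul_neg, smul_smul, id, Pi.smul_apply]
    module
  have hc : ContinuousOn (fun s => -((t - s) • h ^ 2 • g (X s))) (Icc 0 1) :=
    ((continuousOn_const.sub continuousOn_id).smul
      ((H.continuousOn_field hg).const_smul _)).neg
  have := intervalIntegral.integral_eq_sub_of_hasDerivAt hd (hc.intervalIntegrable_unit ht)
  rw [intervalIntegral.integral_neg] at this
  simp only [sub_self, zero_smul, add_zero, sub_zero, H.pos_zero, H.vel_zero] at this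
  rw [eq_comm, sub_eq_iff_eq_add, ← sub_eq_iff_eq_add', ← neg_inj, ← this.symm]
  abel

lemma vel_eq (H : IsTraj g h x v X W) (hg : Continuous g) {t : ℝ} (ht : t ∈ Icc (0 : ℝ) 1) :
    W t = v - ∫ s in (0 : ℝ)..t, h • g (X s) := by
  have hd : ∀ s ∈ uIcc 0 t, HasDerivAt W (-(h • g (X s))) s := fun s hs => by
    rw [uIcc_of_le ht.1] at hs
    exact H.hasDerivAt_vel s ⟨hs.1, hs.2.trans ht.2⟩
  have := intervalIntegral.integral_eq_sub_of_hasDerivAt hd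
    (((H.continuousOn_field hg).const_smul h).neg.intervalIntegrable_unit ht)
  rw [intervalIntegral.integral_neg, H.vel_zero] at this
  rw [sub_eq_add_neg, this]; abel

lemma pos_eq_integral_vel (H : IsTraj g h x v X W) {t : ℝ} (ht : t ∈ Icc (0 : ℝ) 1) :
    X t = x + ∫ s in (0 : ℝ)..t, h • W s := by
  have hd : ∀ s ∈ uIcc 0 t, HasDerivAt X (h • W s) s := fun s hs => by
    rw [uIcc_of_le ht.1] at hs
    exact H.hasDerivAt_pos s ⟨hs.1, hs.2.trans ht.2⟩
  have := intervalIntegral.integral_eq_sub_of_hasDerivAt hd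
    ((H.continuousOn_vel.const_smul h).intervalIntegrable_unit ht)
  rw [H.pos_zero] at this
  rw [this]; abel

end IsTraj

/-! ### Damping -/

lemma norm_integral_sub_smul_le {F : Type*} [NormedAddCommGroup F] [NormedSpace ℝ F]
    {u : ℝ → F} {C t : ℝ} (ht : t ∈ Icc (0 : ℝ) 1) (hC : 0 ≤ C)
    (hu : ∀ s ∈ Icc (0 : ℝ) t, ‖u s‖ ≤ C) :
    ‖∫ s in (0 : ℝ)..t, (t - s) • u s‖ ≤ C / 2 := by
  have h1 : ‖∫ s in (0 : ℝ)..t, (t - s) • u s‖ ≤ ∫ s in (0 : ℝ)..t, (t - s) * C := by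
    refine intervalIntegral.norm_integral_le_of_norm_le ht.1 ?_
      (Continuous.intervalIntegrable (by fun_prop) _ _)
    refine ae_of_all _ fun s hs => ?_
    rw [norm_smul, Real.norm_of_nonneg (by linarith [hs.2])]
    exact mul_le_mul_of_nonneg_left (hu s ⟨hs.1.le, hs.2⟩) (by linarith [hs.2])
  have h2 : ∫ s in (0 : ℝ)..t, (t - s) * C = t ^ 2 / 2 * C := by
    rw [intervalIntegral.integral_mul_const, intervalIntegral.integral_sub (by simp) (by simp),
      intervalIntegral.integral_const, integral_id]
    simp only [smul_eq_mul]; ring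
  rw [h2] at h1
  have : t ^ 2 ≤ 1 := by nlinarith [ht.1, ht.2]
  nlinarith

section Damped

variable {F : Type*} [NormedAddCommGroup F] [NormedSpace ℝ F]
  {y b : ℝ → F} {y₀ u : F} {θ β : ℝ}

/-- Displacement of a damped path in the unit time interval. -/
lemma damped_displacement (hθ : 0 ≤ θ) (hθ' : θ ≤ 1 / 4) (hβ : 0 ≤ β)
    (hy : ContinuousOn y (Icc 0 1)) (hbβ : ∀ s ∈ Icc (0 : ℝ) 1, ‖b s‖ ≤ β)
    (hyeq : ∀ t ∈ Icc (0 : ℝ) 1,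
      y t = y₀ + t • u - ∫ s in (0 : ℝ)..t, (t - s) • (θ • y s + b s)) :
    ∀ t ∈ Icc (0 : ℝ) 1, ‖y t - y₀‖ ≤ 8 / 7 * (‖u‖ + (θ * ‖y₀‖ + β) / 2) := by
  obtain ⟨t₁, ht₁, hmax⟩ := isCompact_Icc.exists_isMaxOn (nonempty_Icc.2 zero_le_one)
    (hy.sub continuousOn_const).norm (f := fun t => ‖y t - y₀‖)
  set S := ‖y t₁ - y₀‖ with hS
  have hS' : ∀ t ∈ Icc (0 : ℝ) 1, ‖y t - y₀‖ ≤ S := fun t ht => hmax ht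
  have h1 : S ≤ ‖u‖ + (θ * (‖y₀‖ + S) + β) / 2 := by
    have e : y t₁ - y₀ = t₁ • u - ∫ s in (0 : ℝ)..t₁, (t₁ - s) • (θ • y s + b s) := by
      rw [hyeq t₁ ht₁]; abel
    refine ((congrArg norm e).trans_le (norm_sub_le _ _)).trans (add_le_add ?_ ?_)
    · rw [norm_smul, Real.norm_of_nonneg ht₁.1]
      exact mul_le_of_le_one_left (norm_nonneg _) ht₁.2
    · refine norm_integral_sub_smul_le ht₁ (by positivity) fun s hs => ?_
      have hs' : s ∈ Icc (0 : ℝ) 1 := ⟨hs.1, hs.2.trans ht₁.2⟩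
      refine (norm_add_le _ _).trans (add_le_add ?_ (hbβ s hs'))
      rw [norm_smul, Real.norm_of_nonneg hθ]
      have : ‖y s‖ ≤ ‖y₀‖ + ‖y s - y₀‖ := by simpa using norm_add_le y₀ (y s - y₀)
      exact mul_le_mul_of_nonneg_left (this.trans (by linarith [hS' s hs'])) hθ
  have hS0 : 0 ≤ S := norm_nonneg _
  intro t ht
  refine (hS' t ht).trans ?_
  nlinarith

/-- The path solves y'' = -(θ y + b). Freezing y at y₀ in the damping term gives the factor 1 - θ/2.
The correction is θ times the displacement, so its dependence on ‖y₀‖ is of order θ², and θ ≤ 1/4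
leaves at least the gain θ/8. It is used for F = E, to control norms, and for F = ℝ, to control each
⟨aᵢ, X⟩. -/
lemma damped_bound [CompleteSpace F] (hθ : 0 ≤ θ) (hθ' : θ ≤ 1 / 4) (hβ : 0 ≤ β)
    (hy : ContinuousOn y (Icc 0 1)) (hb : ContinuousOn b (Icc 0 1))
    (hbβ : ∀ s ∈ Icc (0 : ℝ) 1, ‖b s‖ ≤ β)
    (hyeq : ∀ t ∈ Icc (0 : ℝ) 1,
      y t = y₀ + t • u - ∫ s in (0 : ℝ)..t, (t - s) • (θ • y s + b s)) :
    ‖y 1‖ ≤ (1 - θ / 8) * ‖y₀‖ + 2 * ‖u‖ + 2 * β := by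
  have hdis := damped_displacement hθ hθ' hβ hy hbβ hyeq
  have h01 : (1 : ℝ) ∈ Icc (0 : ℝ) 1 := by simp
  have hsub : ∀ w : ℝ → F, ContinuousOn w (Icc 0 1) →
      IntervalIntegrable (fun s => (1 - s) • w s) volume 0 1 := fun w hw =>
    ((continuousOn_const.sub continuousOn_id).smul hw).intervalIntegrable_unit h01
  have e1 : ∫ s in (0 : ℝ)..1, (1 - s) • (θ • y s + b s)
      = (θ / 2) • y₀ + ∫ s in (0 : ℝ)..1, (1 - s) • (θ • (y s - y₀) + b s) := by
    have hsplit : ∀ s : ℝ, (1 - s) • (θ • y s + b s)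
        = (1 - s) • (θ • y₀) + (1 - s) • (θ • (y s - y₀) + b s) := fun s => by
      rw [← smul_add]; congr 1; rw [smul_sub]; abel
    simp_rw [hsplit]
    rw [intervalIntegral.integral_add (hsub (fun _ => θ • y₀) continuousOn_const)
      (hsub (fun s => θ • (y s - y₀) + b s) (((hy.sub continuousOn_const).const_smul θ).add hb))]
    congr 1
    rw [intervalIntegral.integral_smul_const, intervalIntegral.integral_sub (by simp) (by simp)]
    simp only [intervalIntegral.integral_const, integral_id, smul_smul]
    congr 1; norm_num; ring
  have e2 : y 1 = (1 - θ / 2) • y₀ + u - ∫ s in (0 : ℝ)..1, (1 - s) • (θ • (y s - y₀) + b s) := by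
    rw [hyeq 1 h01, e1]; module
  set C := θ * (8 / 7 * (‖u‖ + (θ * ‖y₀‖ + β) / 2)) + β with hC
  have h3 : ‖∫ s in (0 : ℝ)..1, (1 - s) • (θ • (y s - y₀) + b s)‖ ≤ C / 2 := by
    refine norm_integral_sub_smul_le h01 (by positivity) fun s hs => ?_
    refine (norm_add_le _ _).trans (add_le_add ?_ (hbβ s hs))
    rw [norm_smul, Real.norm_of_nonneg hθ]
    exact mul_le_mul_of_nonneg_left (hdis s hs) hθ
  have h4 : ‖y 1‖ ≤ (1 - θ / 2) * ‖y₀‖ + ‖u‖ + C / 2 := by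
    rw [e2]
    refine (norm_sub_le _ _).trans (add_le_add ((norm_add_le _ _).trans ?_) h3)
    rw [norm_smul, Real.norm_of_nonneg (by linarith)]
  have hu := norm_nonneg u
  have hy0 := norm_nonneg y₀
  have h5 : θ * ‖u‖ ≤ 1 / 4 * ‖u‖ := by gcongr
  have h6 : θ * β ≤ 1 / 4 * β := by gcongr
  have h7 : θ * (θ * ‖y₀‖) ≤ 1 / 4 * (θ * ‖y₀‖) := by gcongr
  have h8 : 0 ≤ θ * ‖y₀‖ := by positivity
  rw [hC] at h4
  linarith

end Damped

/-! ### Contraction of two trajectories with the same initial velocity -/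

section Contraction

variable {E : Type*} [NormedAddCommGroup E] [InnerProductSpace ℝ E] [CompleteSpace E]
  {f : E → ℝ} {g : E → E} {m K h : ℝ} {x y v : E} {X W Y W' : ℝ → E}

/-- With U = X - Y, G = g(X) - g(Y) and the weight 1 - s, expanding ‖U 1‖² gives ‖x - y‖² - 2h² ⟨∫
G, x - y⟩ + h⁴ ‖∫ G‖². Let I be the weighted integral of ⟨G, U⟩ and J that of ‖G‖. The cross term is
at least I - h² J², and cocoercivity gives 2 J² ≤ K I. Hence all errors, at most 3h⁴ J², are
absorbed by the gain 2h² I, and strong monotonicity bounds I from below. -/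
lemma IsTraj.sq_dist_le (Q : QuadBounds f g m K) (hm : 0 ≤ m) (hK : 0 < K)
    (hhK : h ^ 2 * K ≤ 1 / 4) (HX : IsTraj g h x v X W) (HY : IsTraj g h y v Y W') :
    ‖X 1 - Y 1‖ ^ 2 ≤ (1 - m * h ^ 2 / 4) * ‖x - y‖ ^ 2 := by
  have hg : Continuous g := (Q.lipschitz hm hK).continuous
  set G : ℝ → E := fun s => g (X s) - g (Y s) with hG
  set U : ℝ → E := fun s => X s - Y s with hU
  have hGc : ContinuousOn G (Icc 0 1) := (HX.continuousOn_field hg).sub (HY.continuousOn_field hg)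
  have hUc : ContinuousOn U (Icc 0 1) := HX.continuousOn_pos.sub HY.continuousOn_pos
  have h01 : (1 : ℝ) ∈ Icc (0 : ℝ) 1 := by simp
  have hw : ∀ t : ℝ, ContinuousOn (fun s : ℝ => t - s) (Icc 0 1) := fun t =>
    continuousOn_const.sub continuousOn_id
  have hUeq : ∀ t ∈ Icc (0 : ℝ) 1,
      U t = (x - y) - h ^ 2 • ∫ s in (0 : ℝ)..t, (t - s) • G s := fun t ht => by
    have e : ∫ s in (0 : ℝ)..t, (t - s) • G s
        = (∫ s in (0 : ℝ)..t, (t - s) • g (X s)) - ∫ s in (0 : ℝ)..t, (t - s) • g (Y s) := by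
      refine Eq.trans ?_ (intervalIntegral.integral_sub
        (((hw t).smul (HX.continuousOn_field hg)).intervalIntegrable_unit ht)
        (((hw t).smul (HY.continuousOn_field hg)).intervalIntegrable_unit ht))
      simp only [hG, smul_sub]
    have e2 : ∀ Z : ℝ → E, ∫ s in (0 : ℝ)..t, (t - s) • h ^ 2 • g (Z s)
        = h ^ 2 • ∫ s in (0 : ℝ)..t, (t - s) • g (Z s) := fun Z => by
      rw [← intervalIntegral.integral_smul]
      simp only [smul_comm (h ^ 2)]
    simp only [hU]
    rw [HX.pos_eq hg ht, HY.pos_eq hg ht, e2, e2, e, smul_sub]; abel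
  set c : ℝ → ℝ := fun s => ⟪G s, U s⟫ with hc
  have hcc : ContinuousOn c (Icc 0 1) := hGc.inner hUc
  have hcG : ∀ s, ‖G s‖ ^ 2 ≤ K * c s := fun s => Q.cocoercive hm hK _ _
  have hcU : ∀ s, m * ‖U s‖ ^ 2 ≤ c s := fun s => Q.strongMono _ _
  set I : ℝ := ∫ s in (0 : ℝ)..1, (1 - s) * c s with hI
  set J : ℝ := ∫ s in (0 : ℝ)..1, (1 - s) * ‖G s‖ with hJ
  have ii : ∀ w : ℝ → ℝ, ContinuousOn w (Icc 0 1) →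
      IntervalIntegrable (fun s => (1 - s) * w s) volume 0 1 := fun w hwc =>
    ((hw 1).mul hwc).intervalIntegrable_unit h01
  have mono : ∀ w w' : ℝ → ℝ, ContinuousOn w (Icc 0 1) → ContinuousOn w' (Icc 0 1) →
      (∀ s ∈ Icc (0 : ℝ) 1, w s ≤ w' s) →
      ∫ s in (0 : ℝ)..1, (1 - s) * w s ≤ ∫ s in (0 : ℝ)..1, (1 - s) * w' s :=
    fun w w' h1 h2 h3 => intervalIntegral.integral_mono_on zero_le_one (ii w h1) (ii w' h2)
      fun s hs => mul_le_mul_of_nonneg_left (h3 s hs) (by linarith [hs.2])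
  have isub : ∀ w w' : ℝ → ℝ, ContinuousOn w (Icc 0 1) → ContinuousOn w' (Icc 0 1) →
      ∫ s in (0 : ℝ)..1, (1 - s) * (w s - w' s)
        = (∫ s in (0 : ℝ)..1, (1 - s) * w s) - ∫ s in (0 : ℝ)..1, (1 - s) * w' s :=
    fun w w' h1 h2 => by
      rw [← intervalIntegral.integral_sub (ii w h1) (ii w' h2)]
      simp only [mul_sub]
  have hcmul : ∀ (C : ℝ) (w : ℝ → ℝ), ∫ s in (0 : ℝ)..1, (1 - s) * (C * w s)
      = C * ∫ s in (0 : ℝ)..1, (1 - s) * w s := fun C w => by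
    rw [← intervalIntegral.integral_const_mul]
    congr 1; funext s; ring
  have hconst : ∀ C : ℝ, ∫ s in (0 : ℝ)..1, (1 - s) * C = C / 2 := fun C => by
    rw [intervalIntegral.integral_mul_const, intervalIntegral.integral_sub (by simp) (by simp),
      intervalIntegral.integral_const, integral_id]
    simp only [smul_eq_mul]; ring
  have hJ0 : 0 ≤ J := intervalIntegral.integral_nonneg zero_le_one fun s hs =>
    mul_nonneg (by linarith [hs.2]) (norm_nonneg _)
  -- Cauchy-Schwarz
  have hJI : 2 * J ^ 2 ≤ K * I := by
    have h1 : ∫ s in (0 : ℝ)..1, (1 - s) * (4 * J * ‖G s‖ - 4 * J ^ 2)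
        ≤ ∫ s in (0 : ℝ)..1, (1 - s) * (K * c s) :=
      mono _ _ ((continuousOn_const.mul hGc.norm).sub continuousOn_const)
        (continuousOn_const.mul hcc) fun s _ => by
          nlinarith [hcG s, sq_nonneg (‖G s‖ - 2 * J)]
    have h2 : ∫ s in (0 : ℝ)..1, (1 - s) * (4 * J * ‖G s‖ - 4 * J ^ 2)
        = 4 * J * J - 4 * J ^ 2 / 2 := by
      rw [isub (fun s => 4 * J * ‖G s‖) (fun _ => 4 * J ^ 2) (continuousOn_const.mul hGc.norm)
        continuousOn_const, hconst, hcmul]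
    have h3 : ∫ s in (0 : ℝ)..1, (1 - s) * (K * c s) = K * I := hcmul K c
    rw [h2, h3] at h1
    linarith
  have hVJ : ∀ t ∈ Icc (0 : ℝ) 1, ‖∫ s in (0 : ℝ)..t, (t - s) • G s‖ ≤ J := fun t ht => by
    have h1 : ‖∫ s in (0 : ℝ)..t, (t - s) • G s‖ ≤ ∫ s in (0 : ℝ)..t, (1 - s) * ‖G s‖ := by
      refine intervalIntegral.norm_integral_le_of_norm_le ht.1 ?_
        (((hw 1).mul hGc.norm).intervalIntegrable_unit ht)
      refine ae_of_all _ fun s hs => ?_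
      rw [norm_smul, Real.norm_of_nonneg (by linarith [hs.2])]
      exact mul_le_mul_of_nonneg_right (by linarith [ht.2]) (norm_nonneg _)
    refine h1.trans ?_
    refine intervalIntegral.integral_mono_interval le_rfl ht.1 ht.2 ?_ (ii _ hGc.norm)
    refine (ae_restrict_iff' measurableSet_Ioc).2 (ae_of_all _ fun s hs => ?_)
    exact mul_nonneg (by linarith [hs.2]) (norm_nonneg _)
  -- Replacing the constant x - y by U s inside the integral costs at most h² J ‖G s‖ at time s.
  have hVI : I - h ^ 2 * J ^ 2 ≤ ⟪∫ s in (0 : ℝ)..1, (1 - s) • G s, x - y⟫ := by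
    have e1 : ⟪∫ s in (0 : ℝ)..1, (1 - s) • G s, x - y⟫
        = ∫ s in (0 : ℝ)..1, (1 - s) * ⟪G s, x - y⟫ := by
      have := ((innerSL ℝ (x - y))).intervalIntegral_comp_comm
        (((hw 1).smul hGc).intervalIntegrable_unit h01)
      rw [real_inner_comm]
      refine Eq.trans this.symm ?_
      simp only [innerSL_apply_apply, Pi.smul_apply', inner_smul_right, real_inner_comm]
    have e2 : I - h ^ 2 * J ^ 2
        = ∫ s in (0 : ℝ)..1, (1 - s) * (c s - h ^ 2 * J * ‖G s‖) := by
      rw [isub c (fun s => h ^ 2 * J * ‖G s‖) hcc (continuousOn_const.mul hGc.norm),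
        hcmul]
      ring
    rw [e1, e2]
    refine mono _ _ (hcc.sub (continuousOn_const.mul hGc.norm)) (hGc.inner continuousOn_const)
      fun s hs => ?_
    have h1 : x - y = U s + h ^ 2 • ∫ σ in (0 : ℝ)..s, (s - σ) • G σ := by
      rw [hUeq s hs]; abel
    rw [h1, inner_add_right]
    have h2 := abs_real_inner_le_norm (G s) (h ^ 2 • ∫ σ in (0 : ℝ)..s, (s - σ) • G σ)
    rw [norm_smul, Real.norm_of_nonneg (sq_nonneg h)] at h2
    have h3 : ‖G s‖ * (h ^ 2 * ‖∫ σ in (0 : ℝ)..s, (s - σ) • G σ‖) ≤ ‖G s‖ * (h ^ 2 * J) := by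
      gcongr; exact hVJ s hs
    have := (abs_le.1 h2).1
    simp only [hc]
    linarith
  -- The difference U moves by at most 1/7 of ‖x - y‖, so ‖U s‖² stays above ‖x - y‖² / 2. The
  -- weight 1 - s has mass 1/2, whence m/4.
  have hIlow : m / 4 * ‖x - y‖ ^ 2 ≤ I := by
    obtain ⟨t₁, ht₁, hmax⟩ := isCompact_Icc.exists_isMaxOn (nonempty_Icc.2 zero_le_one)
      (hUc.sub continuousOn_const).norm (f := fun t => ‖U t - (x - y)‖)
    set S := ‖U t₁ - (x - y)‖ with hS
    have hS' : ∀ t ∈ Icc (0 : ℝ) 1, ‖U t - (x - y)‖ ≤ S := fun t ht => hmax ht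
    have hS0 : 0 ≤ S := norm_nonneg _
    have h1 : S ≤ 1 / 8 * (‖x - y‖ + S) := by
      have e : U t₁ - (x - y) = -(h ^ 2 • ∫ s in (0 : ℝ)..t₁, (t₁ - s) • G s) := by
        rw [hUeq t₁ ht₁]; abel
      have h2 : ‖∫ s in (0 : ℝ)..t₁, (t₁ - s) • G s‖ ≤ K * (‖x - y‖ + S) / 2 := by
        refine norm_integral_sub_smul_le ht₁ (by positivity) fun s hs => ?_
        have hs' : s ∈ Icc (0 : ℝ) 1 := ⟨hs.1, hs.2.trans ht₁.2⟩
        refine (Q.norm_sub_le hm hK _ _).trans ?_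
        have : ‖U s‖ ≤ ‖x - y‖ + ‖U s - (x - y)‖ := by
          simpa using norm_add_le (x - y) (U s - (x - y))
        exact mul_le_mul_of_nonneg_left (this.trans (by linarith [hS' s hs'])) hK.le
      calc S = h ^ 2 * ‖∫ s in (0 : ℝ)..t₁, (t₁ - s) • G s‖ := by
            rw [hS, e, norm_neg, norm_smul, Real.norm_of_nonneg (sq_nonneg h)]
        _ ≤ h ^ 2 * (K * (‖x - y‖ + S) / 2) := by gcongr
        _ = h ^ 2 * K * ((‖x - y‖ + S) / 2) := by ring
        _ ≤ 1 / 4 * ((‖x - y‖ + S) / 2) := by gcongr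
        _ = _ := by ring
    have h3 : ∀ s ∈ Icc (0 : ℝ) 1, m * (‖x - y‖ ^ 2 / 2) ≤ c s := fun s hs => by
      refine le_trans ?_ (hcU s)
      have : ‖x - y‖ ≤ ‖U s‖ + ‖U s - (x - y)‖ := by
        have := norm_add_le (U s) (-(U s - (x - y)))
        rw [norm_neg] at this
        simpa using this
      have h4 : 6 / 7 * ‖x - y‖ ≤ ‖U s‖ := by linarith [hS' s hs]
      have h5 : ‖x - y‖ ^ 2 / 2 ≤ ‖U s‖ ^ 2 := by nlinarith [norm_nonneg (x - y)]
      exact mul_le_mul_of_nonneg_left h5 hm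
    have := mono _ _ continuousOn_const hcc h3
    rw [hconst] at this
    linarith
  have hU1 := hUeq 1 h01
  have : ‖X 1 - Y 1‖ ^ 2 = ‖U 1‖ ^ 2 := rfl
  rw [this, hU1, norm_sub_sq_real, inner_smul_right, norm_smul, Real.norm_of_nonneg (sq_nonneg h),
    real_inner_comm]
  have h6 : (h ^ 2 * ‖∫ s in (0 : ℝ)..1, (1 - s) • G s‖) ^ 2 ≤ (h ^ 2 * J) ^ 2 := by
    gcongr; exact hVJ 1 h01
  have h7 : h ^ 2 * (I - h ^ 2 * J ^ 2) ≤ h ^ 2 * ⟪∫ s in (0 : ℝ)..1, (1 - s) • G s, x - y⟫ := by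
    gcongr
  have hI0 : 0 ≤ I := le_trans (by positivity) hIlow
  have h8 : h ^ 2 * (h ^ 2 * (2 * J ^ 2)) ≤ h ^ 2 * (1 / 4 * I) := by
    have : h ^ 2 * (2 * J ^ 2) ≤ h ^ 2 * (K * I) := by gcongr
    have : h ^ 2 * (K * I) ≤ 1 / 4 * I := by rw [← mul_assoc]; gcongr
    exact mul_le_mul_of_nonneg_left (by linarith) (sq_nonneg h)
  have h9 : h ^ 2 * (m / 4 * ‖x - y‖ ^ 2) ≤ h ^ 2 * I := by gcongr
  have h10 : 0 ≤ h ^ 2 * I := by positivity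
  nlinarith

lemma IsTraj.dist_le (Q : QuadBounds f g m K) (hm : 0 ≤ m) (hK : 0 < K) (hmK : m ≤ K)
    (hhK : h ^ 2 * K ≤ 1 / 4) (HX : IsTraj g h x v X W) (HY : IsTraj g h y v Y W') :
    ‖X 1 - Y 1‖ ≤ (1 - m * h ^ 2 / 8) * ‖x - y‖ := by
  have h1 := HX.sq_dist_le Q hm hK hhK HY
  have h2 : m * h ^ 2 ≤ 1 / 4 := by nlinarith [sq_nonneg h]
  have h3 : 0 ≤ m * h ^ 2 := by positivity
  have h4 : 0 ≤ (1 - m * h ^ 2 / 8) * ‖x - y‖ := mul_nonneg (by linarith) (norm_nonneg _)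
  refine abs_le_of_sq_le_sq' ?_ h4 |>.2
  refine h1.trans ?_
  rw [mul_pow]
  refine mul_le_mul_of_nonneg_right ?_ (sq_nonneg _)
  nlinarith

end Contraction

/-! ### Symplectic Euler method -/

/-- One step of the symplectic Euler method, with step size `η`. -/
def eulerStep {E : Type*} [NormedAddCommGroup E] [NormedSpace ℝ E] (g : E → E) (η : ℝ)
    (z : E × E) : E × E :=
  (z.1 + η • (z.2 - η • g z.1), z.2 - η • g z.1)

lemma continuous_eulerStep {E : Type*} [NormedAddCommGroup E] [NormedSpace ℝ E] {g : E → E}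
    (hg : Continuous g) (η : ℝ) : Continuous (eulerStep g η) := by
  unfold eulerStep; fun_prop

/-- The step is a composition of two shears, each of which translates one variable by a function of
the other. So volume is preserved for merely continuous g, and no Jacobian is needed. -/
lemma measurePreserving_eulerStep {E : Type*} [NormedAddCommGroup E] [InnerProductSpace ℝ E]
    [FiniteDimensional ℝ E] [MeasurableSpace E] [BorelSpace E] {g : E → E} (hg : Continuous g)
    (η : ℝ) : MeasurePreserving (eulerStep g η) (volume.prod volume) (volume.prod volume) := by
  have hm : Measurable g := hg.measurable
  have h1 : MeasurePreserving (fun z : E × E => (z.1, z.2 - η • g z.1))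
      (volume.prod volume) (volume.prod volume) := by
    refine (MeasurePreserving.id volume).skew_product (g := fun x w => w - η • g x) ?_ ?_
    · simp only [Function.uncurry_def]; fun_prop
    · exact ae_of_all _ fun x => (measurePreserving_sub_right volume _).map_eq
  have h2 : MeasurePreserving (fun z : E × E => (z.1, z.2 + η • z.1))
      (volume.prod volume) (volume.prod volume) := by
    refine (MeasurePreserving.id volume).skew_product (g := fun x w => w + η • x) ?_ ?_
    · simp only [Function.uncurry_def]; fun_prop
    · exact ae_of_all _ fun x => (measurePreserving_add_right volume _).map_eq
  exact (Measure.measurePreserving_swap.comp (h2.comp Measure.measurePreserving_swap)).comp h1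

section EulerConvergence

variable {E : Type*} [NormedAddCommGroup E] [NormedSpace ℝ E]
  {g : E → E} {h K : ℝ} {x v : E} {X W : ℝ → E}

/-- Discrete Gronwall: each step commits an error of at most c / N² and amplifies the previous error
by at most 1 + a / N. After N steps the error is at most c eᵃ / N. -/
lemma IsTraj.tendsto_euler (H : IsTraj g h x v X W) (hh : 0 ≤ h) (hK : 0 ≤ K)
    (hg : ∀ x y, ‖g x - g y‖ ≤ K * ‖x - y‖) :
    Tendsto (fun N : ℕ => (eulerStep g (h / N))^[N] (x, v)) atTop (𝓝 (X 1, W 1)) := by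
  have hgc : Continuous g := (LipschitzWith.of_dist_le_mul (K := ⟨K, hK⟩) fun x y => by
    rw [dist_eq_norm, dist_eq_norm]; exact hg x y).continuous
  obtain ⟨Cg, hCg⟩ := isCompact_Icc.exists_bound_of_continuousOn (H.continuousOn_field hgc)
  obtain ⟨Cw, hCw⟩ := isCompact_Icc.exists_bound_of_continuousOn H.continuousOn_vel
  have h00 : (0 : ℝ) ∈ Icc (0 : ℝ) 1 := by simp
  have hCg0 : 0 ≤ Cg := (norm_nonneg _).trans (hCg 0 h00)
  have hCw0 : 0 ≤ Cw := (norm_nonneg _).trans (hCw 0 h00)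
  have hXlip : ∀ s ∈ Icc (0 : ℝ) 1, ∀ t ∈ Icc (0 : ℝ) 1, ‖X t - X s‖ ≤ h * Cw * |t - s| :=
    fun s hs t ht => by
      have := Convex.norm_image_sub_le_of_norm_hasDerivWithin_le (f := X) (C := h * Cw)
        (fun s hs => (H.hasDerivAt_pos s hs).hasDerivWithinAt) (fun s hs => by
          rw [norm_smul, Real.norm_of_nonneg hh]; gcongr; exact hCw s hs) (convex_Icc 0 1) hs ht
      simpa using this
  have hWlip : ∀ s ∈ Icc (0 : ℝ) 1, ∀ t ∈ Icc (0 : ℝ) 1, ‖W t - W s‖ ≤ h * Cg * |t - s| :=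
    fun s hs t ht => by
      have := Convex.norm_image_sub_le_of_norm_hasDerivWithin_le (f := W) (C := h * Cg)
        (fun s hs => (H.hasDerivAt_vel s hs).hasDerivWithinAt) (fun s hs => by
          rw [norm_neg, norm_smul, Real.norm_of_nonneg hh]; gcongr; exact hCg s hs)
        (convex_Icc 0 1) hs ht
      simpa using this
  have hsub : ∀ s δ t : ℝ, 0 ≤ s → s + δ ≤ 1 → t ∈ Icc s (s + δ) → t ∈ Icc (0 : ℝ) 1 :=
    fun s δ t h0 h1 ht => ⟨h0.trans ht.1, ht.2.trans h1⟩
  have hXloc : ∀ s δ : ℝ, 0 ≤ s → 0 ≤ δ → s + δ ≤ 1 →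
      ‖X (s + δ) - X s - (δ * h) • W s‖ ≤ h * (h * Cg * δ) * δ := fun s δ h0 hδ h1 => by
    have hmem := hsub s δ
    have := Convex.norm_image_sub_le_of_norm_hasDerivWithin_le
      (f := fun t => X t - (t * h) • W s) (C := h * (h * Cg * δ)) (s := Icc s (s + δ))
      (fun t ht => ((H.hasDerivAt_pos t (hmem t h0 h1 ht)).sub
        (((hasDerivAt_id t).mul_const h).smul_const (W s))).hasDerivWithinAt) (fun t ht => by
          rw [one_mul, ← smul_sub, norm_smul, Real.norm_of_nonneg hh]
          have hs : s ∈ Icc (0 : ℝ) 1 := ⟨h0, by linarith⟩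
          have h2 := hWlip s hs t (hmem t h0 h1 ht)
          have h3 : |t - s| ≤ δ := by rw [abs_of_nonneg (by linarith [ht.1])]; linarith [ht.2]
          gcongr
          exact h2.trans (by gcongr)) (convex_Icc _ _) (left_mem_Icc.2 (by linarith))
      (right_mem_Icc.2 (by linarith))
    have e : X (s + δ) - ((s + δ) * h) • W s - (X s - (s * h) • W s)
        = X (s + δ) - X s - (δ * h) • W s := by rw [add_mul, add_smul]; abel
    rw [e] at this
    simpa [abs_of_nonneg hδ] using this
  have hWloc : ∀ s δ : ℝ, 0 ≤ s → 0 ≤ δ → s + δ ≤ 1 →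
      ‖W (s + δ) - W s + (δ * h) • g (X s)‖ ≤ h * (K * (h * Cw * δ)) * δ := fun s δ h0 hδ h1 => by
    have hmem := hsub s δ
    have := Convex.norm_image_sub_le_of_norm_hasDerivWithin_le
      (f := fun t => W t + (t * h) • g (X s)) (C := h * (K * (h * Cw * δ))) (s := Icc s (s + δ))
      (fun t ht => ((H.hasDerivAt_vel t (hmem t h0 h1 ht)).add
        (((hasDerivAt_id t).mul_const h).smul_const (g (X s)))).hasDerivWithinAt) (fun t ht => by
          rw [one_mul, neg_add_eq_sub, ← smul_sub, norm_smul, Real.norm_of_nonneg hh]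
          have hs : s ∈ Icc (0 : ℝ) 1 := ⟨h0, by linarith⟩
          have h2 := hXlip t (hmem t h0 h1 ht) s hs
          have h3 : |s - t| ≤ δ := by
            rw [abs_sub_comm, abs_of_nonneg (by linarith [ht.1])]; linarith [ht.2]
          gcongr
          refine (hg _ _).trans ?_
          gcongr
          exact h2.trans (by gcongr)) (convex_Icc _ _) (left_mem_Icc.2 (by linarith))
      (right_mem_Icc.2 (by linarith))
    have e : W (s + δ) + ((s + δ) * h) • g (X s) - (W s + (s * h) • g (X s))
        = W (s + δ) - W s + (δ * h) • g (X s) := by rw [add_mul, add_smul]; abel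
    rw [e] at this
    simpa [abs_of_nonneg hδ] using this
  set a : ℝ := h * K + h + h ^ 2 * K with ha
  set c : ℝ := 2 * h ^ 2 * Cg + h ^ 2 * K * Cw with hc
  have ha0 : 0 ≤ a := by positivity
  have hc0 : 0 ≤ c := by positivity
  have key : ∀ N : ℕ, 0 < N → ∀ k : ℕ, k ≤ N →
      ‖((eulerStep g (h / N))^[k] (x, v)).1 - X (k / N)‖ +
        ‖((eulerStep g (h / N))^[k] (x, v)).2 - W (k / N)‖
      ≤ k * ((1 / N) ^ 2 * c) * (1 + 1 / N * a) ^ k := by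
    intro N hN k
    have hN' : (0 : ℝ) < N := by exact_mod_cast hN
    have hN1 : (1 : ℝ) ≤ N := by exact_mod_cast hN
    induction k with
    | zero => intro _; simp [H.pos_zero, H.vel_zero]
    | succ k ih =>
      intro hk
      have ih := ih (by omega)
      rw [Function.iterate_succ_apply']
      set z := (eulerStep g (h / N))^[k] (x, v) with hz
      set δ : ℝ := 1 / N with hδ
      have hδ0 : 0 ≤ δ := by positivity
      have hδ1 : δ ≤ 1 := by rw [hδ, div_le_one hN']; exact hN1
      have hs0 : (0 : ℝ) ≤ k / N := by positivity
      have hs1 : (k : ℝ) / N + δ ≤ 1 := by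
        rw [hδ, ← add_div, div_le_one hN']; exact_mod_cast hk
      have hsk : ((k + 1 : ℕ) : ℝ) / N = k / N + δ := by push_cast; rw [add_div]
      have hhN : h / N = δ * h := by rw [hδ]; ring
      set s : ℝ := k / N with hs
      have hs' : s ∈ Icc (0 : ℝ) 1 := ⟨hs0, by linarith⟩
      rw [hsk, hhN]
      simp only [eulerStep]
      have w1 : ‖z.2 - (δ * h) • g z.1 - W (s + δ)‖
          ≤ ‖z.2 - W s‖ + δ * h * (K * ‖z.1 - X s‖) + h * (K * (h * Cw * δ)) * δ := by
        have e : z.2 - (δ * h) • g z.1 - W (s + δ) = (z.2 - W s) - (δ * h) • (g z.1 - g (X s))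
            - (W (s + δ) - W s + (δ * h) • g (X s)) := by rw [smul_sub]; abel
        rw [e]
        refine (norm_sub_le _ _).trans (add_le_add ((norm_sub_le _ _).trans
          (add_le_add le_rfl ?_)) (hWloc s δ hs0 hδ0 hs1))
        rw [norm_smul, Real.norm_of_nonneg (by positivity)]
        gcongr; exact hg _ _
      have w2 : ‖z.1 + (δ * h) • (z.2 - (δ * h) • g z.1) - X (s + δ)‖
          ≤ ‖z.1 - X s‖ + δ * h * ‖z.2 - W s‖ + δ * h * (δ * h * (Cg + K * ‖z.1 - X s‖))
            + h * (h * Cg * δ) * δ := by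
        have e : z.1 + (δ * h) • (z.2 - (δ * h) • g z.1) - X (s + δ)
            = (z.1 - X s) + (δ * h) • (z.2 - W s) - (δ * h) • ((δ * h) • g z.1)
            - (X (s + δ) - X s - (δ * h) • W s) := by rw [smul_sub, smul_sub]; abel
        rw [e]
        refine (norm_sub_le _ _).trans (add_le_add ((norm_sub_le _ _).trans
          (add_le_add ((norm_add_le _ _).trans (add_le_add le_rfl ?_)) ?_))
          (hXloc s δ hs0 hδ0 hs1))
        · rw [norm_smul, Real.norm_of_nonneg (by positivity)]
        · rw [norm_smul, norm_smul, Real.norm_of_nonneg (by positivity)]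
          have : ‖g z.1‖ ≤ ‖g (X s)‖ + ‖g z.1 - g (X s)‖ := by
            simpa using norm_add_le (g (X s)) (g z.1 - g (X s))
          have h1 := hg z.1 (X s)
          have h2 := hCg s hs'
          gcongr
          linarith
      set e := ‖z.1 - X s‖
      set r := ‖z.2 - W s‖
      have he0 : 0 ≤ e := norm_nonneg _
      have hr0 : 0 ≤ r := norm_nonneg _
      have step : ‖z.1 + (δ * h) • (z.2 - (δ * h) • g z.1) - X (s + δ)‖ +
          ‖z.2 - (δ * h) • g z.1 - W (s + δ)‖ ≤ (1 + δ * a) * (e + r) + δ ^ 2 * c := by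
        have i1 : δ * δ * (h ^ 2 * K * e) ≤ δ * 1 * (h ^ 2 * K * e) := by gcongr
        have i2 : 0 ≤ δ * (h * K * r) := by positivity
        have i3 : 0 ≤ δ * (h * e) := by positivity
        have i4 : 0 ≤ δ * (h ^ 2 * K * r) := by positivity
        rw [ha, hc]
        nlinarith
      refine step.trans ?_
      have hpow : 1 ≤ (1 + δ * a) ^ (k + 1) := one_le_pow₀ (by nlinarith)
      calc (1 + δ * a) * (e + r) + δ ^ 2 * c
          ≤ (1 + δ * a) * (k * (δ ^ 2 * c) * (1 + δ * a) ^ k) + δ ^ 2 * c * (1 + δ * a) ^ (k + 1) := by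
            refine add_le_add (mul_le_mul_of_nonneg_left ih (by positivity)) ?_
            exact le_mul_of_one_le_right (by positivity) hpow
        _ = ((k + 1 : ℕ) : ℝ) * (δ ^ 2 * c) * (1 + δ * a) ^ (k + 1) := by push_cast; ring
  have fin : ∀ N : ℕ, 0 < N → dist ((eulerStep g (h / N))^[N] (x, v)) (X 1, W 1)
      ≤ c * Real.exp a * (1 / N) := by
    intro N hN
    have hN' : (0 : ℝ) < N := by exact_mod_cast hN
    have h1 := key N hN N le_rfl
    rw [div_self hN'.ne'] at h1
    have h2 : (1 + 1 / (N : ℝ) * a) ^ N ≤ Real.exp a := by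
      have := Real.add_one_le_exp (1 / (N : ℝ) * a)
      calc (1 + 1 / (N : ℝ) * a) ^ N ≤ Real.exp (1 / (N : ℝ) * a) ^ N := by
            gcongr; linarith
        _ = Real.exp a := by rw [← Real.exp_nat_mul]; congr 1; field_simp
    have h3 : dist ((eulerStep g (h / N))^[N] (x, v)) (X 1, W 1) ≤
        ‖((eulerStep g (h / N))^[N] (x, v)).1 - X 1‖ +
        ‖((eulerStep g (h / N))^[N] (x, v)).2 - W 1‖ := by
      rw [Prod.dist_eq, dist_eq_norm, dist_eq_norm]
      exact max_le (le_add_of_nonneg_right (norm_nonneg _)) (le_add_of_nonneg_left (norm_nonneg _))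
    refine h3.trans (h1.trans ?_)
    calc (N : ℝ) * ((1 / N) ^ 2 * c) * (1 + 1 / N * a) ^ N
        ≤ (N : ℝ) * ((1 / N) ^ 2 * c) * Real.exp a := by gcongr
      _ = c * Real.exp a * (1 / N) := by field_simp
  rw [tendsto_iff_dist_tendsto_zero]
  refine squeeze_zero' (Eventually.of_forall fun _ => dist_nonneg)
    ((eventually_gt_atTop 0).mono fun N hN => fin N hN) ?_
  simpa using tendsto_one_div_atTop_nhds_zero_nat.const_mul (c * Real.exp a)

end EulerConvergence

/-! ### Gibbs measures -/

lemma QuadBounds.quadratic_lower {E : Type*} [NormedAddCommGroup E] [InnerProductSpace ℝ E]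
    {f : E → ℝ} {g : E → E} {m K : ℝ} (Q : QuadBounds f g m K) (hm : 0 < m) (x : E) :
    f 0 - ‖g 0‖ ^ 2 / m + m / 4 * ‖x‖ ^ 2 ≤ f x := by
  have h1 := Q.lower 0 x
  rw [sub_zero] at h1
  have h2 := (abs_le.1 (abs_real_inner_le_norm (g 0) x)).1
  have h3 : ‖g 0‖ * ‖x‖ ≤ ‖g 0‖ ^ 2 / m + m / 4 * ‖x‖ ^ 2 := by
    have : 0 ≤ (‖g 0‖ / m - ‖x‖ / 2) ^ 2 * m := by positivity
    have e : (‖g 0‖ / m - ‖x‖ / 2) ^ 2 * m = ‖g 0‖ ^ 2 / m + m / 4 * ‖x‖ ^ 2 - ‖g 0‖ * ‖x‖ := by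
      field_simp; ring
    linarith
  linarith

lemma QuadBounds.exp_neg_le {E : Type*} [NormedAddCommGroup E] [InnerProductSpace ℝ E]
    {f : E → ℝ} {g : E → E} {m K : ℝ} (Q : QuadBounds f g m K) (hm : 0 < m) (x : E) :
    (1 + ‖x‖ ^ 2) * Real.exp (-f x)
      ≤ (1 + 8 / m) * Real.exp (‖g 0‖ ^ 2 / m - f 0) * Real.exp (-(m / 8) * ‖x‖ ^ 2) := by
  have h1 := Q.quadratic_lower hm x
  have h2 : Real.exp (-f x) ≤
      Real.exp (‖g 0‖ ^ 2 / m - f 0) * Real.exp (-(m / 8) * ‖x‖ ^ 2) *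
        Real.exp (-(m / 8 * ‖x‖ ^ 2)) := by
    rw [← Real.exp_add, ← Real.exp_add]
    exact Real.exp_le_exp.2 (by linarith)
  have h3 : (1 + ‖x‖ ^ 2) ≤ (1 + 8 / m) * Real.exp (m / 8 * ‖x‖ ^ 2) := by
    have h4 := Real.add_one_le_exp (m / 8 * ‖x‖ ^ 2)
    have h5 : 0 ≤ m / 8 * ‖x‖ ^ 2 := by positivity
    have h6 : ‖x‖ ^ 2 = 8 / m * (m / 8 * ‖x‖ ^ 2) := by field_simp
    have h7 : 0 < 8 / m := by positivity
    have h8 : 8 / m * (m / 8 * ‖x‖ ^ 2 + 1) ≤ 8 / m * Real.exp (m / 8 * ‖x‖ ^ 2) := by gcongr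
    nlinarith
  calc (1 + ‖x‖ ^ 2) * Real.exp (-f x)
      ≤ ((1 + 8 / m) * Real.exp (m / 8 * ‖x‖ ^ 2)) *
        (Real.exp (‖g 0‖ ^ 2 / m - f 0) * Real.exp (-(m / 8) * ‖x‖ ^ 2) *
        Real.exp (-(m / 8 * ‖x‖ ^ 2))) := by gcongr
    _ = _ := by
      rw [Real.exp_neg (m / 8 * ‖x‖ ^ 2)]
      field_simp

section Gibbs

variable {E : Type*} [NormedAddCommGroup E] [InnerProductSpace ℝ E] [FiniteDimensional ℝ E]
  [MeasurableSpace E] [BorelSpace E]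

lemma integrable_exp_neg_mul_sq_norm {b : ℝ} (hb : 0 < b) :
    Integrable (fun x : E => Real.exp (-b * ‖x‖ ^ 2)) := by
  refine Integrable.of_integral_ne_zero ?_
  rw [GaussianFourier.integral_rexp_neg_mul_sq_norm hb]
  positivity

/-- Both probability measures have the characteristic function exp(-‖t‖²/2). -/
lemma stdGaussian_eq_tilted :
    stdGaussian E = (volume : Measure E).tilted (fun v => -(‖v‖ ^ 2 / 2)) := by
  have hint : Integrable (fun v : E => Real.exp (-(‖v‖ ^ 2 / 2))) := by
    refine (integrable_exp_neg_mul_sq_norm (E := E) (b := 1 / 2) (by norm_num)).congr ?_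
    exact ae_of_all _ fun v => by simp only; congr 1; ring
  have := isProbabilityMeasure_tilted hint
  refine Measure.ext_of_charFun ?_
  funext t
  rw [charFun_stdGaussian, charFun_apply, integral_tilted]
  have e0 : ∫ v : E, Real.exp (-(‖v‖ ^ 2 / 2))
      = (Real.pi / (1 / 2)) ^ (Module.finrank ℝ E / 2 : ℝ) := by
    rw [← GaussianFourier.integral_rexp_neg_mul_sq_norm (V := E) (b := 1 / 2) (by norm_num)]
    congr 1; funext v; congr 1; ring
  have e1 := GaussianFourier.integral_cexp_neg_mul_sq_norm_add (V := E) (b := 1 / 2)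
    (by norm_num) Complex.I t
  have e2 : ∀ v : E, (Real.exp (-(‖v‖ ^ 2 / 2)) / ∫ v : E, Real.exp (-(‖v‖ ^ 2 / 2))) •
      Complex.exp (⟪v, t⟫ * Complex.I)
      = ((∫ v : E, Real.exp (-(‖v‖ ^ 2 / 2)) : ℝ) : ℂ)⁻¹ *
        Complex.exp (-(1 / 2) * ‖v‖ ^ 2 + Complex.I * ⟪t, v⟫) := fun v => by
    rw [Complex.exp_add, Complex.real_smul, real_inner_comm]
    push_cast
    rw [mul_comm Complex.I]
    ring_nf
  simp_rw [e2]
  rw [integral_const_mul, e1, e0]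
  have hne : ((Real.pi / (1 / 2) : ℝ) ^ (Module.finrank ℝ E / 2 : ℝ) : ℝ) ≠ 0 := by positivity
  have e3 : (((Real.pi / (1 / 2) : ℝ) ^ (Module.finrank ℝ E / 2 : ℝ) : ℝ) : ℂ)
      = ((Real.pi : ℂ) / (1 / 2)) ^ (Module.finrank ℝ E / 2 : ℂ) := by
    rw [Complex.ofReal_cpow (by positivity)]
    push_cast; rfl
  rw [← e3, ← mul_assoc, inv_mul_cancel₀ (by exact_mod_cast hne), one_mul, Complex.I_sq]
  congr 1; ring

variable {f : E → ℝ} {g : E → E} {m K : ℝ}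

lemma QuadBounds.integrable (Q : QuadBounds f g m K) (hm : 0 < m) (hf : Continuous f) :
    Integrable (fun x => (1 + ‖x‖ ^ 2) * Real.exp (-f x)) := by
  refine ((integrable_exp_neg_mul_sq_norm (E := E) (b := m / 8) (by positivity)).const_mul
    ((1 + 8 / m) * Real.exp (‖g 0‖ ^ 2 / m - f 0))).mono' (by fun_prop) (ae_of_all _ fun x => ?_)
  rw [Real.norm_of_nonneg (by positivity)]
  exact Q.exp_neg_le hm x

lemma QuadBounds.integrable_exp (Q : QuadBounds f g m K) (hm : 0 < m) (hf : Continuous f) :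
    Integrable (fun x => Real.exp (-f x)) := by
  refine (Q.integrable hm hf).mono' (by fun_prop) (ae_of_all _ fun x => ?_)
  rw [Real.norm_of_nonneg (by positivity)]
  exact le_mul_of_one_le_left (by positivity) (by nlinarith [norm_nonneg x])

lemma QuadBounds.isProbabilityMeasure (Q : QuadBounds f g m K) (hm : 0 < m) (hf : Continuous f) :
    IsProbabilityMeasure ((volume : Measure E).tilted (fun x => -f x)) :=
  isProbabilityMeasure_tilted (Q.integrable_exp hm hf)

/-- Only finiteness matters here: it lets the stationarity inequality be solved for the second
moment, which then receives its explicit bound. -/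
lemma QuadBounds.lintegral_sq_norm_lt_top (Q : QuadBounds f g m K) (hm : 0 < m)
    (hf : Continuous f) :
    ∫⁻ x, ENNReal.ofReal (‖x‖ ^ 2) ∂((volume : Measure E).tilted (fun x => -f x)) < ⊤ := by
  rw [lintegral_tilted]
  have hi := (Q.integrable hm hf).div_const (∫ x, Real.exp (-f x))
  refine lt_of_le_of_lt (lintegral_mono fun x => ?_) hi.lintegral_lt_top
  have hZ : 0 ≤ ∫ x, Real.exp (-f x) := integral_nonneg fun x => (Real.exp_pos _).le
  rw [← ENNReal.ofReal_mul (by positivity)]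
  refine ENNReal.ofReal_le_ofReal ?_
  rw [div_mul_eq_mul_div, mul_comm]
  gcongr
  linarith

end Gibbs

/-! ### Invariance of the Gibbs measure under the Hamiltonian flow -/

section Invariance

variable {E : Type*} [NormedAddCommGroup E] [InnerProductSpace ℝ E]
  {f : E → ℝ} {g : E → E} {h K : ℝ} {x v : E} {X W : ℝ → E}

lemma IsTraj.energy_eq [CompleteSpace E] (H : IsTraj g h x v X W)
    (hf : ∀ x, HasGradientAt f (g x) x) :
    f (X 1) + ‖W 1‖ ^ 2 / 2 = f x + ‖v‖ ^ 2 / 2 := by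
  have hd : ∀ s ∈ Icc (0 : ℝ) 1, HasDerivAt (fun s => f (X s) + ‖W s‖ ^ 2 / 2) 0 s := fun s hs => by
    have h1 := (hf (X s)).hasFDerivAt.comp_hasDerivAt s (H.hasDerivAt_pos s hs)
    have h2 := ((H.hasDerivAt_vel s hs).norm_sq).div_const 2
    refine (h1.add h2).congr_deriv ?_
    simp [inner_smul_right, real_inner_comm]
    ring
  have := Convex.norm_image_sub_le_of_norm_hasDerivWithin_le (C := 0)
    (fun s hs => (hd s hs).hasDerivWithinAt) (fun s _ => by simp) (convex_Icc (0 : ℝ) 1)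
    (left_mem_Icc.2 zero_le_one) (right_mem_Icc.2 zero_le_one)
  simp only [zero_mul, norm_le_zero_iff, sub_eq_zero, H.pos_zero, H.vel_zero] at this
  exact this

variable [FiniteDimensional ℝ E] [MeasurableSpace E] [BorelSpace E]

/-- The density against Lebesgue measure on phase space depends on (x, v) only through the energy,
which the flow conserves. -/
lemma lintegral_prod_tilted (hf : Continuous f) {G : E × E → ℝ≥0∞} (hG : Measurable G) :
    ∫⁻ z, G z ∂((volume.tilted fun x : E => -f x).prod (stdGaussian E))
      = ∫⁻ z, ENNReal.ofReal (Real.exp (-(f z.1 + ‖z.2‖ ^ 2 / 2)) /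
          ((∫ x : E, Real.exp (-f x)) * ∫ v : E, Real.exp (-(‖v‖ ^ 2 / 2)))) * G z
          ∂((volume : Measure E).prod volume) := by
  rw [lintegral_prod _ hG.aemeasurable, lintegral_tilted, lintegral_prod]
  · refine lintegral_congr fun x => ?_
    rw [stdGaussian_eq_tilted, lintegral_tilted, ← lintegral_const_mul]
    · refine lintegral_congr fun v => ?_
      rw [← mul_assoc, ← ENNReal.ofReal_mul]
      · congr 2
        rw [div_mul_div_comm, ← Real.exp_add]
        congr 2; ring
      · exact div_nonneg (Real.exp_pos _).le (integral_nonneg fun x => (Real.exp_pos _).le)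
    · exact (by fun_prop : Measurable _).mul (hG.comp measurable_prodMk_left)
  · exact ((by fun_prop : Measurable _).mul hG).aemeasurable

variable {Φ : E × E → E × E}

/-- The time-one map is a pointwise limit of continuous Euler iterates, so no regularity of the flow
in its initial data has to be established. -/
lemma measurable_of_isTraj (hh : 0 ≤ h) (hK : 0 ≤ K) (hg : ∀ x y, ‖g x - g y‖ ≤ K * ‖x - y‖)
    (hΦ : ∀ z, ∃ X W, IsTraj g h z.1 z.2 X W ∧ Φ z = (X 1, W 1)) : Measurable Φ := by
  have hgc : Continuous g := (LipschitzWith.of_dist_le_mul (K := ⟨K, hK⟩) fun x y => by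
    rw [dist_eq_norm, dist_eq_norm]; exact hg x y).continuous
  refine measurable_of_tendsto_metrizable
    (f := fun N : ℕ => (eulerStep g (h / N))^[N])
    (fun N => ((continuous_eulerStep hgc _).iterate N).measurable) ?_
  rw [tendsto_pi_nhds]
  intro z
  obtain ⟨X, W, H, e⟩ := hΦ z
  rw [e]
  exact H.tendsto_euler hh hK hg

/-- The Hamiltonian flow preserves the product of the Gibbs measure and the Gaussian measure. -/
theorem measurePreserving_flow (hh : 0 ≤ h) (hK : 0 ≤ K) (hg : ∀ x y, ‖g x - g y‖ ≤ K * ‖x - y‖)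
    (hf : ∀ x, HasGradientAt f (g x) x)
    [IsProbabilityMeasure ((volume : Measure E).tilted fun x => -f x)]
    (hΦ : ∀ z, ∃ X W, IsTraj g h z.1 z.2 X W ∧ Φ z = (X 1, W 1)) :
    MeasurePreserving Φ ((volume.tilted fun x : E => -f x).prod (stdGaussian E))
      ((volume.tilted fun x : E => -f x).prod (stdGaussian E)) := by
  have hgc : Continuous g := (LipschitzWith.of_dist_le_mul (K := ⟨K, hK⟩) fun x y => by
    rw [dist_eq_norm, dist_eq_norm]; exact hg x y).continuous
  have hfc : Continuous f := continuous_iff_continuousAt.2 fun x => (hf x).continuousAt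
  have hΦm := measurable_of_isTraj hh hK hg hΦ
  refine ⟨hΦm, ?_⟩
  set P := (volume.tilted fun x : E => -f x).prod (stdGaussian E) with hP
  have hPmap : IsProbabilityMeasure (P.map Φ) := Measure.isProbabilityMeasure_map hΦm.aemeasurable
  set Z := (∫ x : E, Real.exp (-f x)) * ∫ v : E, Real.exp (-(‖v‖ ^ 2 / 2)) with hZ
  have hZ0 : 0 ≤ Z := mul_nonneg (integral_nonneg fun x => (Real.exp_pos _).le)
    (integral_nonneg fun x => (Real.exp_pos _).le)
  -- Fatou's lemma along the Euler iterates, whose integrals against Lebesgue measure are all equal,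
  -- gives one inequality for nonnegative continuous test functions.
  have key : ∀ u : E × E → ℝ≥0, Continuous u →
      ∫⁻ z, u z ∂(P.map Φ) ≤ ∫⁻ z, u z ∂P := by
    intro u hu
    set G : E × E → ℝ≥0∞ := fun z =>
      ENNReal.ofReal (Real.exp (-(f z.1 + ‖z.2‖ ^ 2 / 2)) / Z * u z) with hG
    have hGc : Continuous G := by
      refine ENNReal.continuous_ofReal.comp ?_
      have := NNReal.continuous_coe.comp hu
      fun_prop
    have hGeq : ∀ z, ENNReal.ofReal (Real.exp (-(f z.1 + ‖z.2‖ ^ 2 / 2)) / Z) * u z = G z :=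
      fun z => by
        simp only [hG]
        rw [ENNReal.ofReal_mul (by positivity), ENNReal.ofReal_coe_nnreal]
    have hum : Measurable fun z => (u z : ℝ≥0∞) := hu.measurable.coe_nnreal_ennreal
    rw [lintegral_map hum hΦm, hP, lintegral_prod_tilted hfc (G := fun z => (u (Φ z) : ℝ≥0∞)) (hum.comp hΦm),
      lintegral_prod_tilted hfc hum]
    rw [← hZ]
    simp_rw [hGeq]
    have hGΦ : ∀ z, ENNReal.ofReal (Real.exp (-(f z.1 + ‖z.2‖ ^ 2 / 2)) / Z) * u (Φ z)
        = G (Φ z) := fun z => by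
      obtain ⟨X, W, H, e⟩ := hΦ z
      rw [← hGeq (Φ z), e, H.energy_eq hf]
    have hlim : ∀ z, G (Φ z)
        = liminf (fun N : ℕ => G ((eulerStep g (h / N))^[N] z)) atTop := fun z => by
      obtain ⟨X, W, H, e⟩ := hΦ z
      have := (hGc.tendsto _).comp (H.tendsto_euler hh hK hg)
      rw [e]
      exact this.liminf_eq.symm
    have hpres : ∀ N : ℕ, ∫⁻ z, G ((eulerStep g (h / N))^[N] z) ∂((volume : Measure E).prod volume)
        = ∫⁻ z, G z ∂((volume : Measure E).prod volume) := fun N =>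
      ((measurePreserving_eulerStep hgc (h / N)).iterate N).lintegral_comp hGc.measurable
    calc ∫⁻ z, ENNReal.ofReal (Real.exp (-(f z.1 + ‖z.2‖ ^ 2 / 2)) / Z) * u (Φ z)
          ∂((volume : Measure E).prod volume)
        = ∫⁻ z, liminf (fun N : ℕ => G ((eulerStep g (h / N))^[N] z)) atTop
          ∂((volume : Measure E).prod volume) :=
          lintegral_congr fun z => (hGΦ z).trans (hlim z)
      _ ≤ liminf (fun N : ℕ => ∫⁻ z, G ((eulerStep g (h / N))^[N] z)
          ∂((volume : Measure E).prod volume)) atTop :=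
          lintegral_liminf_le fun N =>
            (hGc.comp ((continuous_eulerStep hgc _).iterate N)).measurable
      _ = _ := by simp_rw [hpres]; exact liminf_const _
  refine ext_of_forall_lintegral_eq_of_IsFiniteMeasure fun u => le_antisymm
    (key u u.continuous) ?_
  obtain ⟨c, hc⟩ : ∃ c : ℝ≥0, ∀ z, u z ≤ c := ⟨nndist u 0, fun z => by
    have := BoundedContinuousFunction.nndist_coe_le_nndist (f := u) (g := 0) z
    simpa [NNReal.nndist_zero_eq_val'] using this⟩
  -- The reverse inequality is the same one for c - u, since both measures have mass one. The
  -- truncated subtraction is harmless because u ≤ c.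
  have h1 := key (fun z => c - u z) (by fun_prop)
  have h2 : ∀ ρ : Measure (E × E), IsProbabilityMeasure ρ →
      (∫⁻ z, u z ∂ρ) + ∫⁻ z, ((c - u z : ℝ≥0) : ℝ≥0∞) ∂ρ = c := fun ρ hρ => by
    rw [← lintegral_add_left u.continuous.measurable.coe_nnreal_ennreal]
    have : ∀ z, (u z : ℝ≥0∞) + ((c - u z : ℝ≥0) : ℝ≥0∞) = c := fun z => by
      rw [← ENNReal.coe_add, add_tsub_cancel_of_le (hc z)]
    simp_rw [this]
    simp
  have h3 := h2 P inferInstance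
  have h4 := h2 (P.map Φ) hPmap
  have h5 : ∫⁻ z, ((c - u z : ℝ≥0) : ℝ≥0∞) ∂P ≠ ⊤ := by
    refine ne_top_of_le_ne_top ENNReal.coe_ne_top (h3 ▸ le_add_self : _ ≤ (c : ℝ≥0∞))
  refine ENNReal.le_of_add_le_add_right h5 ?_
  rw [h3, ← h4]
  gcongr

end Invariance

/-! ### Quadrature weights at Chebyshev nodes -/

section Chebyshev

lemma chebNode_mem_Icc (D i : ℕ) : chebNode D i ∈ Icc (0 : ℝ) 1 := by
  have h1 := Real.neg_one_le_cos ((2 * i + 1) * Real.pi / (2 * D))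
  have h2 := Real.cos_le_one ((2 * i + 1) * Real.pi / (2 * D))
  constructor <;> · unfold chebNode; linarith

lemma chebNode_injOn (D : ℕ) : Set.InjOn (chebNode D) (Finset.range D) := by
  intro i hi j hj hij
  simp only [Finset.coe_range, mem_Iio] at hi hj
  have hD : (0 : ℝ) < D := by exact_mod_cast (by omega : 0 < D)
  have hmem : ∀ k < D, (2 * (k : ℝ) + 1) * Real.pi / (2 * D) ∈ Icc 0 Real.pi := fun k hk => by
    have hk' : (k : ℝ) + 1 ≤ D := by exact_mod_cast hk
    refine ⟨by positivity, ?_⟩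
    rw [div_le_iff₀ (by positivity)]
    nlinarith [Real.pi_pos]
  have h1 : Real.cos ((2 * i + 1) * Real.pi / (2 * D)) = Real.cos ((2 * j + 1) * Real.pi / (2 * D)) := by
    unfold chebNode at hij; linarith
  have h2 := Real.injOn_cos (hmem i hi) (hmem j hj) h1
  rw [div_left_inj' (by positivity)] at h2
  have h3 := mul_right_cancel₀ Real.pi_pos.ne' h2
  have h4 : (i : ℝ) = j := by linarith
  exact_mod_cast h4

/-- The interpolatory quadrature is exact for polynomials of degree less than `D`. -/
lemma sum_weight_mul_pow {D k : ℕ} (hk : k < D) (t : ℝ) :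
    ∑ j ∈ Finset.range D, weight D j t * chebNode D j ^ k = t ^ (k + 1) / (k + 1) := by
  have hinj := chebNode_injOn D
  have h1 : (Polynomial.X ^ k : Polynomial ℝ)
      = Lagrange.interpolate (Finset.range D) (chebNode D) (fun j => chebNode D j ^ k) := by
    have := Lagrange.eq_interpolate (f := (Polynomial.X ^ k : Polynomial ℝ)) hinj (by
      rw [Polynomial.degree_X_pow, Finset.card_range]; exact_mod_cast hk)
    simpa using this
  have h2 : ∀ s : ℝ, s ^ k = ∑ j ∈ Finset.range D, chebNode D j ^ k *
      (Lagrange.basis (Finset.range D) (chebNode D) j).eval s := fun s => by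
    have := congrArg (Polynomial.eval s) h1
    rw [Lagrange.interpolate_apply, Polynomial.eval_finsetSum] at this
    simpa using this
  have h3 : ∫ s in (0 : ℝ)..t, s ^ k = t ^ (k + 1) / (k + 1) := by
    rw [integral_pow]; simp
  rw [← h3, intervalIntegral.integral_congr (fun s _ => h2 s)]
  rw [intervalIntegral.integral_finsetSum fun j _ =>
    Continuous.intervalIntegrable (by fun_prop) _ _]
  refine Finset.sum_congr rfl fun j _ => ?_
  rw [intervalIntegral.integral_const_mul, weight, mul_comm]

/-- The squared basis polynomial has degree 2D - 2, and Gauss–Chebyshev quadrature with D nodes is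
exact below degree 2D. The square is 1 at one node and 0 at the others, so its integral in the angle
θ is π / D. The substitution s = (1 - cos θ)/2 only adds the factor sin θ / 2 ≤ 1/2. -/
lemma integral_sq_basis_le {D j : ℕ} (hj : j < D) :
    ∫ s in (0 : ℝ)..1, (Lagrange.basis (Finset.range D) (chebNode D) j).eval s ^ 2
      ≤ Real.pi / 2 := by
  have hinj := chebNode_injOn D
  have hD : D ≠ 0 := by omega
  set l := Lagrange.basis (Finset.range D) (chebNode D) j with hl
  set P : Polynomial ℝ := (l.comp (Polynomial.C (1 / 2) - Polynomial.C (1 / 2) * Polynomial.X)) ^ 2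
    with hP
  have hPe : ∀ x, P.eval x = l.eval ((1 - x) / 2) ^ 2 := fun x => by
    simp only [hP, Polynomial.eval_pow, Polynomial.eval_comp, Polynomial.eval_sub,
      Polynomial.eval_C, Polynomial.eval_mul, Polynomial.eval_X]
    congr 2; ring
  have hdeg : P.degree < 2 * D := by
    refine lt_of_le_of_lt Polynomial.degree_le_natDegree ?_
    have hl' : l.natDegree = D - 1 := by
      rw [hl, Lagrange.natDegree_basis hinj (Finset.mem_range.2 hj), Finset.card_range]
    have h1 : (Polynomial.C (1 / 2 : ℝ) - Polynomial.C (1 / 2) * Polynomial.X).natDegree ≤ 1 := by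
      compute_degree
    have h2 : P.natDegree ≤ 2 * ((D - 1) * 1) := by
      rw [hP]
      refine Polynomial.natDegree_pow_le.trans ?_
      gcongr
      refine Polynomial.natDegree_comp_le.trans ?_
      rw [hl']
      gcongr
    have : P.natDegree < 2 * D := by omega
    exact_mod_cast this
  have hsum : Polynomial.Chebyshev.sumZeroes D P = Real.pi / D := by
    rw [Polynomial.Chebyshev.sumZeroes]
    have : ∀ i ∈ Finset.range D, P.eval (Real.cos ((2 * i + 1) / (2 * D) * Real.pi))
        = if i = j then 1 else 0 := fun i hi => by
      have e : (1 - Real.cos ((2 * i + 1) / (2 * D) * Real.pi)) / 2 = chebNode D i := by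
        unfold chebNode; congr 3; ring
      rw [hPe, e]
      split_ifs with hij
      · rw [hij, hl, Lagrange.eval_basis_self hinj (Finset.mem_range.2 hj), one_pow]
      · rw [hl, Lagrange.eval_basis_of_ne (Ne.symm hij) hi]; simp
    rw [Finset.sum_congr rfl this]
    simp [hj]
  have hcheb : ∫ θ in (0 : ℝ)..Real.pi, l.eval ((1 - Real.cos θ) / 2) ^ 2 = Real.pi / D := by
    have := Polynomial.Chebyshev.integral_eq_sumZeroes hD hdeg
    rw [Polynomial.Chebyshev.integral_measureT_eq_integral_cos, hsum] at this
    simpa [hPe] using this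
  have hsubst : ∫ θ in (0 : ℝ)..Real.pi, ((fun s => l.eval s ^ 2) ∘
        fun θ => (1 - Real.cos θ) / 2) θ * (Real.sin θ / 2)
      = ∫ s in (0 : ℝ)..1, l.eval s ^ 2 := by
    have := intervalIntegral.integral_comp_mul_deriv (a := 0) (b := Real.pi)
      (f := fun θ => (1 - Real.cos θ) / 2) (f' := fun θ => Real.sin θ / 2)
      (g := fun s => l.eval s ^ 2)
      (fun θ _ => by simpa using ((Real.hasDerivAt_cos θ).const_sub 1).div_const 2)
      (by fun_prop) (by fun_prop)
    simpa using this
  rw [← hsubst]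
  calc ∫ θ in (0 : ℝ)..Real.pi, ((fun s => l.eval s ^ 2) ∘
        fun θ => (1 - Real.cos θ) / 2) θ * (Real.sin θ / 2)
      ≤ ∫ θ in (0 : ℝ)..Real.pi, l.eval ((1 - Real.cos θ) / 2) ^ 2 * (1 / 2) := by
        refine intervalIntegral.integral_mono_on Real.pi_pos.le
          (Continuous.intervalIntegrable (by fun_prop) _ _)
          (Continuous.intervalIntegrable (by fun_prop) _ _) fun θ _ => ?_
        simp only [Function.comp_apply]
        have := Real.sin_le_one θ
        gcongr
    _ = Real.pi / D * (1 / 2) := by rw [intervalIntegral.integral_mul_const, hcheb]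
    _ ≤ Real.pi / 2 := by
        have : (1 : ℝ) ≤ D := by exact_mod_cast (by omega : 1 ≤ D)
        have : Real.pi / D ≤ Real.pi := div_le_self Real.pi_pos.le this
        linarith

/-- From |ℓⱼ| ≤ (1 + ℓⱼ²)/2 and the L² bound. What matters is that the bound does not depend on D,
so that a sum over all nodes costs only a factor linear in D. -/
lemma abs_weight_le {D j : ℕ} (hj : j < D) {t : ℝ} (ht : t ∈ Icc (0 : ℝ) 1) :
    |weight D j t| ≤ 2 := by
  set l := Lagrange.basis (Finset.range D) (chebNode D) j with hl
  have h1 : |weight D j t| ≤ ∫ s in (0 : ℝ)..t, (1 + l.eval s ^ 2) / 2 := by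
    rw [← Real.norm_eq_abs]
    refine intervalIntegral.norm_integral_le_of_norm_le ht.1 (ae_of_all _ fun s _ => ?_)
      (Continuous.intervalIntegrable (by fun_prop) _ _)
    rw [Real.norm_eq_abs]
    nlinarith [sq_nonneg (|l.eval s| - 1), sq_abs (l.eval s)]
  have h2 : ∫ s in (0 : ℝ)..t, (1 + l.eval s ^ 2) / 2 ≤ ∫ s in (0 : ℝ)..1, (1 + l.eval s ^ 2) / 2 :=
    intervalIntegral.integral_mono_interval le_rfl ht.1 ht.2
      (ae_of_all _ fun s => by simp only [Pi.zero_apply]; positivity)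
      (Continuous.intervalIntegrable (by fun_prop) _ _)
  have h3 : ∫ s in (0 : ℝ)..1, (1 + l.eval s ^ 2) / 2
      = (1 + ∫ s in (0 : ℝ)..1, l.eval s ^ 2) / 2 := by
    rw [intervalIntegral.integral_div, intervalIntegral.integral_add (by simp)
      (Continuous.intervalIntegrable (by fun_prop) _ _)]
    simp
  have h4 := integral_sq_basis_le hj
  have h5 := Real.pi_lt_four
  linarith

end Chebyshev

/-! ### Semantics and cost of the collocation program -/

section Semantics

variable {E : Type*} [AddCommGroup E] [Module ℝ E] (g : E → E)

/-- One fixed-point iteration of the collocation method on nodal positions and velocities. -/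
def sweep (D : ℕ) (h : ℝ) (x v : E) (s : (ℕ → E) × (ℕ → E)) : (ℕ → E) × (ℕ → E) :=
  (fun i => x + ∑ j ∈ Finset.range D, (h * weight D j (chebNode D i)) • s.2 j,
    fun i => v + ∑ j ∈ Finset.range D, (-(h * weight D j (chebNode D i))) • g (s.1 j))

/-- The output of the collocation method. -/
def collocation (D J : ℕ) (h : ℝ) (x v : E) : E :=
  x + ∑ j ∈ Finset.range D, (h * weight D j 1) •
    ((sweep g D h x v)^[J] (fun _ => x, fun _ => v)).2 j

lemma exec_append (P Q : Program) (R : ℕ → E) :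
    Program.exec g (P ++ Q) R = Program.exec g Q (Program.exec g P R) :=
  List.foldl_append

lemma exec_cons (i : Instr) (P : Program) (R : ℕ → E) :
    Program.exec g (i :: P) R = Program.exec g P (i.exec g R) := rfl

lemma exec_nil (R : ℕ → E) : Program.exec g [] R = R := rfl

lemma exec_grads {T S : ℕ → ℕ} (hT : Function.Injective T) (hTS : ∀ i j, S j ≠ T i) (n : ℕ)
    (R : ℕ → E) :
    (∀ j < n, Program.exec g ((List.range n).map fun j => Instr.grad (T j) (S j)) R (T j)
      = g (R (S j))) ∧
    ∀ k, (∀ j, k ≠ T j) →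
      Program.exec g ((List.range n).map fun j => Instr.grad (T j) (S j)) R k = R k := by
  induction n with
  | zero => simp [exec_nil]
  | succ n ih =>
    simp only [List.range_succ, List.map_append, exec_append, List.map_cons, List.map_nil,
      exec_cons, exec_nil, Instr.exec]
    refine ⟨fun j hj => ?_, fun k hk => ?_⟩
    · rcases Nat.lt_succ_iff_lt_or_eq.1 hj with h | rfl
      · rw [Function.update_of_ne (hT.ne h.ne), ih.1 j h]
      · rw [Function.update_self, ih.2 _ fun i => hTS i j]
    · rw [Function.update_of_ne (hk n), ih.2 k hk]

lemma exec_addMuls (t : ℕ) {S : ℕ → ℕ} (hS : ∀ j, S j ≠ t) (c : ℕ → ℝ) (n : ℕ) (R : ℕ → E) :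
    Program.exec g ((List.range n).map fun j => Instr.addMul t t (S j) (c j)) R t
      = R t + ∑ j ∈ Finset.range n, c j • R (S j) ∧
    ∀ k, k ≠ t →
      Program.exec g ((List.range n).map fun j => Instr.addMul t t (S j) (c j)) R k = R k := by
  induction n with
  | zero => simp [exec_nil]
  | succ n ih =>
    simp only [List.range_succ, List.map_append, exec_append, List.map_cons, List.map_nil,
      exec_cons, exec_nil, Instr.exec]
    refine ⟨?_, fun k hk => ?_⟩
    · rw [Function.update_self, ih.1, ih.2 _ (hS n), Finset.sum_range_succ, add_assoc]
    · rw [Function.update_of_ne hk, ih.2 k hk]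

/-- No target register is read by any of the combinations, so sequential execution has the effect of
simultaneous assignment. -/
lemma exec_combinations {T S : ℕ → ℕ} (s : ℕ) (hT : Function.Injective T)
    (hTS : ∀ i j, S j ≠ T i) (hs : ∀ i, s ≠ T i) (c : ℕ → ℕ → ℝ) (D n : ℕ) (R : ℕ → E) :
    (∀ i < n, Program.exec g ((List.range n).flatMap fun i => Instr.copy (T i) s ::
        (List.range D).map fun j => Instr.addMul (T i) (T i) (S j) (c i j)) R (T i)
      = R s + ∑ j ∈ Finset.range D, c i j • R (S j)) ∧
    ∀ k, (∀ i, k ≠ T i) →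
      Program.exec g ((List.range n).flatMap fun i => Instr.copy (T i) s ::
        (List.range D).map fun j => Instr.addMul (T i) (T i) (S j) (c i j)) R k = R k := by
  induction n with
  | zero => simp [exec_nil]
  | succ n ih =>
    simp only [List.range_succ, List.flatMap_append, exec_append, List.flatMap_cons,
      List.flatMap_nil, List.append_nil, exec_cons]
    set R' := Program.exec g ((List.range n).flatMap fun i => Instr.copy (T i) s ::
        (List.range D).map fun j => Instr.addMul (T i) (T i) (S j) (c i j)) R with hR'
    have h1 := exec_addMuls g (T n) (fun j => hTS n j) (c n) D
      ((Instr.copy (T n) s).exec g R')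
    refine ⟨fun i hi => ?_, fun k hk => ?_⟩
    · rcases Nat.lt_succ_iff_lt_or_eq.1 hi with h | rfl
      · rw [h1.2 _ (hT.ne h.ne), Instr.exec, Function.update_of_ne (hT.ne h.ne), ih.1 i h]
      · rw [h1.1, Instr.exec, Function.update_self, ih.2 s hs]
        congr 1
        refine Finset.sum_congr rfl fun j _ => ?_
        rw [Function.update_of_ne (hTS i j), ih.2 _ fun i' => hTS i' j]
    · rw [h1.2 k (hk n), Instr.exec, Function.update_of_ne (hk n), ih.2 k hk]

/-- The registers hold the initial data and the nodal values `s`. -/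
def Holds (D : ℕ) (x v : E) (s : (ℕ → E) × (ℕ → E)) (R : ℕ → E) : Prop :=
  R 0 = x ∧ R 1 = v ∧ ∀ i < D, R (posReg i) = s.1 i ∧ R (velReg i) = s.2 i

lemma posReg_injective : Function.Injective posReg := fun i j h => by
  unfold posReg at h; omega

lemma velReg_injective : Function.Injective velReg := fun i j h => by
  unfold velReg at h; omega

lemma gradReg_injective : Function.Injective gradReg := fun i j h => by
  unfold gradReg at h; omega

lemma holds_init (D : ℕ) (x v : E) (R : ℕ → E) (h0 : R 0 = x) (h1 : R 1 = v) :
    Holds D x v (fun _ => x, fun _ => v) (Program.exec g (initProgram D) R) := by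
  have key : ∀ n, (∀ k, (k = 0 ∨ k = 1) → Program.exec g (initProgram n) R k = R k) ∧
      ∀ i < n, Program.exec g (initProgram n) R (posReg i) = x ∧
        Program.exec g (initProgram n) R (velReg i) = v := by
    intro n
    induction n with
    | zero => simp [initProgram, exec_nil]
    | succ n ih =>
      unfold initProgram at ih ⊢
      simp only [List.range_succ, List.flatMap_append, exec_append, List.flatMap_cons,
        List.flatMap_nil, List.append_nil, exec_cons, exec_nil, Instr.exec]
      have p0 : posReg n ≠ 0 := by unfold posReg; omega
      have p1 : posReg n ≠ 1 := by unfold posReg; omega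
      have v0 : velReg n ≠ 0 := by unfold velReg; omega
      have v1 : velReg n ≠ 1 := by unfold velReg; omega
      have pv : ∀ i, posReg i ≠ velReg n := fun i => by unfold posReg velReg; omega
      have vp : ∀ i, velReg i ≠ posReg n := fun i => by unfold posReg velReg; omega
      refine ⟨fun k hk => ?_, fun i hi => ?_⟩
      · rw [Function.update_of_ne (by rcases hk with rfl | rfl; exacts [v0.symm, v1.symm]),
          Function.update_of_ne (by rcases hk with rfl | rfl; exacts [p0.symm, p1.symm]), ih.1 k hk]
      · rw [Function.update_of_ne (pv i), Function.update_of_ne p1.symm, ih.1 0 (.inl rfl),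
          ih.1 1 (.inr rfl), h0, h1]
        rcases Nat.lt_succ_iff_lt_or_eq.1 hi with h | rfl
        · rw [Function.update_of_ne (posReg_injective.ne h.ne),
            Function.update_of_ne (velReg_injective.ne h.ne), Function.update_of_ne (vp i)]
          exact ih.2 i h
        · rw [Function.update_self, Function.update_self]; exact ⟨rfl, rfl⟩
  exact ⟨by rw [(key D).1 0 (.inl rfl), h0], by rw [(key D).1 1 (.inr rfl), h1], (key D).2⟩

/-- All gradients are stored before any position is overwritten. The positions are then rebuilt from
the old velocities, and the velocities last, from the stored gradients. This order makes the update
simultaneous. -/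
lemma holds_sweep (D : ℕ) (h : ℝ) (x v : E) (s : (ℕ → E) × (ℕ → E)) (R : ℕ → E)
    (H : Holds D x v s R) :
    Holds D x v (sweep g D h x v s) (Program.exec g (sweepProgram D h) R) := by
  unfold sweepProgram
  rw [exec_append, exec_append]
  obtain ⟨a1, a2⟩ := exec_grads g (S := posReg) gradReg_injective
    (fun i j => by unfold posReg gradReg; omega) D R
  set R1 := Program.exec g ((List.range D).map fun j => Instr.grad (gradReg j) (posReg j)) R
  obtain ⟨b1, b2⟩ := exec_combinations g (S := velReg) 0 posReg_injective
    (fun i j => by unfold posReg velReg; omega) (fun i => by unfold posReg; omega)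
    (fun i j => h * weight D j (chebNode D i)) D D R1
  set R2 := Program.exec g ((List.range D).flatMap fun i =>
    Instr.copy (posReg i) 0 :: (List.range D).map fun j =>
      Instr.addMul (posReg i) (posReg i) (velReg j) (h * weight D j (chebNode D i))) R1
  obtain ⟨c1, c2⟩ := exec_combinations g (S := gradReg) 1 velReg_injective
    (fun i j => by unfold velReg gradReg; omega) (fun i => by unfold velReg; omega)
    (fun i j => -(h * weight D j (chebNode D i))) D D R2
  have z0 : R1 0 = x := (a2 0 fun j => by unfold gradReg; omega).trans H.1
  have z1 : R1 1 = v := (a2 1 fun j => by unfold gradReg; omega).trans H.2.1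
  have y0 : R2 0 = x := (b2 0 fun j => by unfold posReg; omega).trans z0
  have y1 : R2 1 = v := (b2 1 fun j => by unfold posReg; omega).trans z1
  refine ⟨(c2 0 fun j => by unfold velReg; omega).trans y0,
    (c2 1 fun j => by unfold velReg; omega).trans y1, fun i hi => ⟨?_, ?_⟩⟩
  · rw [c2 _ fun j => by unfold velReg posReg; omega, b1 i hi, z0]
    simp only [sweep]
    congr 1
    refine Finset.sum_congr rfl fun j hj => ?_
    rw [a2 _ fun j => by unfold velReg gradReg; omega, (H.2.2 j (Finset.mem_range.1 hj)).2]
  · rw [c1 i hi, y1]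
    simp only [sweep]
    congr 1
    refine Finset.sum_congr rfl fun j hj => ?_
    rw [b2 _ fun j => by unfold posReg gradReg; omega, a1 j (Finset.mem_range.1 hj),
      (H.2.2 j (Finset.mem_range.1 hj)).1]

lemma holds_sweeps (D J : ℕ) (h : ℝ) (x v : E) (s : (ℕ → E) × (ℕ → E)) (R : ℕ → E)
    (H : Holds D x v s R) :
    Holds D x v ((sweep g D h x v)^[J] s)
      (Program.exec g (List.replicate J (sweepProgram D h)).flatten R) := by
  induction J generalizing s R with
  | zero => simpa [exec_nil] using H
  | succ J ih =>
    rw [List.replicate_succ, List.flatten_cons, exec_append, Function.iterate_succ_apply]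
    exact ih _ _ (holds_sweep g D h x v s R H)

lemma exec_odeProgram (D J : ℕ) (h : ℝ) (x v : E) (R : ℕ → E) (h0 : R 0 = x) (h1 : R 1 = v) :
    Program.exec g (odeProgram D J h) R 0 = collocation g D J h x v := by
  unfold odeProgram
  rw [exec_append, exec_append]
  have H := holds_sweeps g D J h x v _ _ (holds_init g D x v R h0 h1)
  unfold outputProgram
  rw [(exec_addMuls g 0 (S := velReg) (fun j => by unfold velReg; omega)
    (fun j => h * weight D j 1) D _).1, H.1, collocation]
  congr 1
  refine Finset.sum_congr rfl fun j hj => ?_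
  rw [(H.2.2 j (Finset.mem_range.1 hj)).2]

end Semantics

lemma odeSolve_eq_collocation {d : ℕ} (f : EuclideanSpace ℝ (Fin d) → ℝ) (D J : ℕ) (h : ℝ)
    (x v : EuclideanSpace ℝ (Fin d)) :
    odeSolve f D J h x v = collocation (gradient f) D J h x v :=
  exec_odeProgram _ D J h x v _ (by simp) (by simp)

section Cost

lemma sum_flatMap_nat {α : Type*} (f : α → List ℕ) (l : List α) :
    (l.flatMap f).sum = (l.map fun a => (f a).sum).sum := by
  induction l with
  | nil => simp
  | cons a l ih => simp [ih]

lemma time_append (d : ℕ) (P Q : Program) :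
    Program.time d (P ++ Q) = Program.time d P + Program.time d Q := by
  simp [Program.time]

lemma gradEvals_append (P Q : Program) :
    Program.gradEvals (P ++ Q) = Program.gradEvals P + Program.gradEvals Q := by
  simp [Program.gradEvals]

lemma time_flatten_replicate (d J : ℕ) (P : Program) :
    Program.time d (List.replicate J P).flatten = J * Program.time d P := by
  induction J with
  | zero => simp [Program.time]
  | succ J ih => rw [List.replicate_succ, List.flatten_cons, time_append, ih]; ring

lemma gradEvals_flatten_replicate (J : ℕ) (P : Program) :
    Program.gradEvals (List.replicate J P).flatten = J * Program.gradEvals P := by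
  induction J with
  | zero => simp [Program.gradEvals]
  | succ J ih => rw [List.replicate_succ, List.flatten_cons, gradEvals_append, ih]; ring

lemma iterationTime_eq (d D J : ℕ) (h : ℝ) :
    iterationTime d D J h = d * (1 + 2 * D + J * (4 * D + 4 * D ^ 2) + 2 * D) := by
  have h1 : Program.time d (initProgram D) = D * (2 * d) := by
    simp [Program.time, initProgram, List.map_flatMap, Instr.time, sum_flatMap_nat, two_mul]
  have h2 : Program.time d (sweepProgram D h) = D * (2 * d) + D * (d + D * (2 * d)) +
      D * (d + D * (2 * d)) := by
    simp [Program.time, sweepProgram, List.map_flatMap, Instr.time, sum_flatMap_nat,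
      Function.comp_def]
    ring
  have h3 : Program.time d (outputProgram D h) = D * (2 * d) := by
    simp [Program.time, outputProgram, Instr.time, Function.comp_def]
  rw [iterationTime, odeProgram, time_append, time_append, time_flatten_replicate, h1, h2, h3]
  ring

lemma iterationGradEvals_eq (D J : ℕ) (h : ℝ) : iterationGradEvals D J h = J * D := by
  have h1 : Program.gradEvals (initProgram D) = 0 := by
    simp [Program.gradEvals, initProgram, List.map_flatMap, Instr.gradEvals, sum_flatMap_nat]
  have h2 : Program.gradEvals (sweepProgram D h) = D := by
    simp [Program.gradEvals, sweepProgram, List.map_flatMap, Instr.gradEvals, sum_flatMap_nat,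
      Function.comp_def]
  have h3 : Program.gradEvals (outputProgram D h) = 0 := by
    simp [Program.gradEvals, outputProgram, Instr.gradEvals, Function.comp_def]
  rw [iterationGradEvals, odeProgram, gradEvals_append, gradEvals_append,
    gradEvals_flatten_replicate, h1, h2, h3]
  ring

end Cost

/-! ### Growth and accuracy of the collocation method -/

section Accuracy

variable {E : Type*} [NormedAddCommGroup E] [NormedSpace ℝ E]

lemma norm_sum_weight_smul_le {D : ℕ} {t C : ℝ} (ht : t ∈ Icc (0 : ℝ) 1) {u : ℕ → E}
    (hu : ∀ j < D, ‖u j‖ ≤ C) :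
    ‖∑ j ∈ Finset.range D, weight D j t • u j‖ ≤ 2 * D * C := by
  refine (norm_sum_le_of_le _ fun j hj => ?_).trans
    (by rw [Finset.sum_const, Finset.card_range, nsmul_eq_mul] : _ = (D : ℝ) * (2 * C)).le |>.trans
    (by ring : (D : ℝ) * (2 * C) = 2 * D * C).le
  have hj' := Finset.mem_range.1 hj
  rw [norm_smul, Real.norm_eq_abs]
  exact mul_le_mul (abs_weight_le hj' ht) (hu j hj') (norm_nonneg _) zero_le_two

lemma norm_sum_mul_weight_smul_le {D : ℕ} {h t C : ℝ} (hh : 0 ≤ h) (ht : t ∈ Icc (0 : ℝ) 1)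
    {u : ℕ → E} (hu : ∀ j < D, ‖u j‖ ≤ C) :
    ‖∑ j ∈ Finset.range D, (h * weight D j t) • u j‖ ≤ h * (2 * D) * C := by
  simp_rw [mul_smul]
  rw [← Finset.smul_sum, norm_smul, Real.norm_of_nonneg hh, mul_assoc]
  exact mul_le_mul_of_nonneg_left (norm_sum_weight_smul_le ht hu) hh

/-- A crude bound valid for all data, needed when the velocity is bad. The constants P and V are
chosen so that a sweep maps positions bounded by P and velocities bounded by V to such again. The
growth factor exceeds 1 only by O(m h² D²), which keeps the total growth over 1/(m h²) steps
moderate. -/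
lemma norm_collocation_le {g : E → E} {m F h : ℝ} {D : ℕ} (hh : 0 ≤ h) (hm : 0 ≤ m) (hF : 0 ≤ F)
    (hg : ∀ y, ‖g y‖ ≤ m * ‖y‖ + F) (hD : 2 * (m * h ^ 2 * (2 * D) ^ 2) ≤ 1) (J : ℕ) (x v : E) :
    ‖collocation g D J h x v‖ ≤ (1 + 2 * (m * h ^ 2 * (2 * D) ^ 2)) * ‖x‖ +
      (2 * (h * (2 * D)) * ‖v‖ + 2 * (h ^ 2 * (2 * D) ^ 2) * F) := by
  set L : ℝ := 2 * D with hL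
  have hL0 : 0 ≤ L := by positivity
  set P : ℝ := 2 * (‖x‖ + h * L * ‖v‖ + h ^ 2 * L ^ 2 * F) with hP
  set V : ℝ := ‖v‖ + h * L * (m * P + F) with hV
  have hP0 : 0 ≤ P := by positivity
  have hV0 : 0 ≤ V := by positivity
  have hx : ‖x‖ + h * L * V ≤ P := by
    have : 2 * (m * h ^ 2 * L ^ 2) * (P / 2) ≤ 1 * (P / 2) := by gcongr
    rw [hV]; nlinarith
  have inv : ∀ k, ∀ i < D, ‖((sweep g D h x v)^[k] (fun _ => x, fun _ => v)).1 i‖ ≤ P ∧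
      ‖((sweep g D h x v)^[k] (fun _ => x, fun _ => v)).2 i‖ ≤ V := by
    intro k
    induction k with
    | zero =>
      intro i _
      simp only [Function.iterate_zero, id]
      constructor
      · refine le_trans ?_ hx
        exact le_add_of_nonneg_right (by positivity)
      · rw [hV]; exact le_add_of_nonneg_right (by positivity)
    | succ k ih =>
      intro i _
      rw [Function.iterate_succ_apply']
      set s := (sweep g D h x v)^[k] (fun _ => x, fun _ => v)
      simp only [sweep]
      constructor
      · refine le_trans ((norm_add_le _ _).trans (add_le_add le_rfl ?_)) hx
        exact norm_sum_mul_weight_smul_le hh (chebNode_mem_Icc D i) fun j hj => (ih j hj).2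
      · refine (norm_add_le _ _).trans (add_le_add le_rfl ?_)
        simp_rw [neg_smul]
        rw [Finset.sum_neg_distrib, norm_neg]
        refine norm_sum_mul_weight_smul_le hh (chebNode_mem_Icc D i) fun j hj => ?_
        refine (hg _).trans ?_
        gcongr
        exact (ih j hj).1
  have hout : ‖collocation g D J h x v‖ ≤ ‖x‖ + h * L * V :=
    (norm_add_le _ _).trans (add_le_add le_rfl
      (norm_sum_mul_weight_smul_le hh (by simp) fun j hj => (inv J j hj).2))
  refine hout.trans ?_
  have hmul : h * L * V = h * L * ‖v‖ + h ^ 2 * L ^ 2 * F + m * h ^ 2 * L ^ 2 * P := by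
    rw [hV]; ring
  have h2 : 2 * (m * h ^ 2 * L ^ 2) * (h * L * ‖v‖ + h ^ 2 * L ^ 2 * F)
      ≤ 1 * (h * L * ‖v‖ + h ^ 2 * L ^ 2 * F) := by gcongr
  rw [hmul, hP]
  nlinarith

/-- `u` is within `δ` of a polynomial of degree less than `D` on `[0, 1]`. -/
def PolyApprox (D : ℕ) (δ : ℝ) (u : ℝ → E) : Prop :=
  ∃ c : ℕ → E, ∀ s ∈ Icc (0 : ℝ) 1, ‖u s - ∑ k ∈ Finset.range D, s ^ k • c k‖ ≤ δ

lemma PolyApprox.mono {D D' : ℕ} {δ : ℝ} {u : ℝ → E} (H : PolyApprox D δ u) (hD : D ≤ D') :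
    PolyApprox D' δ u := by
  obtain ⟨c, hc⟩ := H
  refine ⟨fun k => if k < D then c k else 0, fun s hs => ?_⟩
  have : ∑ k ∈ Finset.range D', s ^ k • (if k < D then c k else 0)
      = ∑ k ∈ Finset.range D, s ^ k • c k := by
    rw [← Finset.sum_subset (Finset.range_mono hD)]
    · exact Finset.sum_congr rfl fun k hk => by rw [if_pos (Finset.mem_range.1 hk)]
    · intro k _ hk
      rw [if_neg (by simpa using hk), smul_zero]
  rw [this]; exact hc s hs

lemma norm_integral_sub_integral_le {u q : ℝ → E} {δ t : ℝ} (ht : t ∈ Icc (0 : ℝ) 1)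
    (hu : ContinuousOn u (Icc 0 1)) (hq : Continuous q)
    (h : ∀ s ∈ Icc (0 : ℝ) 1, ‖u s - q s‖ ≤ δ) :
    ‖(∫ s in (0 : ℝ)..t, u s) - ∫ s in (0 : ℝ)..t, q s‖ ≤ δ := by
  rw [← intervalIntegral.integral_sub (hu.intervalIntegrable_unit ht) (hq.intervalIntegrable _ _)]
  have hδ : 0 ≤ δ := (norm_nonneg _).trans (h 0 (by simp))
  have := intervalIntegral.norm_integral_le_of_norm_le_const (a := 0) (b := t) (C := δ)
    (f := fun s => u s - q s) fun s hs => by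
      rw [uIoc_of_le ht.1] at hs
      exact h s ⟨hs.1.le, hs.2.trans ht.2⟩
  refine this.trans ?_
  rw [sub_zero, abs_of_nonneg ht.1]
  exact mul_le_of_le_one_right hδ ht.2

lemma PolyApprox.const_sub_smul {D : ℕ} {δ : ℝ} {u : ℝ → E} (H : PolyApprox (D + 1) δ u) (v : E)
    {h : ℝ} (hh : 0 ≤ h) : PolyApprox (D + 1) (h * δ) (fun t => v - h • u t) := by
  obtain ⟨c, hc⟩ := H
  refine ⟨fun k => (if k = 0 then v else 0) - h • c k, fun s hs => ?_⟩
  have e : ∑ k ∈ Finset.range (D + 1), s ^ k • ((if k = 0 then v else 0) - h • c k)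
      = v - h • ∑ k ∈ Finset.range (D + 1), s ^ k • c k := by
    simp_rw [smul_sub]
    rw [Finset.sum_sub_distrib, Finset.smul_sum]
    congr 1
    · rw [Finset.sum_eq_single 0] <;> simp +contextual
    · exact Finset.sum_congr rfl fun k _ => smul_comm _ _ _
  rw [e, sub_sub_sub_cancel_left, ← smul_sub, norm_smul, Real.norm_of_nonneg hh, norm_sub_rev]
  exact mul_le_mul_of_nonneg_left (hc s hs) hh

variable [CompleteSpace E]

lemma integral_sum_pow_smul (D : ℕ) (c : ℕ → E) (t : ℝ) :
    ∫ s in (0 : ℝ)..t, ∑ k ∈ Finset.range D, s ^ k • c k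
      = ∑ k ∈ Finset.range D, (t ^ (k + 1) / (k + 1)) • c k := by
  rw [intervalIntegral.integral_finsetSum fun k _ =>
    Continuous.intervalIntegrable (by fun_prop) _ _]
  refine Finset.sum_congr rfl fun k _ => ?_
  rw [intervalIntegral.integral_smul_const, integral_pow]
  simp

lemma PolyApprox.integral {D : ℕ} {δ : ℝ} {u : ℝ → E} (H : PolyApprox D δ u)
    (hu : ContinuousOn u (Icc 0 1)) :
    PolyApprox (D + 1) δ (fun t => ∫ s in (0 : ℝ)..t, u s) := by
  obtain ⟨c, hc⟩ := H
  refine ⟨fun k => (1 / (k : ℝ)) • (if k = 0 then 0 else c (k - 1)), fun t ht => ?_⟩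
  have e : ∑ k ∈ Finset.range (D + 1), t ^ k • (1 / (k : ℝ)) • (if k = 0 then 0 else c (k - 1))
      = ∫ s in (0 : ℝ)..t, ∑ k ∈ Finset.range D, s ^ k • c k := by
    rw [integral_sum_pow_smul, Finset.sum_range_succ']
    simp only [if_true, smul_zero, add_zero, Nat.add_one_ne_zero, if_false, Nat.add_sub_cancel,
      smul_smul]
    refine Finset.sum_congr rfl fun k _ => ?_
    push_cast; congr 1; ring
  rw [e]
  exact norm_integral_sub_integral_le ht hu (by fun_prop) hc

/-- The rule is exact on the approximating polynomial. The sampling errors at the nodes contribute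
2Dδ, since the weights are at most 2, and the integral contributes another δ. -/
lemma PolyApprox.quadrature {D : ℕ} {δ : ℝ} {u : ℝ → E} (H : PolyApprox D δ u)
    (hu : ContinuousOn u (Icc 0 1)) {t : ℝ} (ht : t ∈ Icc (0 : ℝ) 1) :
    ‖(∑ j ∈ Finset.range D, weight D j t • u (chebNode D j)) - ∫ s in (0 : ℝ)..t, u s‖
      ≤ (2 * D + 1) * δ := by
  obtain ⟨c, hc⟩ := H
  set q : ℝ → E := fun s => ∑ k ∈ Finset.range D, s ^ k • c k with hq
  have e : ∑ j ∈ Finset.range D, weight D j t • q (chebNode D j) = ∫ s in (0 : ℝ)..t, q s := by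
    rw [hq, integral_sum_pow_smul]
    simp only [Finset.smul_sum, smul_smul]
    rw [Finset.sum_comm]
    refine Finset.sum_congr rfl fun k hk => ?_
    rw [← Finset.sum_smul, sum_weight_mul_pow (Finset.mem_range.1 hk)]
  have h1 : ‖∑ j ∈ Finset.range D, weight D j t • (u (chebNode D j) - q (chebNode D j))‖
      ≤ 2 * D * δ := norm_sum_weight_smul_le ht fun j _ => hc _ (chebNode_mem_Icc D j)
  have h2 := norm_integral_sub_integral_le ht hu (q := q) (by fun_prop) hc
  simp_rw [smul_sub] at h1
  rw [Finset.sum_sub_distrib, e] at h1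
  have : (∑ j ∈ Finset.range D, weight D j t • u (chebNode D j)) - ∫ s in (0 : ℝ)..t, u s
      = ((∑ j ∈ Finset.range D, weight D j t • u (chebNode D j)) - ∫ s in (0 : ℝ)..t, q s) -
        ((∫ s in (0 : ℝ)..t, u s) - ∫ s in (0 : ℝ)..t, q s) := by abel
  rw [this]
  refine (norm_sub_le _ _).trans ?_
  linarith

/-- Error of the collocation method, when the force along the trajectory is close to a
polynomial. -/
lemma norm_collocation_sub_le {g : E → E} {K h δ e₀ : ℝ} {D : ℕ} {x v : E} {X W : ℝ → E}
    (hh : 0 ≤ h) (hK : 0 ≤ K) (hg : ∀ x y, ‖g x - g y‖ ≤ K * ‖x - y‖)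
    (hD : 4 * ((2 * (D + 1 : ℕ)) ^ 2 * (h ^ 2 * K)) ≤ 1)
    (H : IsTraj g h x v X W) (HP : PolyApprox D δ (fun s => g (X s)))
    (he : ∀ s ∈ Icc (0 : ℝ) 1, ‖x - X s‖ ≤ e₀)
    (he' : ∀ s ∈ Icc (0 : ℝ) 1, 2 * (2 * (D + 1 : ℕ)) * (h * ‖v - W s‖) ≤ e₀) (J : ℕ) :
    ‖collocation g (D + 1) J h x v - X 1‖
      ≤ (1 / 2) ^ J * e₀ + 6 * (2 * (D + 1 : ℕ)) ^ 2 * (h ^ 2 * δ) := by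
  have hgc : Continuous g := (LipschitzWith.of_dist_le_mul (K := ⟨K, hK⟩) fun x y => by
    rw [dist_eq_norm, dist_eq_norm]; exact hg x y).continuous
  set L : ℝ := 2 * (D + 1 : ℕ) with hL
  have hL1 : 2 ≤ L := by rw [hL]; push_cast; linarith [(Nat.cast_nonneg D : (0 : ℝ) ≤ D)]
  set ϑ : ℝ := h ^ 2 * δ with hϑ
  have hδ : 0 ≤ δ := by
    obtain ⟨c, hc⟩ := HP
    exact (norm_nonneg _).trans (hc 0 (by simp))
  have hϑ0 : 0 ≤ ϑ := by positivity
  have HPg : PolyApprox (D + 1) δ (fun s => g (X s)) := HP.mono (Nat.le_succ D)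
  have hgX := H.continuousOn_field hgc
  -- The velocity is an integral of the force, so the degree of its approximant rises by one. This
  -- is why D + 1 nodes go with forces approximated in degree less than D.
  have HPW : PolyApprox (D + 1) (h * δ) W := by
    obtain ⟨c, hc⟩ := (HP.integral hgX).const_sub_smul v hh
    refine ⟨c, fun s hs => ?_⟩
    have := hc s hs
    rw [H.vel_eq hgc hs, intervalIntegral.integral_smul]
    exact this
  have qg : ∀ t ∈ Icc (0 : ℝ) 1, ‖(v + ∑ j ∈ Finset.range (D + 1),
      (-(h * weight (D + 1) j t)) • g (X (chebNode (D + 1) j))) - W t‖ ≤ h * ((L + 1) * δ) :=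
    fun t ht => by
      have h1 := HPg.quadrature hgX ht
      rw [H.vel_eq hgc ht, intervalIntegral.integral_smul]
      simp_rw [neg_smul, mul_smul]
      rw [Finset.sum_neg_distrib, ← Finset.smul_sum, ← sub_eq_add_neg, sub_sub_sub_cancel_left,
        ← smul_sub, norm_smul, Real.norm_of_nonneg hh, norm_sub_rev]
      exact mul_le_mul_of_nonneg_left h1 hh
  have qW : ∀ t ∈ Icc (0 : ℝ) 1, ‖(x + ∑ j ∈ Finset.range (D + 1),
      (h * weight (D + 1) j t) • W (chebNode (D + 1) j)) - X t‖ ≤ h * ((L + 1) * (h * δ)) :=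
    fun t ht => by
      have h1 := HPW.quadrature H.continuousOn_vel ht
      rw [H.pos_eq_integral_vel ht, intervalIntegral.integral_smul]
      simp_rw [mul_smul]
      rw [← Finset.smul_sum, add_sub_add_left_eq_sub, ← smul_sub, norm_smul, Real.norm_of_nonneg hh]
      exact mul_le_mul_of_nonneg_left h1 hh
  -- error of a linear combination of nodal velocities
  have posErr : ∀ (w : ℕ → E) (e : ℝ), (∀ j < D + 1, 2 * L * (h * ‖w j - W (chebNode (D + 1) j)‖) ≤ e) →
      ∀ t ∈ Icc (0 : ℝ) 1,
      ‖(x + ∑ j ∈ Finset.range (D + 1), (h * weight (D + 1) j t) • w j) - X t‖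
        ≤ e / 2 + (L + 1) * ϑ := by
    intro w e hw t ht
    have e1 : (x + ∑ j ∈ Finset.range (D + 1), (h * weight (D + 1) j t) • w j) - X t
        = ∑ j ∈ Finset.range (D + 1), weight (D + 1) j t • (h • (w j - W (chebNode (D + 1) j)))
        + ((x + ∑ j ∈ Finset.range (D + 1),
          (h * weight (D + 1) j t) • W (chebNode (D + 1) j)) - X t) := by
      have : ∀ j, weight (D + 1) j t • (h • (w j - W (chebNode (D + 1) j)))
          = (h * weight (D + 1) j t) • w j
            - (h * weight (D + 1) j t) • W (chebNode (D + 1) j) := fun j => by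
        rw [smul_smul, smul_sub, mul_comm]
      simp_rw [this]
      rw [Finset.sum_sub_distrib]; abel
    rw [e1]
    refine (norm_add_le _ _).trans (add_le_add ?_ ((qW t ht).trans_eq (by rw [hϑ]; ring)))
    have h1 := norm_sum_weight_smul_le (D := D + 1) (C := e / (2 * L)) ht
      (u := fun j => h • (w j - W (chebNode (D + 1) j))) fun j hj => by
        rw [le_div_iff₀ (by positivity), norm_smul, Real.norm_of_nonneg hh, mul_comm]
        exact hw j hj
    refine h1.trans_eq ?_
    rw [← hL]; field_simp
  -- Velocity errors are measured in units 1 / (2 L h). Positions then inherit half of the velocity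
  -- error, and velocities inherit 2 L² h² K ≤ 1/2 of the position error. The level 8 L² ϑ is the
  -- fixed point of e ↦ e/2 + 4 L² ϑ, where 4 L² ϑ bounds the quadrature error.
  have key : ∀ k, ∀ i < D + 1,
      ‖((sweep g (D + 1) h x v)^[k] (fun _ => x, fun _ => v)).1 i - X (chebNode (D + 1) i)‖
        ≤ (1 / 2) ^ k * e₀ + 8 * L ^ 2 * ϑ ∧
      2 * L * (h * ‖((sweep g (D + 1) h x v)^[k] (fun _ => x, fun _ => v)).2 i
        - W (chebNode (D + 1) i)‖) ≤ (1 / 2) ^ k * e₀ + 8 * L ^ 2 * ϑ := by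
    intro k
    induction k with
    | zero =>
      intro i _
      simp only [Function.iterate_zero, id, pow_zero, one_mul]
      have hn := chebNode_mem_Icc (D + 1) i
      have : 0 ≤ 8 * L ^ 2 * ϑ := by positivity
      exact ⟨(he _ hn).trans (by linarith), (he' _ hn).trans (by linarith)⟩
    | succ k ih =>
      intro i _
      rw [Function.iterate_succ_apply']
      set s := (sweep g (D + 1) h x v)^[k] (fun _ => x, fun _ => v)
      set e := (1 / 2) ^ k * e₀ + 8 * L ^ 2 * ϑ with hedef
      have hn := chebNode_mem_Icc (D + 1) i
      have he0 : 0 ≤ e := (norm_nonneg _).trans (ih 0 (by omega)).1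
      have enext : (1 / 2) ^ (k + 1) * e₀ + 8 * L ^ 2 * ϑ = e / 2 + 4 * L ^ 2 * ϑ := by
        rw [hedef, pow_succ]; ring
      rw [enext]
      constructor
      · refine (posErr s.2 e (fun j hj => (ih j hj).2) _ hn).trans ?_
        have : (L + 1) * ϑ ≤ 4 * L ^ 2 * ϑ := by gcongr; nlinarith
        linarith
      · set t := chebNode (D + 1) i
        have e1 : (sweep g (D + 1) h x v s).2 i - W t
            = ∑ j ∈ Finset.range (D + 1), (h * weight (D + 1) j t) •
                (g (X (chebNode (D + 1) j)) - g (s.1 j))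
            + ((v + ∑ j ∈ Finset.range (D + 1),
              (-(h * weight (D + 1) j t)) • g (X (chebNode (D + 1) j))) - W t) := by
          simp only [sweep, smul_sub, neg_smul]
          rw [Finset.sum_sub_distrib, Finset.sum_neg_distrib, Finset.sum_neg_distrib]
          abel
        have h1 : ‖(sweep g (D + 1) h x v s).2 i - W t‖ ≤ h * L * (K * e) + h * ((L + 1) * δ) := by
          rw [e1]
          refine (norm_add_le _ _).trans (add_le_add ?_ (qg t hn))
          refine norm_sum_mul_weight_smul_le hh hn fun j hj => ?_
          rw [norm_sub_rev]
          exact (hg _ _).trans (mul_le_mul_of_nonneg_left (ih j hj).1 hK)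
        calc 2 * L * (h * ‖(sweep g (D + 1) h x v s).2 i - W t‖)
            ≤ 2 * L * (h * (h * L * (K * e) + h * ((L + 1) * δ))) := by gcongr
          _ = 4 * (L ^ 2 * (h ^ 2 * K)) * (e / 2) + 2 * L * (L + 1) * ϑ := by rw [hϑ]; ring
          _ ≤ 1 * (e / 2) + 4 * L ^ 2 * ϑ := by
              refine add_le_add (mul_le_mul_of_nonneg_right hD (by positivity))
                (mul_le_mul_of_nonneg_right ?_ hϑ0)
              nlinarith
          _ = _ := by ring
  have hout := posErr _ _ (fun j hj => (key J j hj).2) 1 (by simp)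
  refine hout.trans ?_
  have h1 : (L + 1) * ϑ ≤ 2 * L ^ 2 * ϑ := by gcongr; nlinarith
  have h2 : 0 ≤ (1 / 2 : ℝ) ^ J * e₀ := by
    have : 0 ≤ e₀ := (norm_nonneg _).trans (he 0 (by simp))
    positivity
  linarith

end Accuracy

/-! ### Polynomial curves with bounded coefficients -/

/-- `u` is a polynomial curve `∑ sᵏ cₖ` with `∑ 2ᵏ ‖cₖ‖ ≤ B`. -/
inductive PolyCurve {F : Type*} [NormedAddCommGroup F] [NormedSpace ℝ F] :
    (ℝ → F) → ℝ → Prop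
  | monomial (k : ℕ) (c : F) : PolyCurve (fun s => s ^ k • c) (2 ^ k * ‖c‖)
  | add {u w : ℝ → F} {B B' : ℝ} (hu : PolyCurve u B) (hw : PolyCurve w B') :
      PolyCurve (fun s => u s + w s) (B + B')
  | mono {u : ℝ → F} {B B' : ℝ} (hu : PolyCurve u B) (h : B ≤ B') : PolyCurve u B'

namespace PolyCurve

variable {F : Type*} [NormedAddCommGroup F] [NormedSpace ℝ F] {u w : ℝ → F} {B B' : ℝ}

lemma congr (hu : PolyCurve u B) (h : ∀ s, u s = w s) (hB : B ≤ B') : PolyCurve w B' := by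
  have : u = w := funext h
  exact this ▸ hu.mono hB

lemma continuous (hu : PolyCurve u B) : Continuous u := by
  induction hu with
  | monomial k c => fun_prop
  | add _ _ h1 h2 => exact h1.add h2
  | mono _ _ h => exact h

lemma nonneg (hu : PolyCurve u B) : 0 ≤ B := by
  induction hu with
  | monomial k c => positivity
  | add _ _ h1 h2 => exact add_nonneg h1 h2
  | mono _ h h' => exact h'.trans h

lemma const (c : F) : PolyCurve (fun _ => c) ‖c‖ :=
  (monomial 0 c).congr (fun s => by simp) (by simp)

lemma linear (c : F) : PolyCurve (fun s => s • c) (2 * ‖c‖) :=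
  (monomial 1 c).congr (fun s => by simp) (by simp)

lemma const_smul (a : ℝ) (hu : PolyCurve u B) : PolyCurve (fun s => a • u s) (|a| * B) := by
  induction hu with
  | monomial k c =>
    refine (monomial k (a • c)).congr (fun s => smul_comm _ _ _) ?_
    rw [norm_smul, Real.norm_eq_abs, mul_left_comm]
  | add _ _ h1 h2 => exact (h1.add h2).congr (fun s => by rw [smul_add]) (by rw [mul_add])
  | mono _ h h' => exact h'.mono (mul_le_mul_of_nonneg_left h (abs_nonneg _))

lemma smul_const {u : ℝ → ℝ} (hu : PolyCurve u B) (c : F) :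
    PolyCurve (fun s => u s • c) (B * ‖c‖) := by
  induction hu with
  | monomial k a =>
    refine (monomial k (a • c)).congr (fun s => by simp [mul_smul]) ?_
    rw [norm_smul, mul_assoc]
  | add _ _ h1 h2 => exact (h1.add h2).congr (fun s => by rw [add_smul]) (by rw [add_mul])
  | mono _ h h' => exact h'.mono (mul_le_mul_of_nonneg_right h (norm_nonneg _))

lemma neg (hu : PolyCurve u B) : PolyCurve (fun s => -u s) B :=
  (hu.const_smul (-1)).congr (fun s => by simp) (by simp)

lemma sub (hu : PolyCurve u B) (hw : PolyCurve w B') :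
    PolyCurve (fun s => u s - w s) (B + B') :=
  (hu.add hw.neg).congr (fun _ => (sub_eq_add_neg _ _).symm) le_rfl

/-- The norm ∑ 2ᵏ |cₖ| is submultiplicative because 2^(k+l) = 2ᵏ 2ˡ. This makes substitution into
Taylor polynomials painless. -/
lemma mul {u w : ℝ → ℝ} (hu : PolyCurve u B) (hw : PolyCurve w B') :
    PolyCurve (fun s => u s * w s) (B * B') := by
  induction hu with
  | monomial k a =>
    induction hw with
    | monomial l b =>
      refine (monomial (k + l) (a * b)).congr (fun s => ?_) ?_
      · simp only [smul_eq_mul]; ring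
      · rw [norm_mul, pow_add]; exact (by ring : _ = _).le
    | add _ _ h1 h2 => exact (h1.add h2).congr (fun s => by rw [mul_add]) (by rw [mul_add])
    | mono _ h h' => exact h'.mono (mul_le_mul_of_nonneg_left h (by positivity))
  | add _ _ h1 h2 => exact (h1.add h2).congr (fun s => by rw [add_mul]) (by rw [add_mul])
  | mono _ h h' => exact h'.mono (mul_le_mul_of_nonneg_right h hw.nonneg)

lemma pow {u : ℝ → ℝ} (hu : PolyCurve u B) (n : ℕ) : PolyCurve (fun s => u s ^ n) (B ^ n) := by
  induction n with
  | zero => exact (const (1 : ℝ)).congr (fun s => by simp) (by simp)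
  | succ n ih => exact (ih.mul hu).congr (fun _ => (pow_succ _ _).symm) (pow_succ _ _).ge

lemma sum {ι : Type*} (t : Finset ι) {u : ι → ℝ → F} {B : ι → ℝ}
    (hu : ∀ i, PolyCurve (u i) (B i)) : PolyCurve (fun s => ∑ i ∈ t, u i s) (∑ i ∈ t, B i) := by
  classical
  induction t using Finset.induction_on with
  | empty => exact (const (0 : F)).congr (fun s => by simp) (by simp)
  | insert i t hi ih =>
    exact ((hu i).add ih).congr (fun s => by rw [Finset.sum_insert hi]) (by rw [Finset.sum_insert hi])

lemma norm_le (hu : PolyCurve u B) {s : ℝ} (hs : s ∈ Icc (0 : ℝ) 1) : ‖u s‖ ≤ B := by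
  induction hu with
  | monomial k c =>
    rw [norm_smul, norm_pow, Real.norm_of_nonneg hs.1]
    exact mul_le_mul_of_nonneg_right (pow_le_pow_left₀ hs.1 (by linarith [hs.2]) k) (norm_nonneg _)
  | add _ _ h1 h2 => exact (norm_add_le _ _).trans (add_le_add h1 h2)
  | mono _ h h' => exact h'.trans h

/-- The kernel t - s integrates twice and sends sᵏ to t^(k+2) / ((k+1)(k+2)). The two additional
powers of 2 cost 4, and the denominator returns at least 2. -/
lemma integral [CompleteSpace F] (hu : PolyCurve u B) :
    PolyCurve (fun t => ∫ s in (0 : ℝ)..t, (t - s) • u s) (2 * B) := by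
  induction hu with
  | monomial k c =>
    refine (monomial (k + 2) ((1 / ((k + 1) * (k + 2)) : ℝ) • c)).congr (fun t => ?_) ?_
    · have e : ∀ s : ℝ, (t - s) • s ^ k • c = (t * s ^ k - s ^ (k + 1)) • c := fun s => by
        rw [smul_smul]; congr 1; ring
      simp_rw [e]
      rw [intervalIntegral.integral_smul_const, intervalIntegral.integral_sub
        (Continuous.intervalIntegrable (by fun_prop) _ _)
        (Continuous.intervalIntegrable (by fun_prop) _ _),
        intervalIntegral.integral_const_mul, integral_pow, integral_pow, smul_smul]
      congr 1
      have h1 : (k : ℝ) + 1 ≠ 0 := by positivity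
      have h2 : (k : ℝ) + 2 ≠ 0 := by positivity
      have h3 : (k : ℝ) + 1 + 1 ≠ 0 := by positivity
      push_cast
      rw [zero_pow (by omega), zero_pow (by omega)]
      field_simp
      ring
    · rw [norm_smul, Real.norm_of_nonneg (by positivity)]
      have hk : (0 : ℝ) ≤ k := Nat.cast_nonneg k
      have h1 : 1 / (((k : ℝ) + 1) * (k + 2)) ≤ 1 / 2 := by
        apply one_div_le_one_div_of_le <;> nlinarith
      calc (2 : ℝ) ^ (k + 2) * (1 / ((k + 1) * (k + 2)) * ‖c‖)
          ≤ 2 ^ (k + 2) * (1 / 2 * ‖c‖) := by gcongr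
        _ = _ := by ring
  | add h1' h2' h1 h2 =>
    refine (h1.add h2).congr (fun t => ?_) (by rw [mul_add])
    have hc1 := h1'.continuous
    have hc2 := h2'.continuous
    rw [← intervalIntegral.integral_add (Continuous.intervalIntegrable (by fun_prop) _ _)
      (Continuous.intervalIntegrable (by fun_prop) _ _)]
    simp only [smul_add]
  | mono _ h h' => exact h'.mono (mul_le_mul_of_nonneg_left h zero_le_two)

/-- Monomials of degree at least D are dropped. On [0, 1] such a monomial is at most 1 ≤ 2^(-D) 2ᵏ,
so the total loss is 2^(-D) times the weighted norm. -/
lemma polyApprox (hu : PolyCurve u B) (D : ℕ) : PolyApprox D ((1 / 2) ^ D * B) u := by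
  induction hu with
  | monomial k c =>
    by_cases hk : k < D
    · refine ⟨fun j => if j = k then c else 0, fun s _ => ?_⟩
      have : ∑ j ∈ Finset.range D, s ^ j • (if j = k then c else 0) = s ^ k • c := by
        rw [Finset.sum_eq_single k] <;> simp +contextual [hk]
      rw [this, sub_self, norm_zero]; positivity
    · refine ⟨fun _ => 0, fun s hs => ?_⟩
      simp only [smul_zero, Finset.sum_const_zero, sub_zero]
      rw [norm_smul, norm_pow, Real.norm_of_nonneg hs.1]
      have h1 : s ^ k ≤ 1 := pow_le_one₀ hs.1 hs.2
      have h2 : (1 : ℝ) ≤ (1 / 2) ^ D * 2 ^ k := by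
        have : (2 : ℝ) ^ D ≤ 2 ^ k := pow_le_pow_right₀ one_le_two (by omega)
        rw [one_div, inv_pow, inv_mul_eq_div, one_le_div (by positivity)]
        exact this
      calc s ^ k * ‖c‖ ≤ 1 * ‖c‖ := by gcongr
        _ ≤ ((1 / 2) ^ D * 2 ^ k) * ‖c‖ := by gcongr
        _ = _ := by ring
  | add _ _ h1 h2 =>
    obtain ⟨c, hc⟩ := h1
    obtain ⟨c', hc'⟩ := h2
    refine ⟨fun k => c k + c' k, fun s hs => ?_⟩
    simp_rw [smul_add]
    rw [Finset.sum_add_distrib, add_sub_add_comm, mul_add]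
    exact (norm_add_le _ _).trans (add_le_add (hc s hs) (hc' s hs))
  | mono _ h h' =>
    obtain ⟨c, hc⟩ := h'
    exact ⟨c, fun s hs => (hc s hs).trans (mul_le_mul_of_nonneg_left h (by positivity))⟩

end PolyCurve

/-! ### Taylor polynomials of functions with Cauchy estimates -/

/-- Taylor polynomial of degree `n` of `ψ` at `y₀`, evaluated at `y₀ + z`. -/
def taylorAt (ψ : ℝ → ℝ) (n : ℕ) (y₀ z : ℝ) : ℝ :=
  ∑ l ∈ Finset.range (n + 1), (iteratedDeriv l ψ y₀ / l.factorial) * z ^ l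

lemma HasCauchyEstimate.abs_coeff_le {ψ : ℝ → ℝ} {M r : ℝ} (H : HasCauchyEstimate ψ M r)
    (y₀ : ℝ) (l : ℕ) : |iteratedDeriv l ψ y₀ / l.factorial| ≤ M * (r ^ l)⁻¹ := by
  have hf : (0 : ℝ) < l.factorial := by exact_mod_cast l.factorial_pos
  rw [abs_div, abs_of_pos hf, div_le_iff₀ hf]
  exact (H y₀ l).trans_eq (by ring)

lemma HasCauchyEstimate.abs_le {ψ : ℝ → ℝ} {M r : ℝ} (H : HasCauchyEstimate ψ M r) (s : ℝ) :
    |ψ s| ≤ M := by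
  simpa using H s 0

/-- Lagrange's remainder: at half the Cauchy radius each order gains a factor 1/2. -/
lemma HasCauchyEstimate.abs_sub_taylorAt_le {ψ : ℝ → ℝ} {M r : ℝ} (H : HasCauchyEstimate ψ M r)
    (hM : 0 ≤ M) (hr : 0 < r) (hψ : ContDiff ℝ ∞ ψ) (n : ℕ) (y₀ : ℝ) {z : ℝ} (hz : |z| ≤ r / 2) :
    |ψ (y₀ + z) - taylorAt ψ n y₀ z| ≤ M * (1 / 2) ^ (n + 1) := by
  rcases eq_or_ne z 0 with rfl | hz0
  · have : taylorAt ψ n y₀ 0 = ψ y₀ := by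
      rw [taylorAt, Finset.sum_range_succ']; simp
    rw [this]; simp only [add_zero, sub_self, abs_zero]; positivity
  have hne : y₀ ≠ y₀ + z := fun h => hz0 (by linarith)
  have hψn : ContDiff ℝ (n + 1 : ℕ) ψ := hψ.of_le (by exact_mod_cast le_top)
  obtain ⟨x', -, hx'⟩ := taylor_mean_remainder_lagrange_iteratedDeriv (f := ψ) (n := n) hne
    (by exact_mod_cast hψn.contDiffOn)
  have e : taylorWithinEval ψ n (uIcc y₀ (y₀ + z)) y₀ (y₀ + z) = taylorAt ψ n y₀ z := by
    rw [taylor_within_apply, taylorAt]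
    refine Finset.sum_congr rfl fun k _ => ?_
    rw [iteratedDerivWithin_eq_iteratedDeriv (uniqueDiffOn_uIcc hne)
      (hψ.of_le (by exact_mod_cast le_top)).contDiffAt left_mem_uIcc]
    simp only [add_sub_cancel_left, smul_eq_mul]
    ring
  rw [e, add_sub_cancel_left] at hx'
  rw [hx', mul_div_right_comm, abs_mul, abs_pow]
  calc |iteratedDeriv (n + 1) ψ x' / (n + 1).factorial| * |z| ^ (n + 1)
      ≤ (M * (r ^ (n + 1))⁻¹) * (r / 2) ^ (n + 1) := by
        gcongr
        exact H.abs_coeff_le x' (n + 1)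
    _ = M * (1 / 2) ^ (n + 1) := by rw [div_pow, div_pow, one_pow]; field_simp

/-- The coefficients M r^(-l) meet powers (r/2)^l, and the geometric series sums to 2M. The bound
does not depend on the order n, so n can be sent to infinity later. -/
lemma HasCauchyEstimate.polyCurve_taylorAt {ψ : ℝ → ℝ} {M r : ℝ} (H : HasCauchyEstimate ψ M r)
    (hM : 0 ≤ M) (hr : 0 < r) (n : ℕ) (y₀ : ℝ) {u : ℝ → ℝ} (hu : PolyCurve u (r / 2)) :
    PolyCurve (fun s => taylorAt ψ n y₀ (u s)) (2 * M) := by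
  have h1 := PolyCurve.sum (Finset.range (n + 1)) fun l =>
    (hu.pow l).const_smul (iteratedDeriv l ψ y₀ / l.factorial)
  refine h1.congr (fun s => by simp [taylorAt]) ?_
  calc ∑ l ∈ Finset.range (n + 1), |iteratedDeriv l ψ y₀ / l.factorial| * (r / 2) ^ l
      ≤ ∑ l ∈ Finset.range (n + 1), M * (1 / 2) ^ l := by
        refine Finset.sum_le_sum fun l _ => ?_
        calc |iteratedDeriv l ψ y₀ / l.factorial| * (r / 2) ^ l
            ≤ (M * (r ^ l)⁻¹) * (r / 2) ^ l := by gcongr; exact H.abs_coeff_le y₀ l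
          _ = M * (1 / 2) ^ l := by rw [div_pow, div_pow, one_pow]; field_simp
    _ = M * ∑ l ∈ Finset.range (n + 1), (1 / 2) ^ l := by rw [Finset.mul_sum]
    _ ≤ M * 2 := by gcongr; exact sum_geometric_two_le _
    _ = 2 * M := mul_comm _ _

/-! ### Polynomial approximation of the force along a trajectory -/

section RidgeForce

variable {ι E : Type*} [Fintype ι] [NormedAddCommGroup E] [InnerProductSpace ℝ E]

/-- Regularity of a ridge force field: Cauchy estimates of the profiles, bounds on the row sums of
the Gram matrix of the directions and on the bounded part of the field, Lipschitz continuity. -/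
structure IsRegularRidge (a : ι → E) (ψ : ι → ℝ → ℝ) (m K M r τ F : ℝ) : Prop where
  smooth : ∀ i, ContDiff ℝ ∞ (ψ i)
  cauchy : ∀ i, HasCauchyEstimate (ψ i) M r
  M_nonneg : 0 ≤ M
  r_pos : 0 < r
  gram : ∀ i, ∑ j, |⟪a i, a j⟫| ≤ τ
  sum_norm : ∑ i, M * ‖a i‖ ≤ F
  m_nonneg : 0 ≤ m
  K_nonneg : 0 ≤ K
  m_le : m ≤ K
  lip : ∀ x y, ‖ridgeField a ψ m x - ridgeField a ψ m y‖ ≤ K * ‖x - y‖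

/-- The ridge field with the profiles replaced by their Taylor polynomials at `x`. -/
def taylorField (a : ι → E) (ψ : ι → ℝ → ℝ) (m : ℝ) (n : ℕ) (x y : E) : E :=
  ∑ i, taylorAt (ψ i) n ⟪a i, x⟫ (⟪a i, y⟫ - ⟪a i, x⟫) • a i + m • y

/-- Picard iterates of the second order equation with force `G`. -/
def picardIterate (G : E → E) (h : ℝ) (x v : E) : ℕ → ℝ → E
  | 0 => fun _ => x
  | k + 1 => fun t => x + t • h • v -
      ∫ s in (0 : ℝ)..t, (t - s) • h ^ 2 • G (picardIterate G h x v k s)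

variable {a : ι → E} {ψ : ι → ℝ → ℝ} {m K M r τ F h : ℝ}

namespace IsRegularRidge

lemma continuous (S : IsRegularRidge a ψ m K M r τ F) : Continuous (ridgeField a ψ m) :=
  (LipschitzWith.of_dist_le_mul (K := ⟨K, S.K_nonneg⟩) fun x y => by
    rw [dist_eq_norm, dist_eq_norm]; exact S.lip x y).continuous

lemma F_nonneg (S : IsRegularRidge a ψ m K M r τ F) : 0 ≤ F :=
  (Finset.sum_nonneg fun i _ => mul_nonneg S.M_nonneg (norm_nonneg (a i))).trans S.sum_norm

lemma norm_sum_smul_le (S : IsRegularRidge a ψ m K M r τ F) {c : ι → ℝ} {ρ : ℝ} (hρ : 0 ≤ ρ)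
    (hc : ∀ i, |c i| ≤ M * ρ) : ‖∑ i, c i • a i‖ ≤ F * ρ := by
  calc ‖∑ i, c i • a i‖ ≤ ∑ i, M * ‖a i‖ * ρ := by
        refine norm_sum_le_of_le _ fun i _ => ?_
        rw [norm_smul, Real.norm_eq_abs, mul_right_comm]
        exact mul_le_mul_of_nonneg_right (hc i) (norm_nonneg _)
    _ = (∑ i, M * ‖a i‖) * ρ := by rw [Finset.sum_mul]
    _ ≤ F * ρ := mul_le_mul_of_nonneg_right S.sum_norm hρ

lemma norm_bounded_part_le (S : IsRegularRidge a ψ m K M r τ F) (y : E) :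
    ‖∑ i, ψ i ⟪a i, y⟫ • a i‖ ≤ F := by
  simpa using S.norm_sum_smul_le zero_le_one fun i => by
    simpa using (S.cauchy i).abs_le ⟪a i, y⟫

lemma norm_le (S : IsRegularRidge a ψ m K M r τ F) (y : E) :
    ‖ridgeField a ψ m y‖ ≤ m * ‖y‖ + F := by
  refine (norm_add_le _ _).trans ?_
  rw [norm_smul, Real.norm_of_nonneg S.m_nonneg, add_comm]
  exact add_le_add_right (S.norm_bounded_part_le y) _

/-- This is where τ enters: the bounded part acts on ⟨aᵢ, ·⟩ through row i of the Gram matrix, with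
no loss in n or in the dimension. -/
lemma abs_inner_bounded_part_le (S : IsRegularRidge a ψ m K M r τ F) (i : ι) (y : E) :
    |⟪a i, ∑ j, ψ j ⟪a j, y⟫ • a j⟫| ≤ τ * M := by
  rw [inner_sum]
  calc |∑ j, ⟪a i, ψ j ⟪a j, y⟫ • a j⟫| ≤ ∑ j, |⟪a i, a j⟫| * M := by
        refine (Finset.abs_sum_le_sum_abs _ _).trans (Finset.sum_le_sum fun j _ => ?_)
        rw [inner_smul_right, abs_mul, mul_comm]
        exact mul_le_mul_of_nonneg_left ((S.cauchy j).abs_le _) (abs_nonneg _)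
    _ = (∑ j, |⟪a i, a j⟫|) * M := by rw [Finset.sum_mul]
    _ ≤ τ * M := mul_le_mul_of_nonneg_right (S.gram i) S.M_nonneg

variable {x v : E} {X W : ℝ → E}

lemma continuousOn_bounded_part (S : IsRegularRidge a ψ m K M r τ F)
    (H : IsTraj (ridgeField a ψ m) h x v X W) :
    ContinuousOn (fun s => ∑ i, ψ i ⟪a i, X s⟫ • a i) (Icc 0 1) := by
  refine continuousOn_finsetSum _ fun i _ => ContinuousOn.smul ?_ continuousOn_const
  exact (S.smooth i).continuous.comp_continuousOn (continuousOn_const.inner H.continuousOn_pos)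

variable [CompleteSpace E]

lemma pos_eq (S : IsRegularRidge a ψ m K M r τ F) (H : IsTraj (ridgeField a ψ m) h x v X W)
    {t : ℝ} (ht : t ∈ Icc (0 : ℝ) 1) :
    X t = x + t • h • v - ∫ s in (0 : ℝ)..t,
      (t - s) • ((m * h ^ 2) • X s + h ^ 2 • ∑ i, ψ i ⟪a i, X s⟫ • a i) := by
  rw [H.pos_eq S.continuous ht]
  congr 1
  refine intervalIntegral.integral_congr fun s _ => ?_
  simp only [ridgeField]
  rw [smul_add (h ^ 2), smul_smul (h ^ 2) m, mul_comm m, add_comm]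

lemma norm_displacement_le (S : IsRegularRidge a ψ m K M r τ F) (hh : 0 ≤ h)
    (hm : m * h ^ 2 ≤ 1 / 4) (H : IsTraj (ridgeField a ψ m) h x v X W) {t : ℝ}
    (ht : t ∈ Icc (0 : ℝ) 1) :
    ‖X t - x‖ ≤ 8 / 7 * (h * ‖v‖ + (m * h ^ 2 * ‖x‖ + h ^ 2 * F) / 2) := by
  have hm0 := S.m_nonneg
  have hF0 := S.F_nonneg
  have := damped_displacement (θ := m * h ^ 2) (β := h ^ 2 * F) (u := h • v) (by positivity) hm
    (by positivity) H.continuousOn_pos (fun s _ => by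
      rw [norm_smul, Real.norm_of_nonneg (by positivity)]
      exact mul_le_mul_of_nonneg_left (S.norm_bounded_part_le (X s)) (by positivity))
    (fun t ht => S.pos_eq H ht) t ht
  rwa [norm_smul, Real.norm_of_nonneg hh] at this

lemma norm_pos_one_le (S : IsRegularRidge a ψ m K M r τ F) (hh : 0 ≤ h)
    (hm : m * h ^ 2 ≤ 1 / 4) (H : IsTraj (ridgeField a ψ m) h x v X W) :
    ‖X 1‖ ≤ (1 - m * h ^ 2 / 8) * ‖x‖ + 2 * (h * ‖v‖) + 2 * (h ^ 2 * F) := by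
  have hm0 := S.m_nonneg
  have hF0 := S.F_nonneg
  have := damped_bound (θ := m * h ^ 2) (β := h ^ 2 * F) (u := h • v)
    (b := fun s => h ^ 2 • ∑ i, ψ i ⟪a i, X s⟫ • a i) (by positivity) hm
    (by positivity) H.continuousOn_pos ((S.continuousOn_bounded_part H).const_smul (h ^ 2))
    (fun s _ => by
      rw [norm_smul, Real.norm_of_nonneg (by positivity)]
      exact mul_le_mul_of_nonneg_left (S.norm_bounded_part_le (X s)) (by positivity))
    (fun t ht => S.pos_eq H ht)
  rwa [norm_smul, Real.norm_of_nonneg hh] at this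

/-- The linear part m X of the force commutes with ⟨aᵢ, ·⟩, so t ↦ ⟨aᵢ, X t⟩ is itself a damped
scalar path, driven by a force of size at most τ M. -/
lemma abs_inner_pos_one_le (S : IsRegularRidge a ψ m K M r τ F) (hh : 0 ≤ h)
    (hm : m * h ^ 2 ≤ 1 / 4) (H : IsTraj (ridgeField a ψ m) h x v X W) (i : ι) :
    |⟪a i, X 1⟫| ≤ (1 - m * h ^ 2 / 8) * |⟪a i, x⟫| + 2 * (h * |⟪a i, v⟫|)
      + 2 * (h ^ 2 * (τ * M)) := by
  have hm0 := S.m_nonneg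
  have hτM : 0 ≤ τ * M := (abs_nonneg _).trans (S.abs_inner_bounded_part_le i x)
  have hb := S.continuousOn_bounded_part H
  have := damped_bound (F := ℝ) (θ := m * h ^ 2) (β := h ^ 2 * (τ * M)) (u := h * ⟪a i, v⟫)
    (y := fun t => ⟪a i, X t⟫) (y₀ := ⟪a i, x⟫)
    (b := fun s => h ^ 2 * ⟪a i, ∑ j, ψ j ⟪a j, X s⟫ • a j⟫) (by positivity) hm
    (by positivity) (continuousOn_const.inner H.continuousOn_pos)
    (continuousOn_const.mul (continuousOn_const.inner hb))
    (fun s _ => by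
      rw [Real.norm_eq_abs, abs_mul, abs_of_nonneg (by positivity)]
      exact mul_le_mul_of_nonneg_left (S.abs_inner_bounded_part_le i (X s)) (by positivity))
    (fun t ht => by
      have hint : IntervalIntegrable (fun s =>
          (t - s) • ((m * h ^ 2) • X s + h ^ 2 • ∑ j, ψ j ⟪a j, X s⟫ • a j)) volume 0 t :=
        ((continuousOn_const.sub continuousOn_id).smul ((H.continuousOn_pos.const_smul _).add
          (hb.const_smul _))).intervalIntegrable_unit ht
      have e := S.pos_eq H ht
      have e2 := (innerSL ℝ (a i)).intervalIntegral_comp_comm hint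
      simp only [innerSL_apply_apply, inner_smul_right, inner_add_right] at e2
      rw [e, inner_sub_right, inner_add_right, inner_smul_right, inner_smul_right, ← e2]
      simp only [smul_eq_mul])
  simp only [Real.norm_eq_abs, abs_mul, abs_of_nonneg hh] at this
  exact this

end IsRegularRidge

end RidgeForce

/-! ### Picard iterates of the Taylor field and the accuracy of the solver -/

namespace IsRegularRidge

variable {ι E : Type*} [Fintype ι] [NormedAddCommGroup E] [InnerProductSpace ℝ E]
  {a : ι → E} {ψ : ι → ℝ → ℝ} {m K M r τ F h : ℝ} {x v : E} {X W : ℝ → E}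

lemma norm_sub_taylorField_le (S : IsRegularRidge a ψ m K M r τ F) (n : ℕ) (x : E) {y : E}
    (hy : ∀ i, |⟪a i, y⟫ - ⟪a i, x⟫| ≤ r / 2) :
    ‖ridgeField a ψ m y - taylorField a ψ m n x y‖ ≤ F * (1 / 2) ^ (n + 1) := by
  have e : ridgeField a ψ m y - taylorField a ψ m n x y
      = ∑ i, (ψ i ⟪a i, y⟫ - taylorAt (ψ i) n ⟪a i, x⟫ (⟪a i, y⟫ - ⟪a i, x⟫)) • a i := by
    simp only [ridgeField, taylorField, add_sub_add_right_eq_sub, sub_smul,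
      Finset.sum_sub_distrib]
  rw [e]
  refine S.norm_sum_smul_le (by positivity) fun i => ?_
  simpa using (S.cauchy i).abs_sub_taylorAt_le S.M_nonneg S.r_pos (S.smooth i) n ⟪a i, x⟫ (hy i)

variable [CompleteSpace E]

/-- Induction on the Picard step. While the increments of ⟨aᵢ, ·⟩ have weighted norm at most r/2,
the Taylor polynomials have norm at most 2M. The condition `hsmall` says precisely that the next
increments then stay below r/2. Both bounds are uniform in n and in the number of iterations. -/
lemma polyCurve_picardIterate (S : IsRegularRidge a ψ m K M r τ F) (hh : 0 ≤ h)
    (hm : m * h ^ 2 ≤ 1 / 4)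
    (hsmall : ∀ i, 2 * (h * |⟪a i, v⟫|) + 2 * (h ^ 2 * (2 * (τ * M) + m * (|⟪a i, x⟫| + r / 2)))
      ≤ r / 2) (n k : ℕ) :
    (∀ i, PolyCurve (fun s => ⟪a i, picardIterate (taylorField a ψ m n x) h x v k s⟫ - ⟪a i, x⟫)
      (r / 2)) ∧
    PolyCurve (picardIterate (taylorField a ψ m n x) h x v k)
      (8 * (‖x‖ + h * ‖v‖ + h ^ 2 * F)) := by
  have hm0 := S.m_nonneg
  have hF0 := S.F_nonneg
  have hM0 := S.M_nonneg
  have hr0 := S.r_pos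
  set U : ℝ := ‖x‖ + h * ‖v‖ + h ^ 2 * F with hU
  have hxU : ‖x‖ ≤ 8 * U := by
    have : 0 ≤ h * ‖v‖ := by positivity
    have : 0 ≤ h ^ 2 * F := by positivity
    linarith [norm_nonneg x]
  induction k with
  | zero =>
    refine ⟨fun i => ?_, (PolyCurve.const x).mono hxU⟩
    exact (PolyCurve.const (0 : ℝ)).congr (fun s => by simp [picardIterate])
      (by rw [norm_zero]; positivity)
  | succ k ih =>
    obtain ⟨hA, hB⟩ := ih
    set Z := picardIterate (taylorField a ψ m n x) h x v k with hZ
    have hT : ∀ i, PolyCurve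
        (fun s => taylorAt (ψ i) n ⟪a i, x⟫ (⟪a i, Z s⟫ - ⟪a i, x⟫)) (2 * M) := fun i =>
      (S.cauchy i).polyCurve_taylorAt hM0 hr0 n _ (hA i)
    have hG : PolyCurve (fun s => taylorField a ψ m n x (Z s)) (2 * F + m * (8 * U)) := by
      refine ((PolyCurve.sum Finset.univ fun i => (hT i).smul_const (a i)).add
        (hB.const_smul m)).congr (fun s => rfl) ?_
      rw [abs_of_nonneg hm0]
      have : ∑ i, 2 * M * ‖a i‖ = 2 * ∑ i, M * ‖a i‖ := by
        rw [Finset.mul_sum]; exact Finset.sum_congr rfl fun i _ => by ring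
      rw [this]
      linarith [S.sum_norm]
    have hG2 := hG.const_smul (h ^ 2)
    rw [abs_of_nonneg (sq_nonneg h)] at hG2
    refine ⟨fun i => ?_, ?_⟩
    · have hGi : PolyCurve (fun s => h ^ 2 * ⟪a i, taylorField a ψ m n x (Z s)⟫)
          (h ^ 2 * (2 * (τ * M) + m * (|⟪a i, x⟫| + r / 2))) := by
        refine ((((PolyCurve.sum Finset.univ fun j => (hT j).smul_const ⟪a i, a j⟫).add
          (((hA i).add (PolyCurve.const ⟪a i, x⟫)).const_smul m))).const_smul (h ^ 2)).congr
          (fun s => ?_) ?_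
        · simp only [taylorField, inner_add_right, inner_sum, inner_smul_right, smul_eq_mul,
            sub_add_cancel]
        · rw [abs_of_nonneg (sq_nonneg h), abs_of_nonneg hm0]
          have : ∑ j, 2 * M * ‖⟪a i, a j⟫‖ = 2 * M * ∑ j, |⟪a i, a j⟫| := by
            rw [Finset.mul_sum]; simp only [Real.norm_eq_abs]
          rw [this, Real.norm_eq_abs]
          have := mul_le_mul_of_nonneg_left (S.gram i) (by positivity : 0 ≤ 2 * M)
          refine mul_le_mul_of_nonneg_left ?_ (sq_nonneg h)
          linarith
      refine ((PolyCurve.linear (h * ⟪a i, v⟫)).sub hGi.integral).congr (fun t => ?_) ?_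
      · have hint : IntervalIntegrable (fun s =>
            (t - s) • h ^ 2 • taylorField a ψ m n x (Z s)) volume 0 t := by
          have := hG2.continuous
          exact Continuous.intervalIntegrable (by fun_prop) _ _
        have e2 := (innerSL ℝ (a i)).intervalIntegral_comp_comm hint
        simp only [innerSL_apply_apply, inner_smul_right] at e2
        simp only [picardIterate, inner_sub_right, inner_add_right, inner_smul_right, smul_eq_mul]
        rw [← hZ, ← e2]
        ring
      · rw [norm_mul, Real.norm_of_nonneg hh, Real.norm_eq_abs]
        exact hsmall i
    · refine (((PolyCurve.const x).add (PolyCurve.linear (h • v))).sub hG2.integral).congr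
        (fun t => rfl) ?_
      rw [norm_smul, Real.norm_of_nonneg hh]
      have h1 : m * h ^ 2 * U ≤ 1 / 4 * U := by gcongr
      have h2 : h ^ 2 * F ≤ U := by
        have : 0 ≤ h * ‖v‖ := by positivity
        linarith [norm_nonneg x]
      have h3 : 0 ≤ h * ‖v‖ := by positivity
      nlinarith [norm_nonneg x]

/-- The Picard map contracts because h² K is small, and the Taylor error is a perturbation. That
error is evaluated at the iterates, which are known to stay within r/2 of the base point; no such
information is needed about X. -/
lemma norm_picardIterate_sub_le (S : IsRegularRidge a ψ m K M r τ F)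
    (hK : h ^ 2 * K ≤ 1 / 4) (H : IsTraj (ridgeField a ψ m) h x v X W) {n : ℕ}
    (hA : ∀ k, (∀ i, PolyCurve (fun s => ⟪a i, picardIterate (taylorField a ψ m n x) h x v k s⟫
      - ⟪a i, x⟫) (r / 2)))
    (hB : ∀ k, Continuous fun s =>
      taylorField a ψ m n x (picardIterate (taylorField a ψ m n x) h x v k s))
    {e : ℝ} (he : ∀ t ∈ Icc (0 : ℝ) 1, ‖x - X t‖ ≤ e) (k : ℕ) :
    ∀ t ∈ Icc (0 : ℝ) 1, ‖picardIterate (taylorField a ψ m n x) h x v k t - X t‖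
      ≤ (1 / 2) ^ k * e + 2 * (h ^ 2 * (F * (1 / 2) ^ (n + 1))) := by
  have hF0 := S.F_nonneg
  have he0 : 0 ≤ e := (norm_nonneg _).trans (he 0 (by simp))
  induction k with
  | zero =>
    intro t ht
    have : 0 ≤ 2 * (h ^ 2 * (F * (1 / 2) ^ (n + 1))) := by positivity
    simpa [picardIterate] using (he t ht).trans (le_add_of_nonneg_right this)
  | succ k ih =>
    intro t ht
    set Z := picardIterate (taylorField a ψ m n x) h x v k with hZ
    set ρ : ℝ := F * (1 / 2) ^ (n + 1) with hρ
    have hρ0 : 0 ≤ ρ := by positivity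
    set e' : ℝ := (1 / 2) ^ k * e + 2 * (h ^ 2 * ρ) with he'
    have hBk := hB k
    have hXg := S.continuous.comp_continuousOn H.continuousOn_pos
    have e1 : picardIterate (taylorField a ψ m n x) h x v (k + 1) t - X t
        = ∫ s in (0 : ℝ)..t, (t - s) • h ^ 2 •
          (ridgeField a ψ m (X s) - taylorField a ψ m n x (Z s)) := by
      have hi1 : IntervalIntegrable (fun s => (t - s) • h ^ 2 • ridgeField a ψ m (X s))
          volume 0 t := ((continuousOn_const.sub continuousOn_id).smul
            (hXg.const_smul (h ^ 2))).intervalIntegrable_unit ht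
      have hi2 : IntervalIntegrable (fun s => (t - s) • h ^ 2 • taylorField a ψ m n x (Z s))
          volume 0 t := Continuous.intervalIntegrable (by fun_prop) _ _
      have : ∀ s : ℝ, (t - s) • h ^ 2 • (ridgeField a ψ m (X s) - taylorField a ψ m n x (Z s))
        = (t - s) • h ^ 2 • ridgeField a ψ m (X s)
          - (t - s) • h ^ 2 • taylorField a ψ m n x (Z s) := fun s => by rw [smul_sub, smul_sub]
      simp_rw [this]
      rw [intervalIntegral.integral_sub hi1 hi2, H.pos_eq S.continuous ht, picardIterate, ← hZ]
      exact sub_sub_sub_cancel_left _ _ _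
    rw [e1]
    have hC0 : 0 ≤ h ^ 2 * (K * e' + ρ) := by have := S.K_nonneg; positivity
    refine (norm_integral_sub_smul_le ht hC0 fun s hs => ?_).trans ?_
    · have hs' : s ∈ Icc (0 : ℝ) 1 := ⟨hs.1, hs.2.trans ht.2⟩
      rw [norm_smul, Real.norm_of_nonneg (sq_nonneg h)]
      refine mul_le_mul_of_nonneg_left ?_ (sq_nonneg h)
      have e2 : ridgeField a ψ m (X s) - taylorField a ψ m n x (Z s)
          = (ridgeField a ψ m (X s) - ridgeField a ψ m (Z s))
            + (ridgeField a ψ m (Z s) - taylorField a ψ m n x (Z s)) := by abel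
      rw [e2]
      refine (norm_add_le _ _).trans (add_le_add ((S.lip _ _).trans ?_)
        (S.norm_sub_taylorField_le n x fun i => ?_))
      · rw [norm_sub_rev]
        exact mul_le_mul_of_nonneg_left (ih s hs') S.K_nonneg
      · exact (hA k i).norm_le hs'
    · have h1 : h ^ 2 * K * e' ≤ 1 / 4 * e' := by gcongr
      have h2 : 0 ≤ (1 / 2 : ℝ) ^ k * e := by positivity
      have h3 : 0 ≤ h ^ 2 * ρ := by positivity
      have h4 : h ^ 2 * (K * e' + ρ) = h ^ 2 * K * e' + h ^ 2 * ρ := by ring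
      have h5 : (1 / 2 : ℝ) ^ (k + 1) * e = 1 / 2 * ((1 / 2) ^ k * e) := by ring
      rw [h4, h5]
      linarith

/-- The approximating curves may have huge degree, but their weighted norm is bounded uniformly, so
truncation at degree D costs 2^(-D) times a fixed bound. The distance from the curve to the true
force is made smaller than η. -/
lemma polyApprox_force (S : IsRegularRidge a ψ m K M r τ F) (hh : 0 ≤ h)
    (hK : h ^ 2 * K ≤ 1 / 4) (H : IsTraj (ridgeField a ψ m) h x v X W)
    (hsmall : ∀ i, 2 * (h * |⟪a i, v⟫|) + 2 * (h ^ 2 * (2 * (τ * M) + m * (|⟪a i, x⟫| + r / 2)))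
      ≤ r / 2) (D : ℕ) {η : ℝ} (hη : 0 < η) :
    PolyApprox D ((1 / 2) ^ D * (2 * F + m * (8 * (‖x‖ + h * ‖v‖ + h ^ 2 * F))) + η)
      (fun s => ridgeField a ψ m (X s)) := by
  have hm0 := S.m_nonneg
  have hF0 := S.F_nonneg
  have hK0 := S.K_nonneg
  have hm : m * h ^ 2 ≤ 1 / 4 :=
    (mul_comm m _ ▸ mul_le_mul_of_nonneg_left S.m_le (sq_nonneg h)).trans hK
  set e : ℝ := 8 / 7 * (h * ‖v‖ + (m * h ^ 2 * ‖x‖ + h ^ 2 * F) / 2) with he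
  have hdis : ∀ t ∈ Icc (0 : ℝ) 1, ‖x - X t‖ ≤ e := fun t ht => by
    rw [norm_sub_rev]; exact S.norm_displacement_le hh hm H ht
  have he0 : 0 ≤ e := by positivity
  -- The same n serves as Taylor order and as number of Picard steps. The denominator collects the
  -- initial displacement e, amplified by K, and the Taylor errors.
  obtain ⟨n, hn⟩ := exists_pow_lt_of_lt_one (by positivity : 0 < η / (2 * F + K * e + 1))
    (by norm_num : (1 / 2 : ℝ) < 1)
  rw [lt_div_iff₀ (by positivity)] at hn
  have hpoly := S.polyCurve_picardIterate hh hm hsmall n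
  have hG : ∀ k, PolyCurve (fun s => taylorField a ψ m n x
      (picardIterate (taylorField a ψ m n x) h x v k s))
      (2 * F + m * (8 * (‖x‖ + h * ‖v‖ + h ^ 2 * F))) := fun k => by
    refine ((PolyCurve.sum Finset.univ fun i => (((S.cauchy i).polyCurve_taylorAt S.M_nonneg
      S.r_pos n _ ((hpoly k).1 i)).smul_const (a i))).add
      ((hpoly k).2.const_smul m)).congr (fun s => rfl) ?_
    rw [abs_of_nonneg hm0]
    have : ∑ i, 2 * M * ‖a i‖ = 2 * ∑ i, M * ‖a i‖ := by
      rw [Finset.mul_sum]; exact Finset.sum_congr rfl fun i _ => by ring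
    rw [this]
    linarith [S.sum_norm]
  obtain ⟨c, hc⟩ := (hG n).polyApprox D
  refine ⟨c, fun s hs => ?_⟩
  set Z := picardIterate (taylorField a ψ m n x) h x v n with hZ
  have h1 : ‖Z s - X s‖ ≤ (1 / 2) ^ n * e + 2 * (h ^ 2 * (F * (1 / 2) ^ (n + 1))) :=
    S.norm_picardIterate_sub_le hK H (fun k => (hpoly k).1) (fun k => (hG k).continuous)
      hdis n s hs
  have h2 : ‖ridgeField a ψ m (X s) - taylorField a ψ m n x (Z s)‖
      ≤ K * ‖Z s - X s‖ + F * (1 / 2) ^ (n + 1) := by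
    rw [← sub_add_sub_cancel _ (ridgeField a ψ m (Z s))]
    refine (norm_add_le _ _).trans (add_le_add ?_
      (S.norm_sub_taylorField_le n x fun i => ((hpoly n).1 i).norm_le hs))
    rw [norm_sub_rev (Z s)]; exact S.lip _ _
  have h3 : K * ‖Z s - X s‖ + F * (1 / 2) ^ (n + 1) ≤ η := by
    have h4 := mul_le_mul_of_nonneg_left h1 hK0
    have h5 : h ^ 2 * K * (F * (1 / 2) ^ (n + 1)) ≤ 1 / 4 * (F * (1 / 2) ^ (n + 1)) := by gcongr
    have h6 : (0 : ℝ) ≤ F * (1 / 2) ^ n := by positivity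
    have h7 : F * (1 / 2 : ℝ) ^ (n + 1) = 1 / 2 * (F * (1 / 2) ^ n) := by ring
    rw [h7] at h4 h5 ⊢
    have h8 : (0 : ℝ) ≤ (1 / 2) ^ n := by positivity
    linarith
  rw [← sub_add_sub_cancel _ (taylorField a ψ m n x (Z s)), add_comm ((1 / 2 : ℝ) ^ D * _)]
  exact (norm_add_le _ _).trans (add_le_add (h2.trans h3) (hc s hs))

/-- Accuracy of the collocation method for a ridge field. -/
lemma norm_collocation_sub_le (S : IsRegularRidge a ψ m K M r τ F) (hh : 0 ≤ h) {D J : ℕ}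
    (hD : 4 * ((2 * (D + 1 : ℕ)) ^ 2 * (h ^ 2 * K)) ≤ 1) (hDJ : D ≤ J)
    (H : IsTraj (ridgeField a ψ m) h x v X W)
    (hsmall : ∀ i, 2 * (h * |⟪a i, v⟫|) + 2 * (h ^ 2 * (2 * (τ * M) + m * (|⟪a i, x⟫| + r / 2)))
      ≤ r / 2) :
    ‖collocation (ridgeField a ψ m) (D + 1) J h x v - X 1‖
      ≤ 28 * (2 * (D + 1 : ℕ)) ^ 2 * (1 / 2) ^ D * (‖x‖ + h * ‖v‖ + h ^ 2 * F) := by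
  have hm0 := S.m_nonneg
  have hF0 := S.F_nonneg
  have hK0 := S.K_nonneg
  set L : ℝ := 2 * (D + 1 : ℕ) with hL
  have hL2 : 2 ≤ L := by rw [hL]; push_cast; linarith [(Nat.cast_nonneg D : (0 : ℝ) ≤ D)]
  have hK : h ^ 2 * K ≤ 1 / 4 := by
    have h1 : (1 : ℝ) ≤ L ^ 2 := by nlinarith
    have h2 : 1 * (h ^ 2 * K) ≤ L ^ 2 * (h ^ 2 * K) := by gcongr
    linarith
  have hm : m * h ^ 2 ≤ 1 / 4 :=
    (mul_comm m _ ▸ mul_le_mul_of_nonneg_left S.m_le (sq_nonneg h)).trans hK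
  set U : ℝ := ‖x‖ + h * ‖v‖ + h ^ 2 * F with hU
  have hv0 : 0 ≤ h * ‖v‖ := by positivity
  have hF1 : 0 ≤ h ^ 2 * F := by positivity
  have hx0 := norm_nonneg x
  have hmx : m * h ^ 2 * ‖x‖ ≤ 1 / 4 * ‖x‖ := by gcongr
  have hU0 : 0 ≤ U := by positivity
  have hdis : ∀ t ∈ Icc (0 : ℝ) 1, ‖X t - x‖ ≤ 2 * U := fun t ht => by
    have := S.norm_displacement_le hh hm H ht
    linarith
  have hvel : ∀ t ∈ Icc (0 : ℝ) 1, h * ‖v - W t‖ ≤ 2 * U := fun t ht => by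
    rw [H.vel_eq S.continuous ht, sub_sub_cancel]
    have h1 : ‖∫ s in (0 : ℝ)..t, h • ridgeField a ψ m (X s)‖
        ≤ h * (m * (‖x‖ + 2 * U) + F) * |t - 0| := by
      refine intervalIntegral.norm_integral_le_of_norm_le_const fun s hs => ?_
      rw [uIoc_of_le ht.1] at hs
      have hs' : s ∈ Icc (0 : ℝ) 1 := ⟨hs.1.le, hs.2.trans ht.2⟩
      rw [norm_smul, Real.norm_of_nonneg hh]
      refine mul_le_mul_of_nonneg_left ((S.norm_le _).trans ?_) hh
      gcongr
      have := norm_add_le x (X s - x)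
      rw [add_sub_cancel] at this
      exact this.trans (by linarith [hdis s hs'])
    have h2 : h * (m * (‖x‖ + 2 * U) + F) * |t - 0| ≤ h * (m * (‖x‖ + 2 * U) + F) := by
      rw [sub_zero, abs_of_nonneg ht.1]
      exact mul_le_of_le_one_right (by positivity) ht.2
    calc h * ‖∫ s in (0 : ℝ)..t, h • ridgeField a ψ m (X s)‖
        ≤ h * (h * (m * (‖x‖ + 2 * U) + F)) := mul_le_mul_of_nonneg_left (h1.trans h2) hh
      _ = m * h ^ 2 * (‖x‖ + 2 * U) + h ^ 2 * F := by ring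
      _ ≤ 1 / 4 * (‖x‖ + 2 * U) + h ^ 2 * F := by gcongr
      _ ≤ 2 * U := by linarith
  -- The slack η of the approximation is divided by its amplification factor and then sent to zero.
  -- The choice e₀ = 4 L U below covers the initial position error 2U and the weighted velocity
  -- error 2L · 2U.
  refine le_of_forall_pos_le_add fun η hη => ?_
  have hη' : 0 < η / (6 * L ^ 2 * (h ^ 2 + 1)) := by positivity
  have := HMCSampling.norm_collocation_sub_le (e₀ := 4 * L * U) hh hK0 S.lip hD H
    (S.polyApprox_force hh hK H hsmall D hη') (fun s hs => by
      rw [norm_sub_rev]; refine (hdis s hs).trans ?_; nlinarith)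
    (fun s hs => by
      have := mul_le_mul_of_nonneg_left (hvel s hs) (by positivity : 0 ≤ 2 * L)
      rw [← hL]; linarith) J
  rw [← hL] at this
  refine this.trans ?_
  have hp : (1 / 2 : ℝ) ^ J ≤ (1 / 2) ^ D := pow_le_pow_of_le_one (by norm_num) (by norm_num) hDJ
  have h1 : (1 / 2 : ℝ) ^ J * (4 * L * U) ≤ (1 / 2) ^ D * (2 * L ^ 2 * (2 * U)) := by
    have : 4 * L * U ≤ 2 * L ^ 2 * (2 * U) := by nlinarith [mul_nonneg (by linarith : 0 ≤ L) hU0]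
    gcongr
  have h2 : h ^ 2 * ((1 / 2) ^ D * (2 * F + m * (8 * U)) + η / (6 * L ^ 2 * (h ^ 2 + 1)))
      ≤ (1 / 2) ^ D * (4 * U) + η / (6 * L ^ 2) := by
    have h3 : m * h ^ 2 * U ≤ 1 / 4 * U := by gcongr
    have h4 : h ^ 2 * (2 * F + m * (8 * U)) ≤ 4 * U := by nlinarith
    have h5 : h ^ 2 * (η / (6 * L ^ 2 * (h ^ 2 + 1))) ≤ η / (6 * L ^ 2) := by
      rw [← div_div, mul_div_assoc', div_le_iff₀ (by positivity)]
      have : 0 ≤ η / (6 * L ^ 2) := by positivity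
      nlinarith
    have h6 := mul_le_mul_of_nonneg_left h4 (by positivity : (0 : ℝ) ≤ (1 / 2) ^ D)
    linarith
  have h7 := mul_le_mul_of_nonneg_left h2 (by positivity : 0 ≤ 6 * L ^ 2)
  have h8 : 6 * L ^ 2 * (η / (6 * L ^ 2)) = η := by field_simp
  linarith

end IsRegularRidge

/-! ### Gaussian estimates -/

section Gaussian

lemma lintegral_exp_inner_stdGaussian {E : Type*} [NormedAddCommGroup E] [InnerProductSpace ℝ E]
    [FiniteDimensional ℝ E] [MeasurableSpace E] [BorelSpace E] (w : E) :
    ∫⁻ v, ENNReal.ofReal (Real.exp ⟪w, v⟫) ∂(stdGaussian E)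
      = ENNReal.ofReal (Real.exp (‖w‖ ^ 2 / 2)) := by
  have hmap := IsGaussian.map_eq_gaussianReal (μ := stdGaussian E) (innerSL ℝ w)
  rw [integral_strongDual_stdGaussian, variance_dual_stdGaussian, innerSL_apply_norm] at hmap
  have hmeas : Measurable (innerSL ℝ w : E → ℝ) := by fun_prop
  have h1 : ∫⁻ v, ENNReal.ofReal (Real.exp ⟪w, v⟫) ∂(stdGaussian E)
      = ∫⁻ s, ENNReal.ofReal (Real.exp s) ∂((stdGaussian E).map (innerSL ℝ w)) := by
    rw [lintegral_map (by fun_prop) hmeas]; simp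
  have hint : Integrable (fun s => Real.exp s) (gaussianReal 0 (‖w‖ ^ 2).toNNReal) := by
    simpa using integrable_exp_mul_gaussianReal (μ := 0) (v := (‖w‖ ^ 2).toNNReal) 1
  rw [h1, hmap, ← ofReal_integral_eq_lintegral_ofReal hint
    (ae_of_all _ fun s => (Real.exp_pos s).le)]
  have h2 := mgf_gaussianReal (p := gaussianReal 0 (‖w‖ ^ 2).toNNReal) (X := id) (μ := 0)
    (v := (‖w‖ ^ 2).toNNReal) (by simp) 1
  simp only [mgf, id, one_mul, zero_add, one_pow, mul_one,
    Real.coe_toNNReal _ (sq_nonneg ‖w‖)] at h2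
  rw [h2]

/-- It reduces second moments, also under exponential weights, to the Gaussian moment generating
function. -/
lemma sq_le_exp_add_exp_neg (s : ℝ) : s ^ 2 ≤ Real.exp s + Real.exp (-s) := by
  have key : ∀ t : ℝ, 0 ≤ t → t ^ 2 ≤ Real.exp t := fun t ht => by
    have h := Real.quadratic_le_exp_of_nonneg (x := t / 2) (by linarith)
    have e : Real.exp t = Real.exp (t / 2) ^ 2 := by rw [← Real.exp_nat_mul]; congr 1; ring
    rw [e]
    exact pow_le_pow_left₀ ht (by nlinarith [sq_nonneg (t / 2 - 1)]) 2
  rcases le_total 0 s with hs | hs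
  · linarith [key s hs, Real.exp_pos (-s)]
  · linarith [key (-s) (by linarith), Real.exp_pos s, neg_sq s]

variable {d : ℕ}

local notation "𝔼" => EuclideanSpace ℝ (Fin d)

lemma sq_norm_le_sum_exp (v : 𝔼) :
    ‖v‖ ^ 2 ≤ ∑ j, (Real.exp ⟪EuclideanSpace.single j (1 : ℝ), v⟫
      + Real.exp ⟪-EuclideanSpace.single j (1 : ℝ), v⟫) := by
  rw [EuclideanSpace.norm_sq_eq]
  refine Finset.sum_le_sum fun j _ => ?_
  rw [inner_neg_left, EuclideanSpace.inner_single_left]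
  simpa using sq_le_exp_add_exp_neg (v j)

lemma lintegral_sq_norm_stdGaussian_le :
    ∫⁻ v, ENNReal.ofReal (‖v‖ ^ 2) ∂(stdGaussian 𝔼) ≤ ENNReal.ofReal (4 * d) := by
  calc ∫⁻ v, ENNReal.ofReal (‖v‖ ^ 2) ∂(stdGaussian 𝔼)
      ≤ ∫⁻ v : 𝔼, ∑ j, (ENNReal.ofReal (Real.exp ⟪EuclideanSpace.single j (1 : ℝ), v⟫)
      + ENNReal.ofReal (Real.exp ⟪-EuclideanSpace.single j (1 : ℝ), v⟫)) ∂(stdGaussian 𝔼) := by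
        refine lintegral_mono fun v => ?_
        refine (ENNReal.ofReal_le_ofReal (sq_norm_le_sum_exp v)).trans_eq ?_
        rw [ENNReal.ofReal_sum_of_nonneg fun j _ => by positivity]
        exact Finset.sum_congr rfl fun j _ => ENNReal.ofReal_add (by positivity) (by positivity)
    _ = ∑ j : Fin d, ENNReal.ofReal (2 * Real.exp (1 / 2)) := by
        rw [lintegral_finsetSum _ fun j _ => by fun_prop]
        refine Finset.sum_congr rfl fun j _ => ?_
        rw [lintegral_add_left (by fun_prop), lintegral_exp_inner_stdGaussian,
          lintegral_exp_inner_stdGaussian, norm_neg, PiLp.norm_single,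
          ← ENNReal.ofReal_add (by positivity) (by positivity), two_mul]
        simp
    _ ≤ ENNReal.ofReal (4 * d) := by
        rw [Finset.sum_const, Finset.card_univ, Fintype.card_fin, nsmul_eq_mul,
          ← ENNReal.ofReal_natCast, ← ENNReal.ofReal_mul (by positivity)]
        refine ENNReal.ofReal_le_ofReal ?_
        have h1 : Real.exp (1 / 2) ≤ 2 := by
          have : Real.exp (1 / 2) ^ 2 = Real.exp 1 := by
            rw [← Real.exp_nat_mul]; norm_num
          nlinarith [Real.exp_one_lt_d9, Real.exp_pos (1 / 2)]
        have hd : (0 : ℝ) ≤ d := Nat.cast_nonneg d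
        nlinarith

/-- Chernoff's bound with tilt G - 1 instead of G. The factor ‖v‖² is dominated by exponentials of
±vⱼ, which change the tilt by a unit vector, so every tilt has norm at most G. The result is
e^(-(G-1)G) e^(G²/2) = e^(G - G²/2). -/
lemma setLIntegral_inner_gt_le {u : 𝔼} (hu : ‖u‖ ≤ 1) {G : ℝ} (hG : 1 ≤ G) :
    ∫⁻ v in {v : 𝔼 | G < |⟪u, v⟫|}, ENNReal.ofReal (1 + ‖v‖ ^ 2) ∂(stdGaussian 𝔼)
      ≤ ENNReal.ofReal (2 * (1 + 2 * d) * Real.exp (G - G ^ 2 / 2)) := by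
  set ℓ : ℝ := G - 1 with hℓ
  have hℓ0 : 0 ≤ ℓ := by linarith
  let Ψ : 𝔼 → 𝔼 → ℝ := fun w v => Real.exp ⟪w, v⟫ +
    ∑ j, (Real.exp ⟪w + EuclideanSpace.single j (1 : ℝ), v⟫
      + Real.exp ⟪w - EuclideanSpace.single j (1 : ℝ), v⟫)
  have hΨ : ∀ w v, Real.exp ⟪w, v⟫ * (1 + ‖v‖ ^ 2) ≤ Ψ w v := fun w v => by
    have := mul_le_mul_of_nonneg_left (sq_norm_le_sum_exp v) (Real.exp_pos ⟪w, v⟫).le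
    rw [Finset.mul_sum] at this
    rw [mul_add, mul_one]
    refine add_le_add_right (this.trans_eq ?_) _
    refine Finset.sum_congr rfl fun j _ => ?_
    rw [mul_add, ← Real.exp_add, ← Real.exp_add, ← inner_add_left, ← inner_add_left,
      sub_eq_add_neg]
  have hΨ0 : ∀ w v, 0 ≤ Ψ w v := fun w v =>
    (by positivity : 0 ≤ Real.exp ⟪w, v⟫ * (1 + ‖v‖ ^ 2)).trans (hΨ w v)
  have hΨm : ∀ w, Measurable fun v => ENNReal.ofReal (Ψ w v) := fun w => by
    simp only [Ψ]; fun_prop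
  have hΨi : ∀ w, ‖w‖ ≤ ℓ → ∫⁻ v, ENNReal.ofReal (Ψ w v) ∂(stdGaussian 𝔼)
      ≤ ENNReal.ofReal ((1 + 2 * d) * Real.exp (G ^ 2 / 2)) := fun w hw => by
    have hexp : ∀ w' : 𝔼, ‖w'‖ ≤ G →
        ∫⁻ v, ENNReal.ofReal (Real.exp ⟪w', v⟫) ∂(stdGaussian 𝔼)
          ≤ ENNReal.ofReal (Real.exp (G ^ 2 / 2)) := fun w' hw' => by
      rw [lintegral_exp_inner_stdGaussian]
      refine ENNReal.ofReal_le_ofReal (Real.exp_le_exp.2 ?_)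
      gcongr
    have hs : ∀ j : Fin d, ‖EuclideanSpace.single j (1 : ℝ)‖ = 1 := fun j => by simp
    calc ∫⁻ v, ENNReal.ofReal (Ψ w v) ∂(stdGaussian 𝔼)
        = ∫⁻ v : 𝔼, (ENNReal.ofReal (Real.exp ⟪w, v⟫) +
          ∑ j, (ENNReal.ofReal (Real.exp ⟪w + EuclideanSpace.single j (1 : ℝ), v⟫)
          + ENNReal.ofReal (Real.exp ⟪w - EuclideanSpace.single j (1 : ℝ), v⟫)))
            ∂(stdGaussian 𝔼) := by
          refine lintegral_congr fun v => ?_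
          simp only [Ψ]
          rw [ENNReal.ofReal_add (by positivity) (by positivity),
            ENNReal.ofReal_sum_of_nonneg fun j _ => by positivity]
          congr 1
          exact Finset.sum_congr rfl fun j _ => ENNReal.ofReal_add (by positivity) (by positivity)
      _ ≤ ENNReal.ofReal (Real.exp (G ^ 2 / 2)) +
          ∑ j : Fin d, (ENNReal.ofReal (Real.exp (G ^ 2 / 2))
            + ENNReal.ofReal (Real.exp (G ^ 2 / 2))) := by
          rw [lintegral_add_left (by fun_prop), lintegral_finsetSum _ fun j _ => by fun_prop]
          refine add_le_add (hexp w (by linarith)) (Finset.sum_le_sum fun j _ => ?_)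
          rw [lintegral_add_left (by fun_prop)]
          refine add_le_add (hexp _ ?_) (hexp _ ?_)
          · exact (norm_add_le _ _).trans (by rw [hs]; linarith)
          · exact (norm_sub_le _ _).trans (by rw [hs]; linarith)
      _ = ENNReal.ofReal ((1 + 2 * d) * Real.exp (G ^ 2 / 2)) := by
          rw [Finset.sum_const, Finset.card_univ, Fintype.card_fin, nsmul_eq_mul,
            ← ENNReal.ofReal_natCast, ← ENNReal.ofReal_add (by positivity) (by positivity),
            ← ENNReal.ofReal_mul (by positivity), ← ENNReal.ofReal_add (by positivity)
            (by positivity)]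
          congr 1; ring
  calc ∫⁻ v in {v : 𝔼 | G < |⟪u, v⟫|}, ENNReal.ofReal (1 + ‖v‖ ^ 2) ∂(stdGaussian 𝔼)
      ≤ ∫⁻ v in {v : 𝔼 | G < |⟪u, v⟫|}, ENNReal.ofReal (Real.exp (-(ℓ * G))) *
          (ENNReal.ofReal (Ψ (ℓ • u) v) + ENNReal.ofReal (Ψ (-(ℓ • u)) v)) ∂(stdGaussian 𝔼) := by
        refine setLIntegral_mono (((hΨm _).add (hΨm _)).const_mul _) fun v hv => ?_
        rw [← ENNReal.ofReal_add (hΨ0 _ _) (hΨ0 _ _), ← ENNReal.ofReal_mul (by positivity)]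
        refine ENNReal.ofReal_le_ofReal ?_
        have h1 : 1 ≤ Real.exp (-(ℓ * G)) *
            (Real.exp ⟪ℓ • u, v⟫ + Real.exp ⟪-(ℓ • u), v⟫) := by
          rw [inner_neg_left, real_inner_smul_left, mul_add, ← Real.exp_add, ← Real.exp_add]
          have hv' : G < |⟪u, v⟫| := hv
          rcases le_total 0 ⟪u, v⟫ with h0 | h0
          · rw [abs_of_nonneg h0] at hv'
            have : 1 ≤ Real.exp (-(ℓ * G) + ℓ * ⟪u, v⟫) := Real.one_le_exp (by nlinarith)
            linarith [Real.exp_pos (-(ℓ * G) + -(ℓ * ⟪u, v⟫))]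
          · rw [abs_of_nonpos h0] at hv'
            have : 1 ≤ Real.exp (-(ℓ * G) + -(ℓ * ⟪u, v⟫)) := Real.one_le_exp (by nlinarith)
            linarith [Real.exp_pos (-(ℓ * G) + ℓ * ⟪u, v⟫)]
        calc 1 + ‖v‖ ^ 2 ≤ (Real.exp (-(ℓ * G)) *
            (Real.exp ⟪ℓ • u, v⟫ + Real.exp ⟪-(ℓ • u), v⟫)) * (1 + ‖v‖ ^ 2) :=
              le_mul_of_one_le_left (by positivity) h1
          _ = Real.exp (-(ℓ * G)) * (Real.exp ⟪ℓ • u, v⟫ * (1 + ‖v‖ ^ 2)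
            + Real.exp ⟪-(ℓ • u), v⟫ * (1 + ‖v‖ ^ 2)) := by ring
          _ ≤ _ := mul_le_mul_of_nonneg_left (add_le_add (hΨ _ _) (hΨ _ _)) (Real.exp_pos _).le
    _ ≤ ∫⁻ v, ENNReal.ofReal (Real.exp (-(ℓ * G))) *
          (ENNReal.ofReal (Ψ (ℓ • u) v) + ENNReal.ofReal (Ψ (-(ℓ • u)) v)) ∂(stdGaussian 𝔼) :=
        setLIntegral_le_lintegral _ _
    _ ≤ ENNReal.ofReal (Real.exp (-(ℓ * G))) *
          (ENNReal.ofReal ((1 + 2 * d) * Real.exp (G ^ 2 / 2))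
            + ENNReal.ofReal ((1 + 2 * d) * Real.exp (G ^ 2 / 2))) := by
        have hℓu : ‖ℓ • u‖ ≤ ℓ := by
          rw [norm_smul, Real.norm_of_nonneg hℓ0]; exact mul_le_of_le_one_right hℓ0 hu
        have hsum : Measurable fun v => ENNReal.ofReal (Ψ (ℓ • u) v)
            + ENNReal.ofReal (Ψ (-(ℓ • u)) v) := (hΨm _).add (hΨm _)
        rw [lintegral_const_mul _ hsum, lintegral_add_left (hΨm _)]
        gcongr
        · exact hΨi _ hℓu
        · exact hΨi _ (by rwa [norm_neg])
    _ = _ := by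
        rw [← ENNReal.ofReal_add (by positivity) (by positivity),
          ← ENNReal.ofReal_mul (by positivity)]
        congr 1
        have : Real.exp (G - G ^ 2 / 2) = Real.exp (-(ℓ * G)) * Real.exp (G ^ 2 / 2) := by
          rw [← Real.exp_add]; congr 1; rw [hℓ]; ring
        rw [this]; ring

lemma setLIntegral_exists_inner_gt_le {κ : Type*} [Fintype κ] {u : κ → 𝔼} (hu : ∀ k, ‖u k‖ ≤ 1)
    {G : ℝ} (hG : 1 ≤ G) :
    ∫⁻ v in {v : 𝔼 | ∃ k, G < |⟪u k, v⟫|}, ENNReal.ofReal (1 + ‖v‖ ^ 2) ∂(stdGaussian 𝔼)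
      ≤ ENNReal.ofReal (Fintype.card κ * (2 * (1 + 2 * d) * Real.exp (G - G ^ 2 / 2))) := by
  have : {v : 𝔼 | ∃ k, G < |⟪u k, v⟫|} = ⋃ k, {v : 𝔼 | G < |⟪u k, v⟫|} := by
    ext v; simp
  rw [this]
  refine (lintegral_iUnion_le _ _).trans ?_
  rw [tsum_fintype]
  refine (Finset.sum_le_sum fun k _ => setLIntegral_inner_gt_le (hu k) hG).trans_eq ?_
  rw [Finset.sum_const, Finset.card_univ, nsmul_eq_mul, ← ENNReal.ofReal_natCast,
    ← ENNReal.ofReal_mul (by positivity)]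

end Gaussian

/-! ### Markov chains driven by independent noise, with a good set -/

section NoisyChain

variable {Z N : Type*} [MeasurableSpace Z] [MeasurableSpace N]

/-- The law at time `k` of the chain `z ↦ T (z, v)` with independent noise `v ∼ γ`, started
from `Γ₀`. -/
def chainLaw (Γ₀ : Measure Z) (γ : Measure N) (T : Z × N → Z) : ℕ → Measure Z
  | 0 => Γ₀
  | k + 1 => ((chainLaw Γ₀ γ T k).prod γ).map T

variable {Γ₀ : Measure Z} {γ : Measure N} {T : Z × N → Z}

lemma isProbabilityMeasure_chainLaw [IsProbabilityMeasure Γ₀] [IsProbabilityMeasure γ]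
    (hT : Measurable T) (k : ℕ) : IsProbabilityMeasure (chainLaw Γ₀ γ T k) := by
  induction k with
  | zero => exact ‹IsProbabilityMeasure Γ₀›
  | succ k ih => exact Measure.isProbabilityMeasure_map hT.aemeasurable

variable [IsProbabilityMeasure Γ₀] [IsProbabilityMeasure γ]

lemma lintegral_chainLaw_succ (hT : Measurable T) {u : Z → ℝ≥0∞} (hu : Measurable u) (k : ℕ) :
    ∫⁻ z, u z ∂(chainLaw Γ₀ γ T (k + 1)) = ∫⁻ z, ∫⁻ v, u (T (z, v)) ∂γ ∂(chainLaw Γ₀ γ T k) := by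
  have := isProbabilityMeasure_chainLaw (Γ₀ := Γ₀) (γ := γ) hT k
  rw [chainLaw, lintegral_map hu hT]
  exact lintegral_prod (fun z => u (T z)) (hu.comp hT).aemeasurable

/-- If, for good states and good noise, `T` preserves the good set and contracts `W` up to an
additive error, and if a Lyapunov function `V ≥ W` grows by at most a factor `G`, then the
expectation of `W` contracts up to an error controlled by the contribution `θ` of bad noise. -/
lemma lintegral_chainLaw_le (hT : Measurable T) {W V : Z → ℝ≥0∞} (hW : Measurable W)
    (hV : Measurable V) {𝒢 : Set Z} {𝒱 : Set N} (h𝒢 : MeasurableSet 𝒢) (h𝒱 : MeasurableSet 𝒱)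
    {ρ c G θ : ℝ≥0∞} (hρ : ρ ≤ 1) (hG : 1 ≤ G)
    (hgood : ∀ z ∈ 𝒢, ∀ v ∈ 𝒱, T (z, v) ∈ 𝒢 ∧ W (T (z, v)) ≤ ρ * W z + c)
    (hWV : ∀ z, W z ≤ V z) (hgrow : ∀ z, ∫⁻ v, V (T (z, v)) ∂γ ≤ G * V z)
    (hbad : ∀ z, ∫⁻ v in 𝒱ᶜ, V (T (z, v)) ∂γ ≤ θ * V z) (h0 : Γ₀ 𝒢ᶜ = 0) (n : ℕ) :
    ∫⁻ z, W z ∂(chainLaw Γ₀ γ T n) ≤ ρ ^ n * ∫⁻ z, W z ∂Γ₀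
      + n * (c + n * θ * G ^ n * ∫⁻ z, V z ∂Γ₀) := by
  have hprob := isProbabilityMeasure_chainLaw (Γ₀ := Γ₀) (γ := γ) hT
  have hTz : ∀ z, Measurable fun v => T (z, v) := fun z => hT.comp (by fun_prop)
  have hVTz : ∀ z, Measurable fun v => V (T (z, v)) := fun z => hV.comp (hTz z)
  have hWTz : ∀ z, Measurable fun v => W (T (z, v)) := fun z => hW.comp (hTz z)
  set m₀ := ∫⁻ z, V z ∂Γ₀ with hm₀
  have hm : ∀ k, ∫⁻ z, V z ∂(chainLaw Γ₀ γ T k) ≤ G ^ k * m₀ := fun k => by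
    induction k with
    | zero => simp [chainLaw, hm₀]
    | succ k ih =>
      rw [lintegral_chainLaw_succ hT hV]
      calc _ ≤ ∫⁻ z, G * V z ∂(chainLaw Γ₀ γ T k) := lintegral_mono hgrow
        _ = G * ∫⁻ z, V z ∂(chainLaw Γ₀ γ T k) := lintegral_const_mul _ hV
        _ ≤ G * (G ^ k * m₀) := by gcongr
        _ = G ^ (k + 1) * m₀ := by rw [pow_succ']; ring
  have hbadstep : ∀ k, ∫⁻ z, (G * 𝒢ᶜ.indicator V z + θ * V z) ∂(chainLaw Γ₀ γ T k)
      ≤ G * ∫⁻ z in 𝒢ᶜ, V z ∂(chainLaw Γ₀ γ T k) + θ * (G ^ k * m₀) := fun k => by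
    rw [lintegral_add_left ((hV.indicator h𝒢.compl).const_mul _),
      lintegral_const_mul _ (hV.indicator h𝒢.compl), lintegral_const_mul _ hV,
      lintegral_indicator h𝒢.compl]
    gcongr
    exact hm k
  -- A good state can become bad only through bad noise. For a bad state nothing better than the
  -- growth factor is available.
  have hpt : ∀ z, ∫⁻ v, 𝒢ᶜ.indicator V (T (z, v)) ∂γ ≤ G * 𝒢ᶜ.indicator V z + θ * V z :=
    fun z => by
    by_cases hz : z ∈ 𝒢
    · calc ∫⁻ v, 𝒢ᶜ.indicator V (T (z, v)) ∂γ ≤ ∫⁻ v, 𝒱ᶜ.indicator (fun v => V (T (z, v))) v ∂γ := by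
            refine lintegral_mono fun v => ?_
            by_cases hv : v ∈ 𝒱
            · rw [indicator_of_notMem (by simpa using (hgood z hz v hv).1)]; exact zero_le
            · rw [indicator_of_mem (show v ∈ 𝒱ᶜ from hv)]; exact indicator_le_self _ _ _
        _ = ∫⁻ v in 𝒱ᶜ, V (T (z, v)) ∂γ := lintegral_indicator h𝒱.compl _
        _ ≤ θ * V z := hbad z
        _ ≤ _ := le_add_self
    · rw [indicator_of_mem (show z ∈ 𝒢ᶜ from hz)]
      refine (lintegral_mono fun v => indicator_le_self _ _ _).trans ((hgrow z).trans ?_)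
      exact le_self_add
  -- The part of V on bad states starts at zero and receives at step k at most θ times the total,
  -- which is at most Gᵏ m₀. Both are then amplified by G per step.
  have hβ : ∀ k, ∫⁻ z in 𝒢ᶜ, V z ∂(chainLaw Γ₀ γ T k) ≤ k * θ * G ^ k * m₀ := fun k => by
    induction k with
    | zero =>
      rw [chainLaw, Measure.restrict_eq_zero.2 h0]; simp
    | succ k ih =>
      rw [← lintegral_indicator h𝒢.compl, lintegral_chainLaw_succ hT (hV.indicator h𝒢.compl)]
      calc _ ≤ ∫⁻ z, (G * 𝒢ᶜ.indicator V z + θ * V z) ∂(chainLaw Γ₀ γ T k) := lintegral_mono hpt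
        _ ≤ _ := hbadstep k
        _ ≤ G * (k * θ * G ^ k * m₀) + θ * (G ^ (k + 1) * m₀) := by
            gcongr
            exact Nat.le_succ k
        _ = (k + 1 : ℕ) * θ * G ^ (k + 1) * m₀ := by push_cast; ring
  -- Good states with good noise contract; in all other cases W is replaced by V.
  have hptW : ∀ z, ∫⁻ v, W (T (z, v)) ∂γ ≤ (ρ * W z + c) + (G * 𝒢ᶜ.indicator V z + θ * V z) :=
    fun z => by
    by_cases hz : z ∈ 𝒢
    · calc ∫⁻ v, W (T (z, v)) ∂γ
          ≤ ∫⁻ v, ((ρ * W z + c) + 𝒱ᶜ.indicator (fun v => V (T (z, v))) v) ∂γ := by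
            refine lintegral_mono fun v => ?_
            by_cases hv : v ∈ 𝒱
            · exact (hgood z hz v hv).2.trans le_self_add
            · rw [indicator_of_mem (show v ∈ 𝒱ᶜ from hv)]
              exact (hWV _).trans le_add_self
        _ = (ρ * W z + c) + ∫⁻ v in 𝒱ᶜ, V (T (z, v)) ∂γ := by
            rw [lintegral_add_left measurable_const, lintegral_const, measure_univ, mul_one,
              lintegral_indicator h𝒱.compl]
        _ ≤ _ := by gcongr; exact (hbad z).trans le_add_self
    · rw [indicator_of_mem (show z ∈ 𝒢ᶜ from hz)]
      calc ∫⁻ v, W (T (z, v)) ∂γ ≤ ∫⁻ v, V (T (z, v)) ∂γ := lintegral_mono fun v => hWV _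
        _ ≤ G * V z := hgrow z
        _ ≤ _ := le_self_add.trans le_add_self
  have key : ∀ k, k ≤ n → ∫⁻ z, W z ∂(chainLaw Γ₀ γ T k) ≤ ρ ^ k * ∫⁻ z, W z ∂Γ₀
      + k * (c + n * θ * G ^ n * m₀) := fun k hk => by
    induction k with
    | zero => simp [chainLaw]
    | succ k ih =>
      rw [lintegral_chainLaw_succ hT hW]
      calc _ ≤ ∫⁻ z, ((ρ * W z + c) + (G * 𝒢ᶜ.indicator V z + θ * V z)) ∂(chainLaw Γ₀ γ T k) :=
            lintegral_mono hptW
        _ = (ρ * ∫⁻ z, W z ∂(chainLaw Γ₀ γ T k) + c)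
            + ∫⁻ z, (G * 𝒢ᶜ.indicator V z + θ * V z) ∂(chainLaw Γ₀ γ T k) := by
          rw [lintegral_add_left (by fun_prop), lintegral_add_left (by fun_prop),
            lintegral_const_mul _ hW, lintegral_const, measure_univ, mul_one]
        _ ≤ (ρ * (ρ ^ k * ∫⁻ z, W z ∂Γ₀ + k * (c + n * θ * G ^ n * m₀)) + c)
            + (G * (k * θ * G ^ k * m₀) + θ * (G ^ (k + 1) * m₀)) := by
          gcongr
          · exact ih (by omega)
          · refine (hbadstep k).trans ?_
            gcongr
            · exact hβ k
            · exact Nat.le_succ k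
        _ ≤ (ρ * (ρ ^ k * ∫⁻ z, W z ∂Γ₀) + 1 * (k * (c + n * θ * G ^ n * m₀)) + c)
            + n * θ * G ^ n * m₀ := by
          rw [mul_add]
          gcongr
          calc G * (k * θ * G ^ k * m₀) + θ * (G ^ (k + 1) * m₀)
              = (k + 1 : ℕ) * θ * G ^ (k + 1) * m₀ := by push_cast; ring
            _ ≤ n * θ * G ^ n * m₀ := by gcongr
        _ = ρ ^ (k + 1) * ∫⁻ z, W z ∂Γ₀ + (k + 1 : ℕ) * (c + n * θ * G ^ n * m₀) := by
          push_cast; ring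
  exact key n le_rfl

end NoisyChain

/-- A coordinate that evolves autonomously is again a Markov chain. This identifies the two
marginals of the coupling. -/
lemma map_chainLaw_succ {Z N Y : Type*} [MeasurableSpace Z] [MeasurableSpace N]
    [MeasurableSpace Y] {Γ₀ : Measure Z} {γ : Measure N} [IsProbabilityMeasure Γ₀]
    [IsProbabilityMeasure γ] {T : Z × N → Z} (hT : Measurable T) {p : Z → Y} (hp : Measurable p)
    {S : Y × N → Y} (hS : Measurable S) (h : ∀ z v, p (T (z, v)) = S (p z, v)) (k : ℕ) :
    (chainLaw Γ₀ γ T (k + 1)).map p = (((chainLaw Γ₀ γ T k).map p).prod γ).map S := by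
  have := isProbabilityMeasure_chainLaw (Γ₀ := Γ₀) (γ := γ) hT k
  have e : (((chainLaw Γ₀ γ T k).map p).prod γ)
      = ((chainLaw Γ₀ γ T k).prod γ).map (Prod.map p id) := by
    rw [← Measure.map_prod_map _ _ hp measurable_id, Measure.map_id]
  rw [e, Measure.map_map hS (hp.prodMap measurable_id), chainLaw, Measure.map_map hp hT]
  congr 1
  funext z
  exact h z.1 z.2

/-! ### One step of the coupled chain -/

lemma continuous_collocation {E : Type*} [NormedAddCommGroup E] [NormedSpace ℝ E] {g : E → E}
    (hg : Continuous g) (D J : ℕ) (h : ℝ) :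
    Continuous fun z : E × E => collocation g D J h z.1 z.2 := by
  have key : ∀ k i, Continuous (fun z : E × E =>
      ((sweep g D h z.1 z.2)^[k] (fun _ => z.1, fun _ => z.2)).1 i) ∧ Continuous (fun z : E × E =>
      ((sweep g D h z.1 z.2)^[k] (fun _ => z.1, fun _ => z.2)).2 i) := fun k => by
    induction k with
    | zero => exact fun i => ⟨continuous_fst, continuous_snd⟩
    | succ k ih =>
      intro i
      simp only [Function.iterate_succ_apply', sweep]
      refine ⟨continuous_fst.add (continuous_finsetSum _ fun j _ => (ih j).2.const_smul _),
        continuous_snd.add (continuous_finsetSum _ fun j _ => (hg.comp (ih j).1).const_smul _)⟩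
  exact continuous_fst.add (continuous_finsetSum _ fun j _ => ((key J j).2.const_smul _))

/-- Young's inequality, with weight c on the mixed term. -/
lemma sq_le_of_le_one_add_mul_add {t p u c : ℝ} (ht : 0 ≤ t) (hc : 0 < c)
    (h : t ≤ (1 + c) * p + u) : t ^ 2 ≤ (1 + c) ^ 3 * p ^ 2 + (1 + 1 / c) * u ^ 2 := by
  have h1 : t ^ 2 ≤ ((1 + c) * p + u) ^ 2 := pow_le_pow_left₀ ht h 2
  have h2 : 0 ≤ (c * ((1 + c) * p) - u) ^ 2 / c := by positivity
  have h3 : (c * ((1 + c) * p) - u) ^ 2 / c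
      = c * ((1 + c) * p) ^ 2 - 2 * ((1 + c) * p) * u + 1 / c * u ^ 2 := by
    field_simp
    ring
  nlinarith

/-- Convexity of the square at the average of p and u / q with weights 1 - q and q. -/
lemma sq_le_of_le_one_sub_mul_add {t p u q : ℝ} (ht : 0 ≤ t) (hq : 0 < q) (hq1 : q ≤ 1)
    (h : t ≤ (1 - q) * p + u) : t ^ 2 ≤ (1 - q) * p ^ 2 + u ^ 2 / q := by
  have h1 : t ^ 2 ≤ ((1 - q) * p + u) ^ 2 := pow_le_pow_left₀ ht h 2
  have h2 : 0 ≤ (1 - q) * ((q * p - u) ^ 2 / q) := mul_nonneg (by linarith) (by positivity)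
  have h3 : (q * p - u) ^ 2 / q = q * p ^ 2 - 2 * p * u + u ^ 2 / q := by
    field_simp
    ring
  have h4 : u ^ 2 / q * q = u ^ 2 := by field_simp
  rw [h3] at h2
  nlinarith

namespace IsRegularRidge

variable {ι E : Type*} [Fintype ι] [NormedAddCommGroup E] [InnerProductSpace ℝ E]
  [CompleteSpace E] {a : ι → E} {ψ : ι → ℝ → ℝ} {m K M r τ F h : ℝ} {x y v : E} {X W : ℝ → E}
  {D J : ℕ}

/-- For a good position and a good velocity, the collocation method is accurate and its output
is a good position. -/
lemma good_step (S : IsRegularRidge a ψ m K M r τ F) (hh : 0 ≤ h)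
    (hD : 4 * ((2 * (D + 1 : ℕ)) ^ 2 * (h ^ 2 * K)) ≤ 1) (hDJ : D ≤ J)
    (H : IsTraj (ridgeField a ψ m) h x v X W) {A B R V s δ : ℝ} (hs : ∀ i, ‖a i‖ ≤ s)
    (hx : ∀ i, |⟪a i, x⟫| ≤ B) (hxR : ‖x‖ ≤ R) (hv : ∀ i, |⟪a i, v⟫| ≤ A) (hvV : ‖v‖ ≤ V)
    (h1 : 2 * (h * A) + 2 * (h ^ 2 * (2 * (τ * M) + m * (B + r / 2))) ≤ r / 2)
    (hδ : 28 * (2 * (D + 1 : ℕ)) ^ 2 * (1 / 2) ^ D * (R + h * V + h ^ 2 * F) ≤ δ)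
    (h2 : 2 * (h * A) + 2 * (h ^ 2 * (τ * M)) + s * δ ≤ m * h ^ 2 / 8 * B)
    (h3 : 2 * (h * V) + 2 * (h ^ 2 * F) + δ ≤ m * h ^ 2 / 8 * R) :
    ‖collocation (ridgeField a ψ m) (D + 1) J h x v - X 1‖ ≤ δ ∧
    (∀ i, |⟪a i, collocation (ridgeField a ψ m) (D + 1) J h x v⟫| ≤ B) ∧
    ‖collocation (ridgeField a ψ m) (D + 1) J h x v‖ ≤ R := by
  have hm0 := S.m_nonneg
  have hm : m * h ^ 2 ≤ 1 / 4 := by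
    have h4 : m * h ^ 2 ≤ h ^ 2 * K :=
      mul_comm m _ ▸ mul_le_mul_of_nonneg_left S.m_le (sq_nonneg h)
    have h5 : (1 : ℝ) * (h ^ 2 * K) ≤ (2 * (D + 1 : ℕ)) ^ 2 * (h ^ 2 * K) := by
      refine mul_le_mul_of_nonneg_right ?_ (mul_nonneg (sq_nonneg h) S.K_nonneg)
      push_cast
      nlinarith [(Nat.cast_nonneg D : (0 : ℝ) ≤ D)]
    linarith
  set q : ℝ := m * h ^ 2 / 8 with hq
  have hq1 : 0 ≤ 1 - q := by linarith
  set Y := collocation (ridgeField a ψ m) (D + 1) J h x v with hY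
  have hacc : ‖Y - X 1‖ ≤ δ := by
    refine (S.norm_collocation_sub_le hh hD hDJ H fun i => ?_).trans
      (le_trans (mul_le_mul_of_nonneg_left ?_ (by positivity)) hδ)
    · refine le_trans ?_ h1
      have := hx i
      have := hv i
      gcongr
    · gcongr
  have hYX : Y = X 1 + (Y - X 1) := by abel
  -- Damping removes the fraction q of the bounds B and R. By `h2` and `h3`, velocity, bounded force
  -- and solver error together put back no more than that.
  refine ⟨hacc, fun i => ?_, ?_⟩
  · have e1 := S.abs_inner_pos_one_le hh hm H i
    rw [← hq] at e1
    have e2 : |⟪a i, Y - X 1⟫| ≤ s * δ :=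
      (abs_real_inner_le_norm _ _).trans (mul_le_mul (hs i) hacc (norm_nonneg _)
        ((norm_nonneg _).trans (hs i)))
    rw [hYX, inner_add_right]
    have e3 : (1 - q) * |⟪a i, x⟫| ≤ (1 - q) * B := mul_le_mul_of_nonneg_left (hx i) hq1
    have e4 : h * |⟪a i, v⟫| ≤ h * A := mul_le_mul_of_nonneg_left (hv i) hh
    linarith [abs_add_le ⟪a i, X 1⟫ ⟪a i, Y - X 1⟫]
  · have e1 := S.norm_pos_one_le hh hm H
    rw [← hq] at e1
    rw [hYX]
    have e3 : (1 - q) * ‖x‖ ≤ (1 - q) * R := mul_le_mul_of_nonneg_left hxR hq1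
    have e4 : h * ‖v‖ ≤ h * V := mul_le_mul_of_nonneg_left hvV hh
    linarith [norm_add_le (X 1) (Y - X 1)]

/-- Growth of the Lyapunov function `R₀ + 2 ‖x‖² + 2 ‖y‖²` in one step of the coupled chain. -/
lemma growth_step (S : IsRegularRidge a ψ m K M r τ F) (hm : 0 < m) (hh : 0 < h)
    (hD : 4 * ((2 * (D + 1 : ℕ)) ^ 2 * (h ^ 2 * K)) ≤ 1)
    (H : IsTraj (ridgeField a ψ m) h y v X W) {c : ℝ}
    (hc : c = 2 * (m * h ^ 2 * (2 * (D + 1 : ℕ)) ^ 2)) :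
    ‖collocation (ridgeField a ψ m) (D + 1) J h x v‖ ^ 2
      ≤ (1 + c) ^ 3 * ‖x‖ ^ 2 + 8 / m * (‖v‖ ^ 2 + h ^ 2 * (2 * (D + 1 : ℕ)) ^ 2 * F ^ 2) ∧
    ‖X 1‖ ^ 2
      ≤ (1 + c) ^ 3 * ‖y‖ ^ 2 + 8 / m * (‖v‖ ^ 2 + h ^ 2 * (2 * (D + 1 : ℕ)) ^ 2 * F ^ 2) := by
  have hF0 := S.F_nonneg
  set L : ℝ := 2 * (D + 1 : ℕ) with hL
  have hL2 : 2 ≤ L := by rw [hL]; push_cast; linarith [(Nat.cast_nonneg D : (0 : ℝ) ≤ D)]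
  have hmK : m * h ^ 2 * L ^ 2 ≤ L ^ 2 * (h ^ 2 * K) := by
    have := mul_le_mul_of_nonneg_left S.m_le (by positivity : 0 ≤ L ^ 2 * h ^ 2)
    linarith
  have hc1 : c ≤ 1 := by linarith
  have hc0 : 0 < c := by rw [hc]; positivity
  have hm4 : m * h ^ 2 ≤ 1 / 4 := by
    have : m * h ^ 2 * 1 ≤ m * h ^ 2 * L ^ 2 := by gcongr; nlinarith
    linarith
  set u : ℝ := 2 * (h * L) * ‖v‖ + 2 * (h ^ 2 * L ^ 2) * F with hu
  -- Since c is proportional to m (h L)², the factor 1 / c cancels the square of h L. The velocity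
  -- term keeps the coefficient 8 / m, whatever h and D are.
  have hu2 : (1 + 1 / c) * u ^ 2 ≤ 8 / m * (‖v‖ ^ 2 + h ^ 2 * L ^ 2 * F ^ 2) := by
    have e1 : 1 + 1 / c ≤ 2 / c := by
      have : 1 ≤ 1 / c := by rw [le_div_iff₀ hc0]; linarith
      have : 2 / c = 1 / c + 1 / c := by ring
      linarith
    have e2 : u ^ 2 ≤ 8 * (h * L) ^ 2 * (‖v‖ ^ 2 + h ^ 2 * L ^ 2 * F ^ 2) := by
      have : u = 2 * (h * L) * (‖v‖ + h * L * F) := by rw [hu]; ring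
      have e3 : (‖v‖ + h * L * F) ^ 2 ≤ 2 * (‖v‖ ^ 2 + h ^ 2 * L ^ 2 * F ^ 2) := by
        nlinarith [sq_nonneg (‖v‖ - h * L * F)]
      rw [this, mul_pow]
      have := mul_le_mul_of_nonneg_left e3 (by positivity : 0 ≤ (2 * (h * L)) ^ 2)
      linarith
    calc (1 + 1 / c) * u ^ 2 ≤ 2 / c * (8 * (h * L) ^ 2 * (‖v‖ ^ 2 + h ^ 2 * L ^ 2 * F ^ 2)) := by
          gcongr
      _ = 8 / m * (‖v‖ ^ 2 + h ^ 2 * L ^ 2 * F ^ 2) := by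
          rw [hc]; field_simp
  constructor
  · have e := norm_collocation_le (D := D + 1) hh.le hm.le hF0 S.norm_le
      (by rw [← hL]; linarith) J x v
    rw [← hL, ← hc] at e
    exact (sq_le_of_le_one_add_mul_add (norm_nonneg _) hc0 e).trans (by linarith)
  · have e := S.norm_pos_one_le hh.le hm4 H
    have e' : ‖X 1‖ ≤ (1 + c) * ‖y‖ + u := by
      have e1 : (1 - m * h ^ 2 / 8) * ‖y‖ ≤ (1 + c) * ‖y‖ := by
        gcongr
        have : 0 ≤ m * h ^ 2 := by positivity
        linarith
      have e2 : 1 * (2 * (h * ‖v‖)) ≤ L * (2 * (h * ‖v‖)) := by gcongr; linarith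
      have e3 : 1 * (2 * (h ^ 2 * F)) ≤ L ^ 2 * (2 * (h ^ 2 * F)) := by gcongr; nlinarith
      rw [hu]
      linarith
    exact (sq_le_of_le_one_add_mul_add (norm_nonneg _) hc0 e').trans (by linarith)

end IsRegularRidge

/-! ### The coupling of the algorithm with the stationary flow -/

section Coupling

variable {d : ℕ}

local notation "𝔼" => EuclideanSpace ℝ (Fin d)

lemma lintegral_add_mul_sq_norm_le {b e : ℝ} (hb : 0 ≤ b) (he : 0 ≤ e) :
    ∫⁻ v : 𝔼, ENNReal.ofReal (b * ‖v‖ ^ 2 + e) ∂(stdGaussian 𝔼) ≤ ENNReal.ofReal (b * (4 * d) + e) := by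
  have h1 : ∀ v : 𝔼, ENNReal.ofReal (b * ‖v‖ ^ 2 + e)
      = ENNReal.ofReal b * ENNReal.ofReal (‖v‖ ^ 2) + ENNReal.ofReal e := fun v => by
    rw [ENNReal.ofReal_add (by positivity) he, ENNReal.ofReal_mul hb]
  simp_rw [h1]
  rw [lintegral_add_right _ measurable_const, lintegral_const_mul _ (by fun_prop), lintegral_const,
    measure_univ, mul_one, ENNReal.ofReal_add (by positivity) he, ENNReal.ofReal_mul hb]
  gcongr
  exact lintegral_sq_norm_stdGaussian_le

/-- A stationary distribution of a noisy contraction has a bounded second moment. -/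
lemma lintegral_sq_norm_le_of_stationary {π : Measure 𝔼} [IsProbabilityMeasure π]
    (hfin : ∫⁻ y, ENNReal.ofReal (‖y‖ ^ 2) ∂π < ⊤) {P : 𝔼 × 𝔼 → 𝔼} (hP : Measurable P)
    (hst : (π.prod (stdGaussian 𝔼)).map P = π) {q b e : ℝ} (hq : 0 < q) (hq1 : q ≤ 1)
    (hbound : ∀ y v, ‖P (y, v)‖ ≤ (1 - q) * ‖y‖ + 2 * (b * ‖v‖) + 2 * e) :
    ∫⁻ y, ENNReal.ofReal (‖y‖ ^ 2) ∂π ≤ ENNReal.ofReal ((32 * b ^ 2 * d + 8 * e ^ 2) / q ^ 2) := by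
  set I := ∫⁻ y, ENNReal.ofReal (‖y‖ ^ 2) ∂π with hI
  set β : ℝ := (32 * b ^ 2 * d + 8 * e ^ 2) / q with hβ
  have hβ0 : 0 ≤ β := by positivity
  have h1 : I ≤ ENNReal.ofReal (1 - q) * I + ENNReal.ofReal β := by
    have hinner : ∀ y, ∫⁻ v, ENNReal.ofReal (‖P (y, v)‖ ^ 2) ∂(stdGaussian 𝔼)
        ≤ ENNReal.ofReal (1 - q) * ENNReal.ofReal (‖y‖ ^ 2) + ENNReal.ofReal β := fun y => by
      calc _ ≤ ∫⁻ v : 𝔼, ENNReal.ofReal (8 * b ^ 2 / q * ‖v‖ ^ 2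
            + ((1 - q) * ‖y‖ ^ 2 + 8 * e ^ 2 / q)) ∂(stdGaussian 𝔼) := by
            refine lintegral_mono fun v => ENNReal.ofReal_le_ofReal ?_
            have h2 := sq_le_of_le_one_sub_mul_add (t := ‖P (y, v)‖) (p := ‖y‖)
              (u := 2 * (b * ‖v‖) + 2 * e)
              (norm_nonneg _) hq hq1 (by linarith [hbound y v])
            have h3 : (2 * (b * ‖v‖) + 2 * e) ^ 2 / q
                ≤ (8 * b ^ 2 * ‖v‖ ^ 2 + 8 * e ^ 2) / q := by
              gcongr
              nlinarith [sq_nonneg (b * ‖v‖ - e)]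
            have h4 : (8 * b ^ 2 * ‖v‖ ^ 2 + 8 * e ^ 2) / q
                = 8 * b ^ 2 / q * ‖v‖ ^ 2 + 8 * e ^ 2 / q := by ring
            linarith
        _ ≤ ENNReal.ofReal (8 * b ^ 2 / q * (4 * d) + ((1 - q) * ‖y‖ ^ 2 + 8 * e ^ 2 / q)) :=
            lintegral_add_mul_sq_norm_le (by positivity)
              (add_nonneg (mul_nonneg (by linarith) (sq_nonneg _)) (by positivity))
        _ = _ := by
            rw [← ENNReal.ofReal_mul (by linarith), ← ENNReal.ofReal_add
              (mul_nonneg (by linarith) (sq_nonneg _)) hβ0]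
            congr 1
            rw [hβ]; ring
    calc I = ∫⁻ y, ENNReal.ofReal (‖y‖ ^ 2) ∂((π.prod (stdGaussian 𝔼)).map P) := by rw [hst]
      _ = ∫⁻ y, ∫⁻ v, ENNReal.ofReal (‖P (y, v)‖ ^ 2) ∂(stdGaussian 𝔼) ∂π := by
          rw [lintegral_map (by fun_prop) hP]
          exact lintegral_prod (fun z => ENNReal.ofReal (‖P z‖ ^ 2)) (by fun_prop)
      _ ≤ ∫⁻ y, (ENNReal.ofReal (1 - q) * ENNReal.ofReal (‖y‖ ^ 2) + ENNReal.ofReal β) ∂π :=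
          lintegral_mono hinner
      _ = _ := by
          rw [lintegral_add_right _ measurable_const, lintegral_const_mul _ (by fun_prop),
            lintegral_const, measure_univ, mul_one]
  -- A finite second moment may be subtracted on both sides, so I ≤ (1 - q) I + β yields I ≤ β / q.
  rw [← ENNReal.ofReal_toReal hfin.ne, ← ENNReal.ofReal_mul (by linarith),
    ← ENNReal.ofReal_add (mul_nonneg (by linarith) ENNReal.toReal_nonneg) hβ0,
    ENNReal.ofReal_le_ofReal_iff
      (add_nonneg (mul_nonneg (by linarith) ENNReal.toReal_nonneg) hβ0)] at h1
  rw [← ENNReal.ofReal_toReal hfin.ne]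
  refine ENNReal.ofReal_le_ofReal ?_
  have h2 : (32 * b ^ 2 * d + 8 * e ^ 2) / q ^ 2 = β / q := by rw [hβ]; field_simp
  rw [h2, le_div_iff₀ hq]
  linarith

lemma norm_le_sqrt_mul_of_abs_le {v : 𝔼} {G : ℝ} (hG : 0 ≤ G)
    (hv : ∀ j, |⟪EuclideanSpace.single j (1 : ℝ), v⟫| ≤ G) : ‖v‖ ≤ Real.sqrt d * G := by
  refine abs_le_of_sq_le_sq' ?_ (by positivity) |>.2
  rw [mul_pow, Real.sq_sqrt (Nat.cast_nonneg d), EuclideanSpace.norm_sq_eq]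
  calc ∑ j, ‖v j‖ ^ 2 ≤ ∑ _j : Fin d, G ^ 2 := Finset.sum_le_sum fun j _ => by
        refine pow_le_pow_left₀ (norm_nonneg _) ?_ 2
        simpa [EuclideanSpace.inner_single_left] using hv j
    _ = d * G ^ 2 := by simp

-- Synchronous coupling: the pair moves with a common velocity, the first coordinate by the solver
-- and the second, started from the Gibbs measure, by the exact flow. The result is
-- `lintegral_chainLaw_le` with W the squared distance. Only the first coordinate has to be good,
-- because contraction of the exact flow holds for all pairs of positions.
set_option maxHeartbeats 2000000 in
theorem exists_coupling_lintegral_le {ι : Type*} [Fintype ι] {D J N : ℕ} {a : ι → 𝔼}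
    {ψ : ι → ℝ → ℝ} {f : 𝔼 → ℝ} {m K M r τ F h s G B R δ c q R₀ m₀ θ : ℝ} {x₀ : 𝔼}
    (S : IsRegularRidge a ψ m K M r τ F) (Q : QuadBounds f (ridgeField a ψ m) m K)
    (hf : ∀ x, HasGradientAt f (ridgeField a ψ m x) x) (hm : 0 < m) (hh : 0 < h)
    (hhK : 64 * (h ^ 2 * K) ≤ 1) (hD : 4 * ((2 * (D + 1 : ℕ)) ^ 2 * (h ^ 2 * K)) ≤ 1)
    (hDJ : D ≤ J) (hs0 : 0 < s) (hs : ∀ i, ‖a i‖ ≤ s) (hG : 1 ≤ G)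
    (hx₀ : ∀ i, |⟪a i, x₀⟫| ≤ B) (hx₀R : ‖x₀‖ ≤ R)
    (h1 : 2 * (h * (s * G)) + 2 * (h ^ 2 * (2 * (τ * M) + m * (B + r / 2))) ≤ r / 2)
    (hδ : 28 * (2 * (D + 1 : ℕ)) ^ 2 * (1 / 2) ^ D * (R + h * (Real.sqrt d * G) + h ^ 2 * F) ≤ δ)
    (h2 : 2 * (h * (s * G)) + 2 * (h ^ 2 * (τ * M)) + s * δ ≤ m * h ^ 2 / 8 * B)
    (h3 : 2 * (h * (Real.sqrt d * G)) + 2 * (h ^ 2 * F) + δ ≤ m * h ^ 2 / 8 * R)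
    (hc : c = 2 * (m * h ^ 2 * (2 * (D + 1 : ℕ)) ^ 2)) (hq : q = m * h ^ 2 / 8)
    (hR₀ : R₀ = 32 / m * (4 * d + 1 + h ^ 2 * (2 * (D + 1 : ℕ)) ^ 2 * F ^ 2) / c)
    (hm₀ : m₀ = R₀ + 2 * ‖x₀‖ ^ 2 + 2 * ((32 * h ^ 2 * d + 8 * (h ^ 2 * F) ^ 2) / q ^ 2))
    (hθ : θ = 9 * ((Fintype.card ι + d) * (2 * (1 + 2 * d) * Real.exp (G - G ^ 2 / 2))))
    {law : ℕ → Measure 𝔼} (hlaw0 : law 0 = Measure.dirac x₀)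
    (hlaw : ∀ k, law (k + 1) = ((law k).prod (stdGaussian 𝔼)).map
      fun z => collocation (ridgeField a ψ m) (D + 1) J h z.1 z.2) :
    ∃ Γ : Measure (𝔼 × 𝔼), (Γ.map Prod.fst = law N ∧
      Γ.map Prod.snd = (volume : Measure 𝔼).tilted fun x => -f x) ∧
      ∫⁻ z, edist z.1 z.2 ^ 2 ∂Γ ≤ ENNReal.ofReal ((1 - q) ^ N * m₀
        + N * (δ ^ 2 / q + N * θ * ((1 + c) ^ 3) ^ N * m₀)) := by
  have hfc : Continuous f := continuous_iff_continuousAt.2 fun x => (hf x).continuousAt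
  set g := ridgeField a ψ m with hg
  set π := (volume : Measure 𝔼).tilted fun x => -f x with hπ
  set γ := stdGaussian 𝔼 with hγ
  have hπp : IsProbabilityMeasure π := Q.isProbabilityMeasure hm hfc
  have hK : 0 < K := hm.trans_le S.m_le
  have hF0 := S.F_nonneg
  have hhK4 : h ^ 2 * K ≤ 1 / 4 := by linarith
  have hmh : m * h ^ 2 ≤ 1 / 4 := by
    have := mul_le_mul_of_nonneg_left S.m_le (sq_nonneg h)
    linarith
  have hq0 : 0 < q := by rw [hq]; positivity
  have hq1 : q ≤ 1 := by rw [hq]; linarith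
  have hc0 : 0 < c := by rw [hc]; positivity
  have hc1 : c ≤ 1 := by
    have := mul_le_mul_of_nonneg_left S.m_le
      (by positivity : 0 ≤ (2 * (D + 1 : ℕ) : ℝ) ^ 2 * h ^ 2)
    rw [hc]; linarith
  choose X W HXW using fun z : 𝔼 × 𝔼 => exists_isTraj hh S.lip hhK z.1 z.2
  set Φ : 𝔼 × 𝔼 → 𝔼 × 𝔼 := fun z => (X z 1, W z 1) with hΦdef
  have hΦ : ∀ z, ∃ X W, IsTraj g h z.1 z.2 X W ∧ Φ z = (X 1, W 1) := fun z =>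
    ⟨X z, W z, HXW z, rfl⟩
  have hmp := measurePreserving_flow hh.le hK.le S.lip hf hΦ
  set P : 𝔼 × 𝔼 → 𝔼 := fun z => X z 1 with hPdef
  have hP : Measurable P := measurable_fst.comp hmp.measurable
  have hst : (π.prod γ).map P = π := by
    have : P = Prod.fst ∘ Φ := rfl
    rw [this, ← Measure.map_map measurable_fst hmp.measurable, hmp.map_eq]
    simpa using hπ.symm
  have hC : Measurable fun z : 𝔼 × 𝔼 => collocation g (D + 1) J h z.1 z.2 :=
    (continuous_collocation S.continuous (D + 1) J h).measurable
  have hmom := lintegral_sq_norm_le_of_stationary (Q.lintegral_sq_norm_lt_top hm hfc) hP hst hq0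
    hq1 (b := h) (e := h ^ 2 * F) fun y v => by
      have := S.norm_pos_one_le hh.le hmh (HXW (y, v))
      rw [hq]; simpa [mul_assoc] using this
  set T : (𝔼 × 𝔼) × 𝔼 → 𝔼 × 𝔼 := fun w =>
    (collocation g (D + 1) J h w.1.1 w.2, P (w.1.2, w.2)) with hTdef
  have hT : Measurable T := by
    refine Measurable.prodMk (hC.comp (f := fun w : (𝔼 × 𝔼) × 𝔼 => (w.1.1, w.2)) (by fun_prop)) ?_
    exact hP.comp (f := fun w : (𝔼 × 𝔼) × 𝔼 => (w.1.2, w.2)) (by fun_prop)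
  set Γ₀ : Measure (𝔼 × 𝔼) := (Measure.dirac x₀).prod π with hΓ₀
  -- The normalized aᵢ and the coordinate vectors are treated together: a single tail bound over
  -- card ι + d directions controls both ⟨aᵢ, v⟩ and ‖v‖.
  let u : ι ⊕ Fin d → 𝔼 := Sum.elim (fun i => s⁻¹ • a i) fun j => EuclideanSpace.single j (1 : ℝ)
  have hu : ∀ k, ‖u k‖ ≤ 1 := by
    rintro (i | j)
    · simp only [u, Sum.elim_inl, norm_smul, Real.norm_of_nonneg (inv_nonneg.2 hs0.le)]
      rw [inv_mul_le_iff₀ hs0, mul_one]; exact hs i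
    · simp [u]
  set 𝒱 : Set 𝔼 := {v | ∃ k, G < |⟪u k, v⟫|}ᶜ with h𝒱def
  have h𝒱 : MeasurableSet 𝒱 := by
    refine MeasurableSet.compl ?_
    have : {v | ∃ k, G < |⟪u k, v⟫|} = ⋃ k, {v : 𝔼 | G < |⟪u k, v⟫|} := by ext v; simp
    rw [this]
    exact MeasurableSet.iUnion fun k => measurableSet_lt measurable_const (by fun_prop)
  have h𝒱a : ∀ v ∈ 𝒱, ∀ i, |⟪a i, v⟫| ≤ s * G := fun v hv i => by
    have : ∀ k, |⟪u k, v⟫| ≤ G := by simpa [h𝒱def] using hv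
    have h := this (Sum.inl i)
    simp only [u, Sum.elim_inl, real_inner_smul_left, abs_mul, abs_of_pos (inv_pos.2 hs0)] at h
    rwa [inv_mul_le_iff₀ hs0] at h
  have h𝒱n : ∀ v ∈ 𝒱, ‖v‖ ≤ Real.sqrt d * G := fun v hv => by
    have : ∀ k, |⟪u k, v⟫| ≤ G := by simpa [h𝒱def] using hv
    exact norm_le_sqrt_mul_of_abs_le (by linarith) fun j => this (Sum.inr j)
  set 𝒢 : Set (𝔼 × 𝔼) := {z | (∀ i, |⟪a i, z.1⟫| ≤ B) ∧ ‖z.1‖ ≤ R} with h𝒢def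
  have h𝒢 : MeasurableSet 𝒢 := by
    have : 𝒢 = (⋂ i, {z : 𝔼 × 𝔼 | |⟪a i, z.1⟫| ≤ B}) ∩ {z | ‖z.1‖ ≤ R} := by
      ext z; simp [h𝒢def]
    rw [this]
    exact (MeasurableSet.iInter fun i => measurableSet_le (by fun_prop) measurable_const).inter
      (measurableSet_le (by fun_prop) measurable_const)
  set L2 : ℝ := (2 * (D + 1 : ℕ)) ^ 2 with hL2
  set R₁ : ℝ := 32 / m * (4 * d + 1 + h ^ 2 * L2 * F ^ 2) with hR₁
  have hR₁0 : 0 < R₁ := by positivity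
  -- The constant R₀ is chosen so that the expected additive noise of one step is at most c R₀. This
  -- makes the growth of V purely multiplicative.
  have hcR : c * R₀ = R₁ := by rw [hR₀]; field_simp
  have hR₀0 : 0 ≤ R₀ := by rw [hR₀]; positivity
  let V : 𝔼 × 𝔼 → ℝ := fun z => R₀ + 2 * ‖z.1‖ ^ 2 + 2 * ‖z.2‖ ^ 2
  have hV0 : ∀ z, 0 ≤ V z := fun z => by positivity
  have hVstep : ∀ z v, V (T (z, v)) ≤ R₀ + (1 + c) ^ 3 * (2 * ‖z.1‖ ^ 2 + 2 * ‖z.2‖ ^ 2)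
      + 32 / m * (‖v‖ ^ 2 + h ^ 2 * L2 * F ^ 2) := fun z v => by
    obtain ⟨e1, e2⟩ := S.growth_step (J := J) (x := z.1) hm hh hD (HXW (z.2, v)) hc
    have e3 : 32 / m * (‖v‖ ^ 2 + h ^ 2 * L2 * F ^ 2)
      = 4 * (8 / m * (‖v‖ ^ 2 + h ^ 2 * L2 * F ^ 2)) := by ring
    rw [e3]
    simp only [V, hTdef, hPdef]
    linarith
  have hgood : ∀ z ∈ 𝒢, ∀ v ∈ 𝒱, T (z, v) ∈ 𝒢 ∧ ENNReal.ofReal (‖(T (z, v)).1 - (T (z, v)).2‖ ^ 2)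
      ≤ ENNReal.ofReal (1 - q) * ENNReal.ofReal (‖z.1 - z.2‖ ^ 2) + ENNReal.ofReal (δ ^ 2 / q) :=
    -- The intermediate point is the exact flow from z.1 with the same velocity: the solver error
    -- separates it from the new first coordinate, contraction from the second.
    fun z hz v hv => by
    obtain ⟨e1, e2, e3⟩ := S.good_step hh.le hD hDJ (HXW (z.1, v)) hs hz.1 hz.2 (h𝒱a v hv)
      (h𝒱n v hv) h1 hδ h2 h3
    refine ⟨⟨e2, e3⟩, ?_⟩
    rw [← ENNReal.ofReal_mul (by linarith), ← ENNReal.ofReal_add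
      (mul_nonneg (by linarith) (sq_nonneg _)) (by positivity)]
    refine ENNReal.ofReal_le_ofReal (sq_le_of_le_one_sub_mul_add (norm_nonneg _) hq0 hq1 ?_)
    have e4 := (HXW (z.1, v)).dist_le Q hm.le hK S.m_le hhK4 (HXW (z.2, v))
    rw [← hq] at e4
    have e5 := norm_sub_le_norm_sub_add_norm_sub (T (z, v)).1 (X (z.1, v) 1) (T (z, v)).2
    refine e5.trans ?_
    simp only [hTdef, hPdef]
    linarith
  have hgrow : ∀ z, ∫⁻ v, ENNReal.ofReal (V (T (z, v))) ∂γ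
      ≤ ENNReal.ofReal ((1 + c) ^ 3) * ENNReal.ofReal (V z) := fun z => by
    calc _ ≤ ∫⁻ v : 𝔼, ENNReal.ofReal (32 / m * ‖v‖ ^ 2
          + (R₀ + (1 + c) ^ 3 * (2 * ‖z.1‖ ^ 2 + 2 * ‖z.2‖ ^ 2)
            + 32 / m * (h ^ 2 * L2 * F ^ 2))) ∂γ :=
          lintegral_mono fun v => ENNReal.ofReal_le_ofReal (by linarith [hVstep z v])
      _ ≤ _ := lintegral_add_mul_sq_norm_le (by positivity) (by positivity)
      _ ≤ _ := by
          rw [← ENNReal.ofReal_mul (by positivity)]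
          refine ENNReal.ofReal_le_ofReal ?_
          have e1 : 32 / m * (4 * d) + 32 / m * (h ^ 2 * L2 * F ^ 2) ≤ c * R₀ := by
            rw [hcR, hR₁]
            have : 0 ≤ 32 / m := by positivity
            linarith
          have e2 : (1 + c) * R₀ ≤ (1 + c) ^ 3 * R₀ :=
            mul_le_mul_of_nonneg_right (le_self_pow₀ (by linarith) (by norm_num)) hR₀0
          simp only [V]
          linarith
  have hbad : ∀ z, ∫⁻ v in 𝒱ᶜ, ENNReal.ofReal (V (T (z, v))) ∂γ
      ≤ ENNReal.ofReal θ * ENNReal.ofReal (V z) := fun z => by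
    calc _ ≤ ∫⁻ v in 𝒱ᶜ, ENNReal.ofReal (9 * V z) * ENNReal.ofReal (1 + ‖v‖ ^ 2) ∂γ := by
          refine lintegral_mono fun v => ?_
          rw [← ENNReal.ofReal_mul (by have := hV0 z; positivity)]
          refine ENNReal.ofReal_le_ofReal ((hVstep z v).trans ?_)
          have e1 : 32 / m * (‖v‖ ^ 2 + h ^ 2 * L2 * F ^ 2) ≤ c * R₀ * (1 + ‖v‖ ^ 2) := by
            have e0 : ‖v‖ ^ 2 + h ^ 2 * L2 * F ^ 2
                ≤ (4 * d + 1 + h ^ 2 * L2 * F ^ 2) * (1 + ‖v‖ ^ 2) := by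
              have e2 : 0 ≤ h ^ 2 * L2 * F ^ 2 * ‖v‖ ^ 2 := by positivity
              have e3 : 0 ≤ (d : ℝ) * ‖v‖ ^ 2 := by positivity
              have e4 : (0 : ℝ) ≤ d := Nat.cast_nonneg d
              linarith
            have := mul_le_mul_of_nonneg_left e0 (by positivity : 0 ≤ 32 / m)
            rw [hcR, hR₁]
            linarith
          have e2 : (1 + c) ^ 3 ≤ 8 := by
            calc (1 + c) ^ 3 ≤ (2 : ℝ) ^ 3 := by gcongr; linarith
              _ = 8 := by norm_num
          have e3 : (1 + c) ^ 3 * (2 * ‖z.1‖ ^ 2 + 2 * ‖z.2‖ ^ 2)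
              ≤ 8 * (2 * ‖z.1‖ ^ 2 + 2 * ‖z.2‖ ^ 2) := by gcongr
          have e4 : c * R₀ * (1 + ‖v‖ ^ 2) ≤ 1 * R₀ * (1 + ‖v‖ ^ 2) := by gcongr
          have e5 : 0 ≤ R₀ * ‖v‖ ^ 2 := by positivity
          have e6 : 0 ≤ (2 * ‖z.1‖ ^ 2 + 2 * ‖z.2‖ ^ 2) * ‖v‖ ^ 2 := by positivity
          have e7 : 0 ≤ 2 * ‖z.1‖ ^ 2 + 2 * ‖z.2‖ ^ 2 := by positivity
          simp only [V]
          linarith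
      _ = ENNReal.ofReal (9 * V z) * ∫⁻ v in 𝒱ᶜ, ENNReal.ofReal (1 + ‖v‖ ^ 2) ∂γ :=
          lintegral_const_mul _ (by fun_prop)
      _ ≤ ENNReal.ofReal (9 * V z) * ENNReal.ofReal (Fintype.card (ι ⊕ Fin d) *
          (2 * (1 + 2 * d) * Real.exp (G - G ^ 2 / 2))) := by
          rw [h𝒱def, compl_compl]
          gcongr
          exact setLIntegral_exists_inner_gt_le hu hG
      _ = _ := by
          rw [← ENNReal.ofReal_mul (by have := hV0 z; positivity),
            ← ENNReal.ofReal_mul (by rw [hθ]; positivity)]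
          congr 1
          rw [hθ, Fintype.card_sum, Fintype.card_fin]
          push_cast; ring
  have hΓ₀𝒢 : Γ₀ 𝒢ᶜ = 0 := by
    have : 𝒢ᶜ = {x : 𝔼 | (∀ i, |⟪a i, x⟫| ≤ B) ∧ ‖x‖ ≤ R}ᶜ ×ˢ univ := by
      ext z; simp [h𝒢def]
    rw [this, hΓ₀, Measure.prod_prod, Measure.dirac_apply]
    simp [hx₀, hx₀R]
  have hVm : Measurable fun z => ENNReal.ofReal (V z) := by simp only [V]; fun_prop
  have hWV : ∀ z : 𝔼 × 𝔼, ‖z.1 - z.2‖ ^ 2 ≤ V z := fun z => by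
    have e1 := pow_le_pow_left₀ (norm_nonneg _) (norm_sub_le z.1 z.2) 2
    simp only [V]
    nlinarith [sq_nonneg (‖z.1‖ - ‖z.2‖)]
  have hV₀ : ∫⁻ z, ENNReal.ofReal (V z) ∂Γ₀ ≤ ENNReal.ofReal m₀ := by
    rw [hΓ₀, lintegral_prod _ hVm.aemeasurable, lintegral_dirac]
    have : ∀ y : 𝔼, ENNReal.ofReal (V (x₀, y)) = ENNReal.ofReal (R₀ + 2 * ‖x₀‖ ^ 2)
        + ENNReal.ofReal 2 * ENNReal.ofReal (‖y‖ ^ 2) := fun y => by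
      rw [← ENNReal.ofReal_mul zero_le_two, ← ENNReal.ofReal_add (by positivity) (by positivity)]
    simp_rw [this]
    rw [lintegral_add_left measurable_const, lintegral_const_mul _ (by fun_prop), lintegral_const,
      measure_univ, mul_one, hm₀]
    refine (add_le_add le_rfl (mul_le_mul_right hmom _)).trans_eq ?_
    rw [← ENNReal.ofReal_mul zero_le_two, ← ENNReal.ofReal_add (by positivity) (by positivity)]
  have hm₀0 : 0 ≤ m₀ := by rw [hm₀]; positivity
  have hmain := lintegral_chainLaw_le (Γ₀ := Γ₀) (γ := γ) hT
    (W := fun z : 𝔼 × 𝔼 => ENNReal.ofReal (‖z.1 - z.2‖ ^ 2))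
    (V := fun z => ENNReal.ofReal (V z)) (by fun_prop) hVm h𝒢 h𝒱
    (ENNReal.ofReal_le_one.2 (by linarith)) (G := ENNReal.ofReal ((1 + c) ^ 3))
    (ENNReal.one_le_ofReal.2 (one_le_pow₀ (by linarith)))
    hgood (fun z => ENNReal.ofReal_le_ofReal (hWV z)) hgrow hbad hΓ₀𝒢 N
  refine ⟨chainLaw Γ₀ γ T N, ⟨?_, ?_⟩, ?_⟩
  · have : ∀ k, (chainLaw Γ₀ γ T k).map Prod.fst = law k := fun k => by
      induction k with
      | zero => rw [hlaw0, chainLaw, hΓ₀]; simp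
      | succ k ih =>
        rw [hlaw, ← ih]
        exact map_chainLaw_succ hT measurable_fst hC (fun z v => rfl) k
    exact this N
  · have : ∀ k, (chainLaw Γ₀ γ T k).map Prod.snd = π := fun k => by
      induction k with
      | zero => rw [chainLaw, hΓ₀]; simp
      | succ k ih =>
        rw [map_chainLaw_succ hT measurable_snd hP (fun z v => rfl) k, ih, hst]
    exact this N
  · have e : ∀ z : 𝔼 × 𝔼, edist z.1 z.2 ^ 2 = ENNReal.ofReal (‖z.1 - z.2‖ ^ 2) := fun z => by
      rw [edist_dist, dist_eq_norm, ENNReal.ofReal_pow (norm_nonneg _)]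
    simp_rw [e]
    refine hmain.trans ?_
    have hW₀ : ∫⁻ z : 𝔼 × 𝔼, ENNReal.ofReal (‖z.1 - z.2‖ ^ 2) ∂Γ₀ ≤ ENNReal.ofReal m₀ :=
      (lintegral_mono fun z => ENNReal.ofReal_le_ofReal (hWV z)).trans hV₀
    have hθ0 : 0 ≤ θ := by rw [hθ]; positivity
    calc _ ≤ ENNReal.ofReal (1 - q) ^ N * ENNReal.ofReal m₀ + N * (ENNReal.ofReal (δ ^ 2 / q)
          + N * ENNReal.ofReal θ * ENNReal.ofReal ((1 + c) ^ 3) ^ N * ENNReal.ofReal m₀) := by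
          gcongr
      _ = _ := by
          rw [← ENNReal.ofReal_pow (by linarith), ← ENNReal.ofReal_pow (by positivity),
            ← ENNReal.ofReal_natCast N, ← ENNReal.ofReal_mul (pow_nonneg (by linarith) N),
            ← ENNReal.ofReal_mul (by positivity), ← ENNReal.ofReal_mul (by positivity),
            ← ENNReal.ofReal_mul (by positivity), ← ENNReal.ofReal_add (by positivity)
              (by positivity), ← ENNReal.ofReal_mul (by positivity), ← ENNReal.ofReal_add
              (mul_nonneg (pow_nonneg (by linarith) N) hm₀0) (by positivity)]

end Coupling

/-! ### Choice of the parameters -/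

/-- The dimensionless quantities: `ℓ` is a large multiple of the logarithmic factor, whose
exponential dominates all data, and `h` is the step size in units of `m₂ ^ (-1/2)`. -/
structure Scales (n d κ ρ ε M r ℓ c b h : ℝ) : Prop where
  n_nonneg : 0 ≤ n
  d_nonneg : 0 ≤ d
  one_le_κ : 1 ≤ κ
  ρ_nonneg : 0 ≤ ρ
  ε_pos : 0 < ε
  M_pos : 0 < M
  r_pos : 0 < r
  b_pos : 0 < b
  ten_le : 10 ≤ ℓ
  n_le : n ≤ Real.exp ℓ
  d_le : d ≤ Real.exp ℓ
  ε_le : 1 / ε ≤ Real.exp ℓ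
  M_le : 1 + M ≤ Real.exp ℓ
  r_le : 1 + 1 / r ≤ Real.exp ℓ
  b_le : b ≤ Real.exp ℓ
  sq_b : b ^ 2 = κ ^ (3 / 2 : ℝ) + ρ + 1
  c_eq : c = 1 / (1000 * (1 + M) * (1 + 1 / r))
  h_eq : h = c / (ℓ ^ 12 * b)

namespace Scales

variable {n d κ ρ ε M r ℓ c b h : ℝ}

lemma le_exp (_ : Scales n d κ ρ ε M r ℓ c b h) : ℓ ≤ Real.exp ℓ := by
  linarith [Real.add_one_le_exp ℓ]

lemma exp_ge (H : Scales n d κ ρ ε M r ℓ c b h) : 20000 ≤ Real.exp ℓ := by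
  refine le_trans ?_ (Real.exp_le_exp.2 H.ten_le)
  have e : Real.exp 10 = Real.exp 1 ^ 10 := by rw [← Real.exp_nat_mul]; norm_num
  rw [e]
  calc (20000 : ℝ) ≤ 2.7 ^ 10 := by norm_num
    _ ≤ Real.exp 1 ^ 10 := by
        gcongr
        linarith [Real.exp_one_gt_d9]

lemma c_pos (H : Scales n d κ ρ ε M r ℓ c b h) : 0 < c := by
  have := H.M_pos
  have := H.r_pos
  rw [H.c_eq]; positivity

lemma c_bounds (H : Scales n d κ ρ ε M r ℓ c b h) :
    1000 * c ≤ 1 ∧ 1000 * c ≤ r ∧ 1000 * (c * M) ≤ 1 := by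
  have hM := H.M_pos
  have hr := H.r_pos
  have hr' : 0 < 1 / r := by positivity
  have e : 1000 * c * ((1 + M) * (1 + 1 / r)) = 1 := by rw [H.c_eq]; field_simp
  have hc := H.c_pos
  refine ⟨?_, ?_, ?_⟩
  · have : 1000 * c * 1 ≤ 1000 * c * ((1 + M) * (1 + 1 / r)) := by
      gcongr; nlinarith [mul_pos hM hr']
    linarith
  · have : 1000 * c * (1 / r) ≤ 1000 * c * ((1 + M) * (1 + 1 / r)) := by
      gcongr; nlinarith [mul_pos hM hr']
    rw [e, mul_one_div, div_le_one hr] at this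
    exact this
  · have : 1000 * c * M ≤ 1000 * c * ((1 + M) * (1 + 1 / r)) := by
      gcongr; nlinarith [mul_pos hM hr']
    linarith

lemma one_le_b (H : Scales n d κ ρ ε M r ℓ c b h) : 1 ≤ b := by
  have h1 : 1 ≤ κ ^ (3 / 2 : ℝ) := Real.one_le_rpow H.one_le_κ (by norm_num)
  have h2 := H.sq_b
  have h3 := H.ρ_nonneg
  nlinarith [H.b_pos]

lemma κ_le_sq_b (H : Scales n d κ ρ ε M r ℓ c b h) : κ ≤ b ^ 2 := by
  have h1 : κ ^ (1 : ℝ) ≤ κ ^ (3 / 2 : ℝ) :=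
    Real.rpow_le_rpow_of_exponent_le H.one_le_κ (by norm_num)
  rw [Real.rpow_one] at h1
  linarith [H.sq_b, H.ρ_nonneg]

lemma ρ_le_sq_b (H : Scales n d κ ρ ε M r ℓ c b h) : ρ + 1 ≤ b ^ 2 := by
  have h1 : 1 ≤ κ ^ (3 / 2 : ℝ) := Real.one_le_rpow H.one_le_κ (by norm_num)
  linarith [H.sq_b]

lemma sqrt_le_b (H : Scales n d κ ρ ε M r ℓ c b h) : Real.sqrt (ρ + 1) ≤ b :=
  (Real.sqrt_le_sqrt H.ρ_le_sq_b).trans_eq (Real.sqrt_sq H.b_pos.le)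

lemma h_mul (H : Scales n d κ ρ ε M r ℓ c b h) : h * b * ℓ ^ 12 = c := by
  have := H.ten_le
  have := H.b_pos
  rw [H.h_eq]; field_simp

lemma h_pos (H : Scales n d κ ρ ε M r ℓ c b h) : 0 < h := by
  have h1 := H.ten_le
  have h2 := H.b_pos
  have h3 := H.c_pos
  have : 0 < ℓ := by linarith
  rw [H.h_eq]; positivity

/-- The step size is small compared to `1 / b`, even after multiplication with powers of `ℓ`. -/
lemma h_mul_b_mul_le (H : Scales n d κ ρ ε M r ℓ c b h) : h * b * ℓ ^ 10 ≤ c / 100 := by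
  have h1 := H.ten_le
  have h2 := H.h_mul
  have h3 : 0 ≤ h * b * ℓ ^ 10 := by
    have := H.h_pos; have := H.b_pos; have : 0 < ℓ := by linarith
    positivity
  have h4 : (100 : ℝ) ≤ ℓ ^ 2 := by nlinarith
  have h5 : h * b * ℓ ^ 12 = h * b * ℓ ^ 10 * ℓ ^ 2 := by ring
  nlinarith

lemma h_mul_b_le (H : Scales n d κ ρ ε M r ℓ c b h) : h * b ≤ c := by
  have h1 : 0 ≤ h * b := mul_nonneg H.h_pos.le H.b_pos.le
  have h2 : (1 : ℝ) ≤ ℓ ^ 12 := one_le_pow₀ (by linarith [H.ten_le])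
  nlinarith [H.h_mul]

lemma sq_h_mul_sq_b_mul_le (H : Scales n d κ ρ ε M r ℓ c b h) :
    h ^ 2 * b ^ 2 * ℓ ^ 20 ≤ c ^ 2 / 10000 := by
  have h1 := H.h_mul_b_mul_le
  have h3 : 0 ≤ h * b * ℓ ^ 10 := by
    have := H.h_pos; have := H.b_pos; have : 0 < ℓ := by linarith [H.ten_le]
    positivity
  calc h ^ 2 * b ^ 2 * ℓ ^ 20 = (h * b * ℓ ^ 10) ^ 2 := by ring
    _ ≤ (c / 100) ^ 2 := pow_le_pow_left₀ h3 h1 2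
    _ = c ^ 2 / 10000 := by ring

lemma sq_h_mul_sq_b_le (H : Scales n d κ ρ ε M r ℓ c b h) : h ^ 2 * b ^ 2 ≤ c ^ 2 / 10000 := by
  have h2 : (1 : ℝ) ≤ ℓ ^ 20 := one_le_pow₀ (by linarith [H.ten_le])
  have h3 : 0 ≤ h ^ 2 * b ^ 2 := by positivity
  nlinarith [H.sq_h_mul_sq_b_mul_le]

lemma h_le_one (H : Scales n d κ ρ ε M r ℓ c b h) : h ≤ 1 := by
  have h1 := H.h_mul_b_le
  have h2 := H.c_bounds.1
  nlinarith [H.one_le_b, H.h_pos]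

/-- From here on every quantity is compared with a power of e^ℓ; the exact exponents are irrelevant
as long as D, N and G can beat them. -/
lemma inv_h_le (H : Scales n d κ ρ ε M r ℓ c b h) : 1 / h ≤ Real.exp ℓ ^ 16 := by
  have hZ := H.exp_ge
  have hℓ0 : 0 ≤ ℓ := by linarith [H.ten_le]
  have hb := H.b_pos
  have hM := H.M_pos
  have hr := H.r_pos
  have e : 1 / h = ℓ ^ 12 * b * (1000 * (1 + M) * (1 + 1 / r)) := by
    rw [H.h_eq, H.c_eq]; field_simp
  rw [e]
  calc ℓ ^ 12 * b * (1000 * (1 + M) * (1 + 1 / r))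
      ≤ Real.exp ℓ ^ 12 * Real.exp ℓ * (Real.exp ℓ * Real.exp ℓ * Real.exp ℓ) := by
        gcongr
        · exact H.le_exp
        · exact H.b_le
        · linarith
        · exact H.M_le
        · exact H.r_le
    _ = Real.exp ℓ ^ 16 := by ring

lemma inv_sq_h_le (H : Scales n d κ ρ ε M r ℓ c b h) : 1 / h ^ 2 ≤ Real.exp ℓ ^ 32 := by
  have h0 : 0 ≤ 1 / h := by have := H.h_pos; positivity
  calc 1 / h ^ 2 = (1 / h) ^ 2 := by rw [div_pow, one_pow]
    _ ≤ (Real.exp ℓ ^ 16) ^ 2 := pow_le_pow_left₀ h0 H.inv_h_le 2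
    _ = Real.exp ℓ ^ 32 := by ring

lemma force_le (H : Scales n d κ ρ ε M r ℓ c b h) :
    n * (Real.sqrt (ρ + 1) * M) ≤ Real.exp ℓ ^ 3 := by
  have h1 := H.n_nonneg
  have h2 := H.M_pos
  calc n * (Real.sqrt (ρ + 1) * M) ≤ Real.exp ℓ * (Real.exp ℓ * Real.exp ℓ) := by
        gcongr
        · exact H.n_le
        · exact H.sqrt_le_b.trans H.b_le
        · linarith [H.M_le]
    _ = Real.exp ℓ ^ 3 := by ring

lemma initial_le (H : Scales n d κ ρ ε M r ℓ c b h) {F L : ℝ} (hF0 : 0 ≤ F)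
    (hF : F ≤ Real.exp ℓ ^ 3) (hL : 2 ≤ L) :
    32 * (4 * d + 1 + h ^ 2 * L ^ 2 * F ^ 2) / (2 * (h ^ 2 * L ^ 2)) + 2 * F ^ 2 +
      2 * ((32 * h ^ 2 * d + 8 * (h ^ 2 * F) ^ 2) / (h ^ 2 / 8) ^ 2) ≤ Real.exp ℓ ^ 35 := by
  have hZ := H.exp_ge
  have hh := H.h_pos
  have hd := H.d_nonneg
  set Z := Real.exp ℓ with hZdef
  have hw := H.inv_sq_h_le
  have hw0 : 0 ≤ 1 / h ^ 2 := by positivity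
  have e1 : 32 * (4 * d + 1 + h ^ 2 * L ^ 2 * F ^ 2) / (2 * (h ^ 2 * L ^ 2))
      = 16 * (4 * d + 1) * (1 / h ^ 2) * (1 / L ^ 2) + 16 * F ^ 2 := by
    have : L ≠ 0 := by linarith
    field_simp
    ring
  have e2 : 2 * ((32 * h ^ 2 * d + 8 * (h ^ 2 * F) ^ 2) / (h ^ 2 / 8) ^ 2)
      = 4096 * d * (1 / h ^ 2) + 1024 * F ^ 2 := by
    field_simp
    ring
  have hL1 : 1 / L ^ 2 ≤ 1 := by
    rw [div_le_one (by positivity)]; nlinarith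
  have hF2 : F ^ 2 ≤ Z ^ 33 := by
    calc F ^ 2 ≤ (Z ^ 3) ^ 2 := pow_le_pow_left₀ hF0 hF 2
      _ = Z ^ 6 := by ring
      _ ≤ Z ^ 33 := pow_le_pow_right₀ (by linarith) (by norm_num)
  have h1 : 16 * (4 * d + 1) * (1 / h ^ 2) * (1 / L ^ 2) ≤ 16 * (5 * Z) * Z ^ 32 * 1 := by
    gcongr
    linarith [H.d_le]
  have h2 : 4096 * d * (1 / h ^ 2) ≤ 4096 * Z * Z ^ 32 := by
    gcongr
    exact H.d_le
  rw [e1, e2]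
  have h3 : Z ^ 35 = Z ^ 2 * Z ^ 33 := by ring
  have h4 : (6000 : ℝ) * Z ^ 33 ≤ Z ^ 2 * Z ^ 33 := by gcongr; nlinarith
  have h5 : 0 ≤ Z ^ 33 := by positivity
  have h6 : Z * Z ^ 32 = Z ^ 33 := by ring
  nlinarith

end Scales

lemma half_pow_le_exp (D : ℕ) : (1 / 2 : ℝ) ^ D ≤ Real.exp (-(D / 2)) := by
  have h1 : (1 / 2 : ℝ) ≤ Real.exp (-(1 / 2)) := by
    rw [Real.exp_neg, ← one_div]
    refine one_div_le_one_div_of_le (Real.exp_pos _) ?_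
    have e : Real.exp (1 / 2) ^ 2 = Real.exp 1 := by rw [← Real.exp_nat_mul]; norm_num
    nlinarith [Real.exp_one_lt_d9, Real.exp_pos (1 / 2)]
  calc (1 / 2 : ℝ) ^ D ≤ Real.exp (-(1 / 2)) ^ D := pow_le_pow_left₀ (by norm_num) h1 D
    _ = Real.exp (-(D / 2)) := by rw [← Real.exp_nat_mul]; congr 1; ring

namespace Scales

variable {n d κ ρ ε M r ℓ c b h : ℝ}

/-- The term ℓ^20 / 2 dominates ℓ^10, 120 ℓ and 7·10⁸ ℓ³ together, because ℓ^10 ≥ 10^10. -/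
lemma gaussian_tail_le {ℓ : ℝ} (hℓ : 10 ≤ ℓ) {u : ℝ} (hu : u ≤ 700000000 * ℓ ^ 3) :
    Real.exp (ℓ ^ 10 - (ℓ ^ 10) ^ 2 / 2) * Real.exp u ≤ (Real.exp ℓ ^ 120)⁻¹ := by
  rw [← Real.exp_add, ← Real.exp_nat_mul, ← Real.exp_neg]
  refine Real.exp_le_exp.2 ?_
  have h1 : (10 : ℝ) ^ 10 ≤ ℓ ^ 10 := pow_le_pow_left₀ (by norm_num) hℓ 10
  have h2 : ℓ ^ 3 ≤ ℓ ^ 10 := pow_le_pow_right₀ (by linarith) (by norm_num)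
  have h3 : ℓ ≤ ℓ ^ 10 := le_self_pow₀ (by linarith) (by norm_num)
  push_cast
  nlinarith

set_option maxHeartbeats 2000000 in
/-- All the smallness conditions on the parameters can be met. -/
lemma exists_parameters (H : Scales n d κ ρ ε M r ℓ c b h) :
    ∃ (D N : ℕ) (G B R δ : ℝ), 1 ≤ G ∧ 0 ≤ B ∧ 0 ≤ R ∧ ρ * M ≤ B ∧
      n * (Real.sqrt (ρ + 1) * M) ≤ R ∧
      64 * (h ^ 2 * κ) ≤ 1 ∧ 4 * ((2 * (D + 1 : ℕ)) ^ 2 * (h ^ 2 * κ)) ≤ 1 ∧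
      2 * (h * (Real.sqrt (ρ + 1) * G)) + 2 * (h ^ 2 * (2 * (ρ * M) + (B + r / 2))) ≤ r / 2 ∧
      28 * (2 * (D + 1 : ℕ)) ^ 2 * (1 / 2) ^ D *
        (R + h * (Real.sqrt d * G) + h ^ 2 * (n * (Real.sqrt (ρ + 1) * M))) ≤ δ ∧
      2 * (h * (Real.sqrt (ρ + 1) * G)) + 2 * (h ^ 2 * (ρ * M)) + Real.sqrt (ρ + 1) * δ
        ≤ h ^ 2 / 8 * B ∧
      2 * (h * (Real.sqrt d * G)) + 2 * (h ^ 2 * (n * (Real.sqrt (ρ + 1) * M))) + δ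
        ≤ h ^ 2 / 8 * R ∧
      (∀ m₀, 0 ≤ m₀ → m₀ ≤ Real.exp ℓ ^ 35 →
        (1 - h ^ 2 / 8) ^ N * m₀ + N * (δ ^ 2 / (h ^ 2 / 8) +
          N * (9 * ((n + d) * (2 * (1 + 2 * d) * Real.exp (G - G ^ 2 / 2)))) *
          ((1 + 2 * (h ^ 2 * (2 * (D + 1 : ℕ)) ^ 2)) ^ 3) ^ N * m₀) ≤ ε ^ 2) ∧
      (D + 1 : ℝ) ≤ 250 * ℓ ∧ (N : ℝ) ≤ 401 * ℓ * (1 / h ^ 2) := by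
  have hZ := H.exp_ge
  have hℓ := H.ten_le
  have hh := H.h_pos
  have hh1 := H.h_le_one
  have hd := H.d_nonneg
  have hn := H.n_nonneg
  have hM := H.M_pos
  have hr := H.r_pos
  have hρ := H.ρ_nonneg
  have hc := H.c_pos
  have hb := H.b_pos
  obtain ⟨hc1, hcr, hcM⟩ := H.c_bounds
  set Z := Real.exp ℓ with hZdef
  have hZ0 : 0 < Z := Real.exp_pos _
  have hZ1 : 1 ≤ Z := by linarith
  have hℓ0 : 0 < ℓ := by linarith
  set F : ℝ := n * (Real.sqrt (ρ + 1) * M) with hF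
  have hF0 : 0 ≤ F := by positivity
  have hFZ : F ≤ Z ^ 3 := H.force_le
  -- Large enough that e^(-G²/2) beats the growth e^(O(ℓ³)) of the Lyapunov function, and small
  -- enough that h b G is still small, because h carries ℓ^(-12).
  set G : ℝ := ℓ ^ 10 with hG
  have hG1 : 1 ≤ G := one_le_pow₀ (by linarith)
  have hGZ : G ≤ Z ^ 10 := pow_le_pow_left₀ hℓ0.le H.le_exp 10
  have hsd : Real.sqrt d ≤ Z := by
    refine (Real.sqrt_le_sqrt (H.d_le.trans (le_self_pow₀ hZ1 two_ne_zero))).trans_eq ?_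
    exact Real.sqrt_sq hZ0.le
  -- This gives 2^(-D) ≤ e^(-100 ℓ), which exceeds all polynomial losses in δ by a factor e^(51 ℓ).
  set D : ℕ := ⌈200 * ℓ⌉₊ with hD
  have hD1 : 200 * ℓ ≤ D := Nat.le_ceil _
  have hD2 : (D : ℝ) < 200 * ℓ + 1 := Nat.ceil_lt_add_one (by positivity)
  set L : ℝ := 2 * (D + 1 : ℕ) with hL
  have hLℓ : L ≤ 500 * ℓ := by rw [hL]; push_cast; linarith
  have hL2 : 2 ≤ L := by rw [hL]; push_cast; linarith
  set q : ℝ := h ^ 2 / 8 with hq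
  have hq0 : 0 < q := by positivity
  have hq1 : q ≤ 1 := by
    have : h ^ 2 ≤ 1 := pow_le_one₀ hh.le hh1
    linarith
  have hw := H.inv_sq_h_le
  have hqinv : 1 / q ≤ Z ^ 33 := by
    have : 1 / q = 8 * (1 / h ^ 2) := by rw [hq]; field_simp
    rw [this]
    calc 8 * (1 / h ^ 2) ≤ Z * Z ^ 32 := by gcongr; linarith
      _ = Z ^ 33 := by ring
  have hhG : h * (Real.sqrt (ρ + 1) * G) ≤ c / 100 := by
    refine le_trans ?_ H.h_mul_b_mul_le
    rw [← mul_assoc]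
    gcongr
    exact H.sqrt_le_b
  have hhρ : h ^ 2 * (ρ + 1) ≤ c ^ 2 / 10000 := by
    refine le_trans ?_ H.sq_h_mul_sq_b_le
    gcongr
    exact H.ρ_le_sq_b
  have hhρM : h ^ 2 * (ρ * M) ≤ r / 1000000 := by
    have h1 : h ^ 2 * (ρ * M) ≤ h ^ 2 * (ρ + 1) * M := by
      have : 0 ≤ h ^ 2 * M := by positivity
      linarith
    have h2 : h ^ 2 * (ρ + 1) * M ≤ c ^ 2 / 10000 * M := by gcongr
    have h3 : c * (c * M) ≤ r / 1000 * (1 / 1000) := by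
      gcongr <;> linarith
    linarith
  have hhκ : h ^ 2 * κ * ℓ ^ 20 ≤ c ^ 2 / 10000 := by
    refine le_trans ?_ H.sq_h_mul_sq_b_mul_le
    gcongr
    exact H.κ_le_sq_b
  have hc2 : c ^ 2 ≤ 1 / 1000000 := by
    calc c ^ 2 ≤ (1 / 1000) ^ 2 := pow_le_pow_left₀ hc.le (by linarith) 2
      _ = 1 / 1000000 := by norm_num
  have hκ0 : 0 < κ := by linarith [H.one_le_κ]
  have hL2κ : 4 * (L ^ 2 * (h ^ 2 * κ)) ≤ 1 := by
    have h1 : L ^ 2 ≤ 250000 * ℓ ^ 2 := by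
      calc L ^ 2 ≤ (500 * ℓ) ^ 2 := by gcongr
        _ = 250000 * ℓ ^ 2 := by ring
    have h2 : ℓ ^ 2 ≤ ℓ ^ 20 := pow_le_pow_right₀ (by linarith) (by norm_num)
    calc 4 * (L ^ 2 * (h ^ 2 * κ)) ≤ 4 * (250000 * ℓ ^ 20 * (h ^ 2 * κ)) := by
          gcongr; exact h1.trans (by gcongr)
      _ = 1000000 * (h ^ 2 * κ * ℓ ^ 20) := by ring
      _ ≤ 1 := by linarith
  -- Solved from the invariance condition for the norm, with 1 in place of δ.
  set R : ℝ := (2 * (h * (Real.sqrt d * G)) + 2 * (h ^ 2 * F) + 1) / q with hR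
  have hR0 : 0 ≤ R := by positivity
  have hqR : q * R = 2 * (h * (Real.sqrt d * G)) + 2 * (h ^ 2 * F) + 1 := by
    rw [hR]; field_simp
  have hhdG : h * (Real.sqrt d * G) ≤ Z ^ 11 := by
    calc h * (Real.sqrt d * G) ≤ 1 * (Z * Z ^ 10) := by gcongr
      _ = Z ^ 11 := by ring
  have hhF : h ^ 2 * F ≤ Z ^ 11 := by
    calc h ^ 2 * F ≤ 1 * Z ^ 3 := by gcongr; exact pow_le_one₀ hh.le hh1
      _ ≤ Z ^ 11 := by rw [one_mul]; exact pow_le_pow_right₀ hZ1 (by norm_num)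
  have hRZ : R ≤ Z ^ 45 := by
    have h1 : 2 * (h * (Real.sqrt d * G)) + 2 * (h ^ 2 * F) + 1 ≤ Z ^ 12 := by
      have h2 : 1 ≤ Z ^ 11 := one_le_pow₀ hZ1
      have h3 : 5 * Z ^ 11 ≤ Z * Z ^ 11 := by gcongr; linarith
      have h4 : Z ^ 12 = Z * Z ^ 11 := by ring
      linarith
    calc R = (2 * (h * (Real.sqrt d * G)) + 2 * (h ^ 2 * F) + 1) * (1 / q) := by
          rw [hR, mul_one_div]
      _ ≤ Z ^ 12 * Z ^ 33 := by gcongr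
      _ = Z ^ 45 := by ring
  -- The accuracy condition holds with equality.
  set δ : ℝ := 28 * L ^ 2 * (1 / 2) ^ D * (R + h * (Real.sqrt d * G) + h ^ 2 * F) with hδ
  have hδ0 : 0 ≤ δ := by positivity
  have hδZ : δ * Z ^ 51 ≤ 1 := by
    have h1 : (1 / 2 : ℝ) ^ D * Z ^ 100 ≤ 1 := by
      calc (1 / 2 : ℝ) ^ D * Z ^ 100 ≤ Real.exp (-(D / 2)) * Z ^ 100 := by
            gcongr; exact half_pow_le_exp D
        _ = Real.exp (-(D / 2) + 100 * ℓ) := by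
            rw [Real.exp_add, hZdef, ← Real.exp_nat_mul]; norm_num
        _ ≤ 1 := Real.exp_le_one_iff.2 (by linarith)
    have h2 : R + h * (Real.sqrt d * G) + h ^ 2 * F ≤ 3 * Z ^ 45 := by
      have : Z ^ 11 ≤ Z ^ 45 := pow_le_pow_right₀ hZ1 (by norm_num)
      linarith
    have h3 : L ^ 2 ≤ 250000 * Z ^ 2 := by
      calc L ^ 2 ≤ (500 * Z) ^ 2 := by gcongr; linarith [H.le_exp]
        _ = 250000 * Z ^ 2 := by ring
    calc δ * Z ^ 51 = 28 * L ^ 2 * (R + h * (Real.sqrt d * G) + h ^ 2 * F) * Z ^ 51 *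
          (1 / 2) ^ D := by rw [hδ]; ring
      _ ≤ 28 * (250000 * Z ^ 2) * (3 * Z ^ 45) * Z ^ 51 * (1 / 2) ^ D := by gcongr
      _ = 21000000 * Z ^ 98 * (1 / 2) ^ D := by ring
      _ ≤ Z ^ 2 * Z ^ 98 * (1 / 2) ^ D := by
          gcongr
          have := pow_le_pow_left₀ (by norm_num) hZ 2
          linarith
      _ = (1 / 2) ^ D * Z ^ 100 := by ring
      _ ≤ 1 := h1
  have hδ1 : δ ≤ 1 := by
    have : δ * 1 ≤ δ * Z ^ 51 := by gcongr; exact one_le_pow₀ hZ1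
    linarith
  have hsδ : Real.sqrt (ρ + 1) * δ ≤ r / 1000 := by
    have h1 : Real.sqrt (ρ + 1) ≤ Z := H.sqrt_le_b.trans H.b_le
    have h2 : 1 ≤ r * Z := by
      have := H.r_le
      have h3 : 1 / r ≤ Z := by linarith
      rwa [div_le_iff₀ hr, mul_comm] at h3
    have h3 : 1000 * Z * Z ≤ Z ^ 51 := by
      calc 1000 * Z * Z ≤ Z * Z * Z := by gcongr; linarith
        _ = Z ^ 3 := by ring
        _ ≤ Z ^ 51 := pow_le_pow_right₀ hZ1 (by norm_num)
    have h4 : Real.sqrt (ρ + 1) * δ * (1000 * Z) ≤ 1 := by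
      calc Real.sqrt (ρ + 1) * δ * (1000 * Z) ≤ Z * δ * (1000 * Z) := by gcongr
        _ = δ * (1000 * Z * Z) := by ring
        _ ≤ δ * Z ^ 51 := by gcongr
        _ ≤ 1 := hδZ
    have h5 : Real.sqrt (ρ + 1) * δ * (1000 * Z) ≤ r / 1000 * (1000 * Z) := by linarith
    exact le_of_mul_le_mul_right h5 (by positivity)
  -- Up to the constant, this is the largest B that analyticity allows: h² B = r / 20 fits under r /
  -- 2. The damping h² B / 8 = r / 160 then exceeds the contributions of velocity, force and solver
  -- error, each of which is at most a small fraction of r.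
  set B : ℝ := r / (20 * h ^ 2) with hB
  have hB0 : 0 ≤ B := by positivity
  have hhB : h ^ 2 * B = r / 20 := by rw [hB]; field_simp
  -- This gives (1 - q)^N ≤ e^(-50 ℓ), enough against the initial size e^(35 ℓ) and the target
  -- accuracy.
  set N : ℕ := ⌈50 * ℓ / q⌉₊ with hN
  have hN1 : 50 * ℓ / q ≤ N := Nat.le_ceil _
  have hN2 : (N : ℝ) < 50 * ℓ / q + 1 := Nat.ceil_lt_add_one (by positivity)
  have hNle : (N : ℝ) ≤ 401 * ℓ * (1 / h ^ 2) := by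
    have h1 : 50 * ℓ / q = 400 * ℓ * (1 / h ^ 2) := by rw [hq]; field_simp; norm_num
    have h2 : 1 ≤ 1 / h ^ 2 := by
      rw [le_div_iff₀ (by positivity), one_mul]; exact pow_le_one₀ hh.le hh1
    have h3 : 1 * 1 ≤ ℓ * (1 / h ^ 2) := by gcongr; linarith
    linarith
  have hNZ : (N : ℝ) ≤ Z ^ 34 := by
    calc (N : ℝ) ≤ 401 * ℓ * (1 / h ^ 2) := hNle
      _ ≤ Z * Z * Z ^ 32 := by
          gcongr
          · linarith
          · exact H.le_exp
      _ = Z ^ 34 := by ring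
  have hεZ : 1 ≤ ε ^ 2 * Z ^ 2 := by
    have h1 : 1 ≤ ε * Z := by
      have := H.ε_le
      rwa [div_le_iff₀ H.ε_pos, mul_comm] at this
    calc (1 : ℝ) ≤ (ε * Z) ^ 2 := one_le_pow₀ h1
      _ = ε ^ 2 * Z ^ 2 := by ring
  -- Of the three powers of Z, two pay for 1 / ε² and one for the factor 3, since three terms share
  -- ε².
  have hsmall : ∀ t : ℝ, t * Z ^ 3 ≤ 1 → t ≤ ε ^ 2 / 3 := fun t ht => by
    have h1 : t * Z ^ 3 ≤ ε ^ 2 / 3 * Z ^ 3 := by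
      have : ε ^ 2 * Z ^ 2 * 3 ≤ ε ^ 2 * Z ^ 2 * Z := by gcongr; linarith
      have h2 : ε ^ 2 / 3 * Z ^ 3 = ε ^ 2 * Z ^ 2 * Z / 3 := by ring
      linarith
    exact le_of_mul_le_mul_right h1 (by positivity)
  refine ⟨D, N, G, B, R, δ, hG1, hB0, hR0, ?_, ?_, ?_, hL2κ, ?_, le_rfl, ?_, ?_, ?_, ?_, hNle⟩
  · have h1 : h ^ 2 * (ρ * M) ≤ h ^ 2 * B := by rw [hhB]; linarith
    exact le_of_mul_le_mul_left h1 (by positivity)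
  · have h1 : q * F ≤ q * R := by
      rw [hqR, hq]
      have : 0 ≤ h * (Real.sqrt d * G) := by positivity
      have : 0 ≤ h ^ 2 * F := by positivity
      linarith
    exact le_of_mul_le_mul_left h1 hq0
  · have : (16 : ℝ) * (h ^ 2 * κ) ≤ 4 * (L ^ 2 * (h ^ 2 * κ)) := by
      have : 4 * (h ^ 2 * κ) ≤ L ^ 2 * (h ^ 2 * κ) := by
        gcongr
        have := pow_le_pow_left₀ (by norm_num) hL2 2
        linarith
      linarith
    have h20 : (10 : ℝ) ^ 20 ≤ ℓ ^ 20 := pow_le_pow_left₀ (by norm_num) hℓ 20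
    have : h ^ 2 * κ * 10 ^ 20 ≤ h ^ 2 * κ * ℓ ^ 20 := by gcongr
    linarith
  · have h1 : h ^ 2 * r ≤ r / 1000 := by
      have h2 : h ^ 2 * 1 ≤ h ^ 2 * (ρ + 1) := by gcongr; linarith
      have h3 : h ^ 2 ≤ 1 / 1000 := by linarith
      calc h ^ 2 * r ≤ 1 / 1000 * r := by gcongr
        _ = r / 1000 := by ring
    linarith
  · have : q * B = r / 160 := by rw [hq]; linarith
    linarith
  · rw [hqR]; linarith
  · intro m₀ hm₀ hm₀Z
    have t1 : (1 - q) ^ N * m₀ ≤ ε ^ 2 / 3 := by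
      apply hsmall
      have h1 : (1 - q) ^ N ≤ (Z ^ 50)⁻¹ := by
        calc (1 - q) ^ N ≤ Real.exp (-q) ^ N := by
              refine pow_le_pow_left₀ (by linarith) ?_ N
              linarith [Real.add_one_le_exp (-q)]
          _ = Real.exp (N * -q) := by rw [← Real.exp_nat_mul]
          _ ≤ Real.exp (-((50 : ℕ) * ℓ)) := by
              refine Real.exp_le_exp.2 ?_
              rw [div_le_iff₀ hq0] at hN1
              push_cast
              linarith
          _ = (Z ^ 50)⁻¹ := by rw [Real.exp_neg, Real.exp_nat_mul]
      calc (1 - q) ^ N * m₀ * Z ^ 3 ≤ (Z ^ 50)⁻¹ * Z ^ 35 * Z ^ 3 := by gcongr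
        _ = Z ^ 38 / Z ^ 50 := by ring
        _ ≤ 1 := by
            rw [div_le_one (by positivity)]
            exact pow_le_pow_right₀ hZ1 (by norm_num)
    have t2 : N * (δ ^ 2 / q) ≤ ε ^ 2 / 3 := by
      apply hsmall
      calc N * (δ ^ 2 / q) * Z ^ 3 = N * (δ ^ 2 * (1 / q)) * Z ^ 3 := by rw [mul_one_div]
        _ ≤ Z ^ 34 * (δ ^ 2 * Z ^ 33) * Z ^ 3 := by gcongr
        _ = δ ^ 2 * Z ^ 70 := by ring
        _ ≤ δ ^ 2 * Z ^ 102 := mul_le_mul_of_nonneg_left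
            (pow_le_pow_right₀ hZ1 (by norm_num)) (sq_nonneg δ)
        _ = (δ * Z ^ 51) ^ 2 := by ring
        _ ≤ 1 := pow_le_one₀ (by positivity) hδZ
    have t3 : N * (N * (9 * ((n + d) * (2 * (1 + 2 * d) * Real.exp (G - G ^ 2 / 2)))) *
          ((1 + 2 * (h ^ 2 * L ^ 2)) ^ 3) ^ N * m₀) ≤ ε ^ 2 / 3 := by
      apply hsmall
      have h1 : ((1 + 2 * (h ^ 2 * L ^ 2)) ^ 3) ^ N
          ≤ Real.exp (6 * (h ^ 2 * L ^ 2) * N) := by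
        calc ((1 + 2 * (h ^ 2 * L ^ 2)) ^ 3) ^ N
            ≤ (Real.exp (2 * (h ^ 2 * L ^ 2)) ^ 3) ^ N := by
              gcongr
              linarith [Real.add_one_le_exp (2 * (h ^ 2 * L ^ 2))]
          _ = Real.exp (6 * (h ^ 2 * L ^ 2) * N) := by
              rw [← Real.exp_nat_mul, ← Real.exp_nat_mul]
              congr 1; push_cast; ring
      -- The step size cancels: L is O(ℓ) and N is O(ℓ / h²), so the total growth exponent is O(ℓ³).
      have h2 : 6 * (h ^ 2 * L ^ 2) * N ≤ 700000000 * ℓ ^ 3 := by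
        calc 6 * (h ^ 2 * L ^ 2) * N
            ≤ 6 * (h ^ 2 * (500 * ℓ) ^ 2) * (401 * ℓ * (1 / h ^ 2)) := by gcongr
          _ = 601500000 * ℓ ^ 3 := by field_simp; norm_num
          _ ≤ 700000000 * ℓ ^ 3 := by gcongr; norm_num
      have h3 := gaussian_tail_le hℓ h2
      have h4 : 9 * ((n + d) * (2 * (1 + 2 * d))) ≤ Z ^ 3 := by
        calc 9 * ((n + d) * (2 * (1 + 2 * d))) ≤ 9 * ((Z + Z) * (2 * (Z + 2 * Z))) := by
              gcongr
              · exact H.n_le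
              · exact H.d_le
              · exact H.d_le
          _ = 108 * Z ^ 2 := by ring
          _ ≤ Z * Z ^ 2 := by gcongr; linarith
          _ = Z ^ 3 := by ring
      calc N * (N * (9 * ((n + d) * (2 * (1 + 2 * d) * Real.exp (G - G ^ 2 / 2)))) *
            ((1 + 2 * (h ^ 2 * L ^ 2)) ^ 3) ^ N * m₀) * Z ^ 3
          = N * N * (9 * ((n + d) * (2 * (1 + 2 * d)))) * (Real.exp (G - G ^ 2 / 2) *
            ((1 + 2 * (h ^ 2 * L ^ 2)) ^ 3) ^ N) * m₀ * Z ^ 3 := by ring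
        _ ≤ Z ^ 34 * Z ^ 34 * Z ^ 3 * (Real.exp (G - G ^ 2 / 2) *
            Real.exp (6 * (h ^ 2 * L ^ 2) * N)) * Z ^ 35 * Z ^ 3 := by gcongr
        _ ≤ Z ^ 34 * Z ^ 34 * Z ^ 3 * (Z ^ 120)⁻¹ * Z ^ 35 * Z ^ 3 := by gcongr
        _ = Z ^ 109 / Z ^ 120 := by ring
        _ ≤ 1 := by
            rw [div_le_one (by positivity)]
            exact pow_le_pow_right₀ hZ1 (by norm_num)
    rw [mul_add]
    linarith
  · linarith

end Scales

lemma one_le_logFactor (n d : ℕ) {κ ρ ε : ℝ} (hκ : 1 ≤ κ) (hρ : 0 ≤ ρ) (hε : 0 < ε) :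
    1 ≤ logFactor n d κ ρ ε := by
  have h1 : (0 : ℝ) ≤ n := Nat.cast_nonneg n
  have h2 : (0 : ℝ) ≤ d := Nat.cast_nonneg d
  have h3 : 0 < 1 / ε := by positivity
  rw [logFactor, Real.le_log_iff_exp_le (by linarith)]
  linarith [Real.exp_one_lt_d9]

/-- The multiple 10 + M + 1/r of the logarithm makes e^ℓ dominate M and 1/r as well as all data. It
depends only on M and r, and so does the final constant. -/
lemma exists_scales (n d : ℕ) {κ ρ ε M r : ℝ} (hκ : 1 ≤ κ) (hρ : 0 ≤ ρ) (hε : 0 < ε)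
    (hM : 0 < M) (hr : 0 < r) :
    ∃ b h : ℝ, Scales n d κ ρ ε M r ((10 + M + 1 / r) * logFactor n d κ ρ ε)
      (1 / (1000 * (1 + M) * (1 + 1 / r))) b h := by
  have hΛ := one_le_logFactor n d hκ hρ hε
  have hn : (0 : ℝ) ≤ n := Nat.cast_nonneg n
  have hd : (0 : ℝ) ≤ d := Nat.cast_nonneg d
  have hε' : 0 < 1 / ε := by positivity
  have hr' : 0 < 1 / r := by positivity
  set X : ℝ := 2 + n + d + κ + ρ + 1 / ε with hX
  have hXΛ : Real.exp (logFactor n d κ ρ ε) = X := Real.exp_log (by linarith)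
  set Λ := logFactor n d κ ρ ε
  have hc2 : ∀ t, 0 ≤ t → t ≤ 10 + M + 1 / r → t ≤ (10 + M + 1 / r) * Λ := fun t _ ht =>
    ht.trans (le_mul_of_one_le_right (by linarith) hΛ)
  have hXZ : X ≤ Real.exp ((10 + M + 1 / r) * Λ) := by
    rw [← hXΛ]
    refine Real.exp_le_exp.2 (le_mul_of_one_le_left (by linarith) (by linarith))
  have hκ1 : 1 ≤ κ ^ (3 / 2 : ℝ) := Real.one_le_rpow hκ (by norm_num)
  have hκ2 : κ ^ (3 / 2 : ℝ) ≤ κ ^ 2 := by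
    rw [← Real.rpow_natCast]
    exact Real.rpow_le_rpow_of_exponent_le hκ (by norm_num)
  refine ⟨Real.sqrt (κ ^ (3 / 2 : ℝ) + ρ + 1), 1 / (1000 * (1 + M) * (1 + 1 / r)) /
    (((10 + M + 1 / r) * Λ) ^ 12 * Real.sqrt (κ ^ (3 / 2 : ℝ) + ρ + 1)), ?_⟩
  constructor
  case h_eq => rfl
  case c_eq => rfl
  case sq_b => exact Real.sq_sqrt (by linarith)
  case b_le =>
    refine (Real.sqrt_le_sqrt (y := X ^ 2) ?_).trans ((Real.sqrt_sq (by linarith)).trans_le hXZ)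
    nlinarith
  case b_pos => exact Real.sqrt_pos.2 (by linarith)
  case ten_le => exact hc2 10 (by norm_num) (by linarith)
  case M_le =>
    refine le_trans ?_ (Real.exp_le_exp.2 (hc2 M hM.le (by linarith)))
    linarith [Real.add_one_le_exp M]
  case r_le =>
    refine le_trans ?_ (Real.exp_le_exp.2 (hc2 (1 / r) hr'.le (by linarith)))
    linarith [Real.add_one_le_exp (1 / r)]
  all_goals first | assumption | linarith

/-! ### From couplings to the Wasserstein bound for HMC -/

lemma wasserstein_two_le {E : Type*} [MeasurableSpace E] [PseudoEMetricSpace E]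
    {μ ν : Measure E} {Γ : Measure (E × E)} (hΓ : Γ.map Prod.fst = μ ∧ Γ.map Prod.snd = ν)
    {t : ℝ} (ht : 0 ≤ t) (h : ∫⁻ z, edist z.1 z.2 ^ 2 ∂Γ ≤ ENNReal.ofReal (t ^ 2)) :
    wasserstein 2 μ ν ≤ ENNReal.ofReal t := by
  rw [wasserstein]
  calc _ ≤ (ENNReal.ofReal (t ^ 2)) ^ (1 / ((2 : ℕ) : ℝ)) := by
        refine ENNReal.rpow_le_rpow ?_ (by positivity)
        exact (iInf₂_le Γ hΓ).trans h
    _ = ENNReal.ofReal t := by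
        rw [ENNReal.ofReal_pow ht, ← ENNReal.rpow_natCast, ← ENNReal.rpow_mul]
        norm_num

section Potential

variable {n d : ℕ} {A : Matrix (Fin n) (Fin d) ℝ} {φ : Fin n → ℝ → ℝ} {m K M r τ s : ℝ}

lemma isRegularRidge_potential (hm : 0 < m) (hmK : m ≤ K) (hM : 0 < M) (hr : 0 < r)
    (hφ : ∀ i, ContDiff ℝ ∞ (φ i)) (hC : ∀ i, HasCauchyEstimate (deriv (φ i)) M r)
    (hA : inftyOpNorm (A * Aᵀ) = τ) (hs : ∀ i, ‖row A i‖ ≤ s)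
    (Q : QuadBounds (potential A φ m) (ridgeField (row A) (fun i => deriv (φ i)) m) m K) :
    IsRegularRidge (row A) (fun i => deriv (φ i)) m K M r τ (n * (s * M)) where
  smooth i := (contDiff_infty_iff_deriv.1 (hφ i)).2
  cauchy := hC
  M_nonneg := hM.le
  r_pos := hr
  gram i := hA ▸ sum_abs_inner_row_le A i
  sum_norm := by
    calc ∑ i, M * ‖row A i‖ ≤ ∑ _i : Fin n, M * s := by gcongr with i; exact hs i
      _ = n * (s * M) := by simp [mul_comm M]
  m_nonneg := hm.le
  K_nonneg := hm.le.trans hmK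
  m_le := hmK
  lip := Q.norm_sub_le hm.le (hm.trans_le hmK)

/-- The diagonal entry ‖aᵢ‖² of the Gram matrix is at most its row sum. -/
lemma norm_row_le (hA : inftyOpNorm (A * Aᵀ) = τ) (hs0 : 0 ≤ s) (hs : τ ≤ s ^ 2) (i : Fin n) :
    ‖row A i‖ ≤ s := by
  refine abs_le_of_sq_le_sq' ?_ hs0 |>.2
  calc ‖row A i‖ ^ 2 = ⟪row A i, row A i⟫ := (real_inner_self_eq_norm_sq _).symm
    _ ≤ |⟪row A i, row A i⟫| := le_abs_self _
    _ ≤ ∑ j, |⟪row A i, row A j⟫| :=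
        Finset.single_le_sum (f := fun j => |⟪row A i, row A j⟫|) (fun j _ => abs_nonneg _)
          (Finset.mem_univ i)
    _ ≤ τ := hA ▸ sum_abs_inner_row_le A i
    _ ≤ s ^ 2 := hs

end Potential

/-- A zero of a regular ridge field is bounded, and so are its inner products with the
directions. -/
lemma IsRegularRidge.bounds_of_eq_zero {ι E : Type*} [Fintype ι] [NormedAddCommGroup E]
    [InnerProductSpace ℝ E] {a : ι → E} {ψ : ι → ℝ → ℝ} {m K M r τ F : ℝ}
    (S : IsRegularRidge a ψ m K M r τ F) (hm : 0 < m) {x : E} (hx : ridgeField a ψ m x = 0) :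
    m * ‖x‖ ≤ F ∧ ∀ i, m * |⟪a i, x⟫| ≤ τ * M := by
  have e : m • x = -∑ i, ψ i ⟪a i, x⟫ • a i := eq_neg_of_add_eq_zero_right hx
  refine ⟨?_, fun i => ?_⟩
  · rw [← abs_of_pos hm, ← Real.norm_eq_abs, ← norm_smul, e, norm_neg]
    exact S.norm_bounded_part_le x
  · have e' : m * |⟪a i, x⟫| = |⟪a i, m • x⟫| := by
      rw [inner_smul_right, abs_mul, abs_of_pos hm]
    rw [e', e, inner_neg_right, abs_neg]
    exact S.abs_inner_bounded_part_le i x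

set_option maxHeartbeats 1000000 in
/-- Accuracy of HMC, with the step size in units of `m ^ (-1/2)`. -/
theorem exists_wasserstein_hmcLaw_le {n d : ℕ} {m K τ ε M r ℓ c b h : ℝ} (hm : 0 < m)
    (hmK : m ≤ K) (H : Scales n d (K / m) (τ / m) ε M r ℓ c b h) :
    ∃ D N : ℕ, (D + 1 : ℝ) ≤ 250 * ℓ ∧ (N : ℝ) ≤ 401 * ℓ * (1 / h ^ 2) ∧
      ∀ (A : Matrix (Fin n) (Fin d) ℝ) (φ : Fin n → ℝ → ℝ) (x₀ : EuclideanSpace ℝ (Fin d)),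
        (∀ i, ContDiff ℝ ∞ (φ i)) → (∀ i, HasCauchyEstimate (deriv (φ i)) M r) →
        HessianBounds (potential A φ m) m K → inftyOpNorm (A * Aᵀ) = τ →
        (x₀ = 0 ∨ IsMinOn (potential A φ m) Set.univ x₀) →
        wasserstein 2 (hmcLaw (potential A φ m) (D + 1) D (h / Real.sqrt m) x₀ N)
          (gibbs (potential A φ m)) ≤ ENNReal.ofReal (ε / Real.sqrt m) := by
  obtain ⟨D, N, G, B, R, δ, hG, hB0, hR0, hB, hR, hK1, hK2, h1, hδ, h2, h3, hfin, hD, hN⟩ :=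
    H.exists_parameters
  refine ⟨D, N, hD, hN, fun A φ x₀ hφ hC hH hA hx₀ => ?_⟩
  have hM := H.M_pos
  have hr := H.r_pos
  have hh := H.h_pos
  have hρ := H.ρ_nonneg
  have hℓ := H.ten_le
  set σ := Real.sqrt m with hσ
  have hσ0 : 0 < σ := Real.sqrt_pos.2 hm
  have hσ2 : σ ^ 2 = m := Real.sq_sqrt hm.le
  -- The summand 1 keeps the bound σ w on the rows positive when τ = 0; the directions are divided
  -- by it.
  set w : ℝ := Real.sqrt (τ / m + 1) with hw
  have hw0 : 0 < w := Real.sqrt_pos.2 (by linarith)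
  have hw2 : w ^ 2 = τ / m + 1 := Real.sq_sqrt (by linarith)
  have hs : ∀ i, ‖row A i‖ ≤ σ * w := norm_row_le hA (by positivity) (by
    rw [mul_pow, hσ2, hw2, mul_add, mul_div_cancel₀ _ hm.ne']; linarith)
  set ψ : Fin n → ℝ → ℝ := fun i => deriv (φ i) with hψ
  have hgrad : gradient (potential A φ m) = ridgeField (row A) ψ m := gradient_potential A φ m hφ
  have hcd := contDiff_potential A φ m hφ
  have Q : QuadBounds (potential A φ m) (ridgeField (row A) ψ m) m K :=
    hgrad ▸ quadBounds_of_hessianBounds (contDiff_infty.1 hcd 2) hH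
  have hf : ∀ x, HasGradientAt (potential A φ m) (ridgeField (row A) ψ m x) x := fun x =>
    hgrad ▸ (hcd.differentiable (by simp) x).hasGradientAt
  have S := isRegularRidge_potential hm hmK hM hr hφ hC hA hs Q
  set F : ℝ := n * (w * M) with hF
  have hF0 : 0 ≤ F := by positivity
  have eF : n * (σ * w * M) = σ * F := by rw [hF]; ring
  rw [eF] at S
  have hzero : x₀ = 0 ∨ ridgeField (row A) ψ m x₀ = 0 := by
    refine hx₀.imp_right fun hmin => ?_
    have h0 := (hmin.isLocalMin Filter.univ_mem).fderiv_eq_zero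
    rw [← hgrad, gradient, h0, map_zero]
  have hx₀F : σ * ‖x₀‖ ≤ F := by
    rcases hzero with rfl | h0
    · simpa using hF0
    · have := (S.bounds_of_eq_zero hm h0).1
      rw [← hσ2, sq, mul_assoc] at this
      exact le_of_mul_le_mul_left this hσ0
  have hx₀B : ∀ i, |⟪row A i, x₀⟫| ≤ B := fun i => by
    rcases hzero with rfl | h0
    · simpa using hB0
    · refine le_trans ?_ hB
      have := (S.bounds_of_eq_zero hm h0).2 i
      rw [div_mul_eq_mul_div, le_div_iff₀ hm]
      linarith
  have hh2 : (h / σ) ^ 2 = h ^ 2 / m := by rw [div_pow, hσ2]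
  have e1 : h / σ * (σ * w * G) = h * (w * G) := by field_simp
  have e2 : m * (h / σ) ^ 2 = h ^ 2 := by rw [hh2]; field_simp
  have e3 : (h / σ) ^ 2 * K = h ^ 2 * (K / m) := by rw [hh2]; ring
  have e4 : (h / σ) ^ 2 * (σ * F) = h ^ 2 * F / σ := by rw [hh2, ← hσ2]; field_simp
  have hlaw : ∀ k, hmcLaw (potential A φ m) (D + 1) D (h / σ) x₀ (k + 1)
      = ((hmcLaw (potential A φ m) (D + 1) D (h / σ) x₀ k).prod (stdGaussian _)).map
        fun z => collocation (ridgeField (row A) ψ m) (D + 1) D (h / σ) z.1 z.2 := fun k => by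
    rw [hmcLaw]
    simp_rw [odeSolve_eq_collocation, hgrad]
  -- Rescaling space by σ turns m into 1. The lengths R and δ and the step h carry 1 / σ, while the
  -- norms of the aᵢ carry σ. The bound B on inner products is scale free. The number of sweeps
  -- equals D, with D + 1 nodes.
  obtain ⟨Γ, hΓ, hΓle⟩ := exists_coupling_lintegral_le (J := D) (N := N) (h := h / σ)
    (s := σ * w) (G := G) (B := B) (R := R / σ) (δ := δ / σ) S Q hf hm (by positivity)
    (by rw [e3]; exact hK1) (by rw [e3]; exact hK2) le_rfl (by positivity) hs hG hx₀B
    (by rw [le_div_iff₀ hσ0, mul_comm]; exact hx₀F.trans hR)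
    (by
      have : (h / σ) ^ 2 * (2 * (τ * M) + m * (B + r / 2))
          = h ^ 2 * (2 * (τ / m * M) + (B + r / 2)) := by rw [hh2]; field_simp
      rw [e1, this]; exact h1)
    (by
      rw [e4, le_div_iff₀ hσ0]
      refine le_trans (le_of_eq ?_) hδ
      field_simp)
    (by
      have : (h / σ) ^ 2 * (τ * M) = h ^ 2 * (τ / m * M) := by rw [hh2]; field_simp
      have e5 : σ * w * (δ / σ) = w * δ := by field_simp
      rw [e1, this, e5, e2]; exact h2)
    (by
      rw [e4, e2]
      have := div_le_div_of_nonneg_right h3 hσ0.le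
      refine le_trans (le_of_eq ?_) (this.trans (le_of_eq ?_)) <;> ring)
    rfl rfl rfl rfl rfl rfl hlaw
  set L : ℝ := 2 * (D + 1 : ℕ) with hL
  have hL2 : 2 ≤ L := by rw [hL]; push_cast; linarith [(Nat.cast_nonneg D : (0 : ℝ) ≤ D)]
  clear_value L
  refine wasserstein_two_le hΓ (by have := H.ε_pos; positivity) (hΓle.trans ?_)
  refine ENNReal.ofReal_le_ofReal ?_
  rw [e2, div_pow ε, hσ2]
  set m₀ : ℝ := 32 / m * (4 * d + 1 + (h / σ) ^ 2 * L ^ 2 * (σ * F) ^ 2) /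
    (2 * (h ^ 2 * L ^ 2)) + 2 * ‖x₀‖ ^ 2 +
    2 * ((32 * (h / σ) ^ 2 * d + 8 * ((h / σ) ^ 2 * (σ * F)) ^ 2) / (h ^ 2 / 8) ^ 2) with hm₀
  have hm₀0 : 0 ≤ m₀ := by positivity
  -- The product m m₀ is the initial Lyapunov value in rescaled units, where the bound of
  -- `Scales.initial_le` applies.
  have hm₀le : m * m₀ ≤ Real.exp ℓ ^ 35 := by
    refine le_trans ?_ (H.initial_le hF0 H.force_le hL2)
    have t1 : m * (32 / m * (4 * d + 1 + (h / σ) ^ 2 * L ^ 2 * (σ * F) ^ 2) /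
        (2 * (h ^ 2 * L ^ 2))) = 32 * (4 * d + 1 + h ^ 2 * L ^ 2 * F ^ 2) /
          (2 * (h ^ 2 * L ^ 2)) := by
      rw [hh2, mul_pow, hσ2]; field_simp
    have t2 : m * (2 * ‖x₀‖ ^ 2) ≤ 2 * F ^ 2 := by
      have := pow_le_pow_left₀ (by positivity) hx₀F 2
      rw [mul_pow, hσ2] at this
      linarith
    have t3 : m * (2 * ((32 * (h / σ) ^ 2 * d + 8 * ((h / σ) ^ 2 * (σ * F)) ^ 2)
        / (h ^ 2 / 8) ^ 2)) = 2 * ((32 * h ^ 2 * d + 8 * (h ^ 2 * F) ^ 2) / (h ^ 2 / 8) ^ 2) := by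
      rw [e4, hh2, div_pow _ σ, hσ2]; field_simp
    rw [hm₀, mul_add, mul_add, t1, t3]
    linarith
  rw [le_div_iff₀ hm]
  refine le_trans (le_of_eq ?_) (hfin (m * m₀) (by positivity) hm₀le)
  rw [div_pow δ, hσ2, Fintype.card_fin]
  field_simp

end HMCSampling

end

/-! ### The main theorem -/

open HMCSampling in
theorem mainTheorem1 :
    ∃ p : ℕ, ∀ M r : ℝ, 0 < M → 0 < r → ∃ C : ℝ, 0 < C ∧
      ∀ (n d : ℕ) (m₂ M₂ τ ε : ℝ), 0 < m₂ → m₂ ≤ M₂ → 0 ≤ τ → 0 < ε →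
        -- step size, solver parameters and number of iterations depend on these numbers only
        ∃ (h : ℝ) (D J N : ℕ),
          0 < h ∧ h ≤ m₂ ^ (1 / 4 : ℝ) / (2 * M₂ ^ (3 / 4 : ℝ)) ∧
          (N : ℝ) ≤ C * ((M₂ / m₂) ^ (3 / 2 : ℝ) + τ / m₂) *
            logFactor n d (M₂ / m₂) (τ / m₂) ε ^ p ∧
          (iterationTime d D J h : ℝ) ≤ C * d * logFactor n d (M₂ / m₂) (τ / m₂) ε ^ p ∧
          (iterationGradEvals D J h : ℝ) ≤ C * logFactor n d (M₂ / m₂) (τ / m₂) ε ^ p ∧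
          ∀ (A : Matrix (Fin n) (Fin d) ℝ) (φ : Fin n → ℝ → ℝ)
            (x₀ : EuclideanSpace ℝ (Fin d)),
            (∀ i, ContDiff ℝ ∞ (φ i)) →
            (∀ i, HasCauchyEstimate (deriv (φ i)) M r) →
            HessianBounds (potential A φ m₂) m₂ M₂ →
            inftyOpNorm (A * Aᵀ) = τ →
            (x₀ = 0 ∨ IsMinOn (potential A φ m₂) Set.univ x₀) →
            wasserstein 2 (hmcLaw (potential A φ m₂) D J h x₀ N) (gibbs (potential A φ m₂)) ≤
              ENNReal.ofReal (ε / Real.sqrt m₂) := by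
  -- The exponent comes from N = O(ℓ / h²) with 1 / h² = ℓ^24 b² / c². The cost of an iteration is
  -- much smaller: D sweeps of O(D²) vector operations, with D = O(ℓ).
  refine ⟨25, fun M r hM hr => ?_⟩
  set c₂ : ℝ := 10 + M + 1 / r with hc₂
  set c : ℝ := 1 / (1000 * (1 + M) * (1 + 1 / r)) with hc
  have hc₂0 : 0 < c₂ := by positivity
  have hc0 : 0 < c := by positivity
  refine ⟨802 * c₂ ^ 25 / c ^ 2 + 13 * (250 * c₂) ^ 3, by positivity, ?_⟩
  intro n d m K τ ε hm hmK hτ hε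
  have hκ : 1 ≤ K / m := by rwa [one_le_div hm]
  have hρ : 0 ≤ τ / m := by positivity
  have hΛ := one_le_logFactor n d hκ hρ hε
  obtain ⟨b, h, H⟩ := exists_scales n d hκ hρ hε hM hr
  rw [← hc₂, ← hc] at H
  obtain ⟨D, N, hD, hN, hW⟩ := exists_wasserstein_hmcLaw_le hm hmK H
  set Λ := logFactor n d (K / m) (τ / m) ε
  have hh := H.h_pos
  have hb := H.b_pos
  have hK : 0 < K := hm.trans_le hmK
  have hd : (0 : ℝ) ≤ d := Nat.cast_nonneg d
  have hκ1 : 1 ≤ (K / m) ^ (3 / 2 : ℝ) := Real.one_le_rpow hκ (by norm_num)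
  have hΛ0 : 0 < Λ := by linarith
  set a : ℝ := D + 1 with ha
  have hD0 : (0 : ℝ) ≤ D := Nat.cast_nonneg D
  have ha1 : 1 ≤ a := by linarith
  have ha3 : a ^ 3 ≤ (250 * c₂) ^ 3 * Λ ^ 25 := by
    calc a ^ 3 ≤ (250 * (c₂ * Λ)) ^ 3 := by gcongr
      _ = (250 * c₂) ^ 3 * Λ ^ 3 := by ring
      _ ≤ (250 * c₂) ^ 3 * Λ ^ 25 := by gcongr; norm_num
  have ha12 : 1 ≤ a ^ 2 := one_le_pow₀ ha1
  have ha23 : a ^ 2 ≤ a ^ 3 := pow_le_pow_right₀ ha1 (by norm_num)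
  have ha13 : a ≤ a ^ 3 := le_self_pow₀ ha1 (by norm_num)
  refine ⟨h / Real.sqrt m, D + 1, D, N, by positivity, ?_, ?_, ?_, ?_, hW⟩
  · have e1 : m ^ (1 / 4 : ℝ) = m ^ (3 / 4 : ℝ) / Real.sqrt m := by
      rw [Real.sqrt_eq_rpow, ← Real.rpow_sub hm]; norm_num
    have e2 : m ^ (1 / 4 : ℝ) / (2 * K ^ (3 / 4 : ℝ))
        = 1 / (2 * (K / m) ^ (3 / 4 : ℝ)) / Real.sqrt m := by
      rw [e1, Real.div_rpow hK.le hm.le]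
      have : 0 < m ^ (3 / 4 : ℝ) := by positivity
      have : 0 < K ^ (3 / 4 : ℝ) := by positivity
      field_simp
    rw [e2]
    refine div_le_div_of_nonneg_right ?_ (Real.sqrt_nonneg m)
    -- Here the summand κ^(3/2) of b² is used in full, for the prescribed bound on the step size.
    have h1 : (K / m) ^ (3 / 4 : ℝ) ≤ b := by
      refine abs_le_of_sq_le_sq' ?_ hb.le |>.2
      rw [H.sq_b, ← Real.rpow_natCast, ← Real.rpow_mul (by positivity)]
      norm_num
      linarith
    have h2 : 0 < (K / m) ^ (3 / 4 : ℝ) := by positivity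
    rw [le_div_iff₀ (by positivity)]
    have h3 : h * (K / m) ^ (3 / 4 : ℝ) ≤ h * b := mul_le_mul_of_nonneg_left h1 hh.le
    linarith [H.h_mul_b_le, H.c_bounds.1]
  · have e1 : 401 * (c₂ * Λ) * (1 / h ^ 2) = 401 * c₂ ^ 25 / c ^ 2 * b ^ 2 * Λ ^ 25 := by
      rw [H.h_eq]; field_simp
    -- The summand 1 in b² is absorbed by κ^(3/2) ≥ 1.
    have e2 : b ^ 2 ≤ 2 * ((K / m) ^ (3 / 2 : ℝ) + τ / m) := by rw [H.sq_b]; linarith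
    calc (N : ℝ) ≤ 401 * c₂ ^ 25 / c ^ 2 * b ^ 2 * Λ ^ 25 := hN.trans_eq e1
      _ ≤ 401 * c₂ ^ 25 / c ^ 2 * (2 * ((K / m) ^ (3 / 2 : ℝ) + τ / m)) * Λ ^ 25 := by gcongr
      _ = 802 * c₂ ^ 25 / c ^ 2 * ((K / m) ^ (3 / 2 : ℝ) + τ / m) * Λ ^ 25 := by ring
      _ ≤ _ := by
          gcongr
          exact le_add_of_nonneg_right (by positivity)
  · rw [iterationTime_eq]
    push_cast
    rw [← ha]
    have e1 : 1 + 2 * a + D * (4 * a + 4 * a ^ 2) + 2 * a ≤ 13 * a ^ 3 := by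
      have : D * (4 * a + 4 * a ^ 2) ≤ a * (4 * a + 4 * a ^ 2) := by gcongr; linarith
      nlinarith
    calc d * (1 + 2 * a + D * (4 * a + 4 * a ^ 2) + 2 * a)
        ≤ d * (13 * ((250 * c₂) ^ 3 * Λ ^ 25)) := by gcongr; linarith
      _ = 13 * (250 * c₂) ^ 3 * d * Λ ^ 25 := by ring
      _ ≤ _ := by
          gcongr
          exact le_add_of_nonneg_left (by positivity)
  · rw [iterationGradEvals_eq]
    push_cast
    rw [← ha]
    have e1 : D * a ≤ a ^ 2 := by rw [sq]; gcongr; linarith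
    calc D * a ≤ 13 * (250 * c₂) ^ 3 * Λ ^ 25 := by nlinarith
      _ ≤ _ := by
          gcongr
          exact le_add_of_nonneg_left (by positivity)
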